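/- Let $G$ be a compact Hausdorff group. For a C*-algebra $A$ with a (strongly continuous) action $\alpha$ of $G$, let $\mathrm{Cu}^G(A,\alpha)$ be the equivariant Cuntz semigroup: the set of classes $[a]$ of positive elements $a\in (K(H_\mu)\otimes A)^G$, where $\mu$ runs through the strongly continuous unitary representations of $G$ on separable Hilbert spaces $H_\mu$ and $K(H_\mu)\otimes A$ carries the action $\mathrm{Ad}(\mu)\otimes\alpha$. For $a\in (K(H_\mu)\otimes A)^G$ and $b\in(K(H_\nu)\otimes A)^G$ write $a\precsim_G b$ if there are $G$-invariant $d_n\in K(H_\nu,H_\mu)\otimes A$ with $d_nbd_n^*\to a$; then $[a]\le[b]$ means $a\precsim_G b$, and $[a]=[b]$ means $a\precsim_G b\precsim_G a$. Addition is $[a]+[b]=[a\oplus b]$. The semiring $\mathrm{Cu}(G)$ of unitary equivalence classes of separable representations acts by $[\nu]\cdot[a]=[s_\nu\otimes a]$, with $s_\nu\in K(H_\nu)^G$ any strictly positive element. An equivariant $*$-homomorphism $\psi$ induces $\mathrm{Cu}^G(\psi)[a]=[(\mathrm{id}\otimes\psi)(a)]$. A $\mathbf{CCu}^G$-morphism is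 an order preserving $\mathrm{Cu}(G)$-semimodule homomorphism that preserves $0$, suprema of increasing sequences and the relation $\ll$ (where $s\ll t$ means: whenever $(t_n)_n$ is increasing with a supremum and $t\le\sup_n t_n$, then $s\le t_n$ for some $n$). A $\mathbf{CCu}^G$-isomorphism is a $\mathbf{CCu}^G$-morphism with an inverse $\mathbf{CCu}^G$-morphism. (1) Give $\ell^2(\mathbb N)$ the trivial representation of $G$, let $K=K(\ell^2(\mathbb N))$ and let $q\in K$ be a rank one projection. For every C*-algebra $A$ with an action $\alpha$ of $G$ let $\iota_q\colon A\to A\otimes K$, $\iota_q(a)=a\otimes q$. Then $\mathrm{Cu}^G(\iota_q)\colon \mathrm{Cu}^G(A,\alpha)\to\mathrm{Cu}^G(A\otimes K,\alpha\otimes\mathrm{id}_K)$ is a $\mathbf{CCu}^G$-isomorphism, natural in $(A,\alpha)$ with respect to equivariant $*$-homomorphisms. (2) Let $\mu\colon G\to U(H_\mu)$ be a separable unitary representation, let $q\in K(H_\mu)$ be a rank one projection, and let $A$ be a unital C*-algebra with an action $\alpha$ of $G$. Put $B=A\otimes K(H_\mu)$. Recall that a positive invariant element $a$ over $B$ corresponds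 to the equivariant Hilbert $B$-module $E_a=\overline{a(H_\nu\otimes B)}$, so that elements of $\mathrm{Cu}^G(B,\cdot)$ may be written as classes $[(E,\rho)]$ of equivariant Hilbert modules. Let $\omega_g=1\otimes\mu_g$ be the unitary cocycle relating $\alpha\otimes\mathrm{Ad}(\mu)$ and $\alpha\otimes\mathrm{id}$. There is a unique $\mathbf{CCu}^G$-isomorphism $$\varepsilon\colon \mathrm{Cu}^G(B,\alpha\otimes\mathrm{Ad}(\mu))\to \mathrm{Cu}^G(B,\alpha\otimes\mathrm{id}),\qquad \varepsilon[(E,\rho)]=[(E,\rho^\omega)],\quad \rho^\omega_g(x)=\rho_g(x)\,\omega_g .$$ With $\iota_q\colon A\to B$, $\iota_q(a)=a\otimes q$, which is equivariant for $\alpha$ and $\alpha\otimes\mathrm{id}$, the composition $$\varepsilon^{-1}\circ\mathrm{Cu}^G(\iota_q)\colon \mathrm{Cu}^G(A,\alpha)\to\mathrm{Cu}^G(A\otimes K(H_\mu),\alpha\otimes\mathrm{Ad}(\mu))$$ is a $\mathbf{CCu}^G$-isomorphism, and it is natural in the unital C*-algebra $A$ with action $\alpha$, with respect to equivariant $*$-homomorphisms.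 -/

import Mathlib

universe u v

open scoped TensorProduct Topology

noncomputable section
namespace EqCuntz

section CStarTensor

/-- A C*-seminorm on the algebraic tensor product `A ⊗ B`. -/
structure IsCStarSeminorm {A B : Type*} [NonUnitalCStarAlgebra A] [NonUnitalCStarAlgebra B]
    (p : Seminorm ℂ (A ⊗[ℂ] B)) : Prop where
  mul_le : ∀ x y, p (x * y) ≤ p x * p y
  star_mul_self : ∀ x, p (star x * x) = p x * p x
  tmul_le : ∀ a b, p (a ⊗ₜ[ℂ] b) ≤ ‖a‖ * ‖b‖

variable {A B : Type*} [NonUnitalCStarAlgebra A] [NonUnitalCStarAlgebra B]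

theorem isCStarSeminorm_zero : IsCStarSeminorm (0 : Seminorm ℂ (A ⊗[ℂ] B)) where
  mul_le := by simp
  star_mul_self := by simp
  tmul_le a b := by simpa using by positivity

theorem IsCStarSeminorm.star_eq {p : Seminorm ℂ (A ⊗[ℂ] B)} (hp : IsCStarSeminorm p)
    (x : A ⊗[ℂ] B) : p (star x) = p x := by
  have key : ∀ y : A ⊗[ℂ] B, p y ≤ p (star y) := by
    intro y
    by_contra! h
    have h1 : p y * p y ≤ p (star y) * p y := by
      rw [← hp.star_mul_self]; exact hp.mul_le _ _
    have h0 : 0 < p y := lt_of_le_of_lt (apply_nonneg p _) h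
    nlinarith
  refine le_antisymm ?_ (key x)
  simpa using key (star x)

theorem exists_bound (x : A ⊗[ℂ] B) :
    ∃ C : ℝ, ∀ p : Seminorm ℂ (A ⊗[ℂ] B), IsCStarSeminorm p → p x ≤ C := by
  induction x using TensorProduct.induction_on with
  | zero => exact ⟨0, fun p _ => by simp⟩
  | tmul a b => exact ⟨_, fun p hp => hp.tmul_le a b⟩
  | add x y hx hy =>
    obtain ⟨C, hC⟩ := hx
    obtain ⟨D, hD⟩ := hy
    exact ⟨C + D, fun p hp => (map_add_le_add p x y).trans (add_le_add (hC p hp) (hD p hp))⟩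

/-- The largest C*-seminorm on the algebraic tensor product `A ⊗ B`. -/
def maxNorm (x : A ⊗[ℂ] B) : ℝ :=
  ⨆ p : {p : Seminorm ℂ (A ⊗[ℂ] B) // IsCStarSeminorm p}, p.1 x

instance : Nonempty {p : Seminorm ℂ (A ⊗[ℂ] B) // IsCStarSeminorm p} := ⟨⟨0, isCStarSeminorm_zero⟩⟩

theorem bddAbove_maxNorm (x : A ⊗[ℂ] B) :
    BddAbove (Set.range fun p : {p : Seminorm ℂ (A ⊗[ℂ] B) // IsCStarSeminorm p} => p.1 x) := by
  obtain ⟨C, hC⟩ := exists_bound x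
  exact ⟨C, by rintro _ ⟨p, rfl⟩; exact hC p.1 p.2⟩

theorem le_maxNorm {p : Seminorm ℂ (A ⊗[ℂ] B)} (hp : IsCStarSeminorm p) (x : A ⊗[ℂ] B) :
    p x ≤ maxNorm x :=
  le_ciSup (bddAbove_maxNorm x) ⟨p, hp⟩

theorem maxNorm_le {x : A ⊗[ℂ] B} {C : ℝ}
    (h : ∀ p : Seminorm ℂ (A ⊗[ℂ] B), IsCStarSeminorm p → p x ≤ C) : maxNorm x ≤ C :=
  ciSup_le fun p => h p.1 p.2

theorem maxNorm_nonneg (x : A ⊗[ℂ] B) : 0 ≤ maxNorm x := by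
  simpa using le_maxNorm isCStarSeminorm_zero x

theorem maxNorm_mul_le (x y : A ⊗[ℂ] B) : maxNorm (x * y) ≤ maxNorm x * maxNorm y :=
  maxNorm_le fun p hp => (hp.mul_le x y).trans
    (mul_le_mul (le_maxNorm hp x) (le_maxNorm hp y) (apply_nonneg p y) (maxNorm_nonneg x))

theorem maxNorm_star (x : A ⊗[ℂ] B) : maxNorm (star x) = maxNorm x := by
  unfold maxNorm
  exact iSup_congr fun p => p.2.star_eq x

theorem maxNorm_star_mul_self (x : A ⊗[ℂ] B) :
    maxNorm (star x * x) = maxNorm x * maxNorm x := by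
  apply le_antisymm
  · simpa [maxNorm_star] using maxNorm_mul_le (star x) x
  · have h : maxNorm x ≤ Real.sqrt (maxNorm (star x * x)) := maxNorm_le fun p hp => by
      apply Real.le_sqrt_of_sq_le
      rw [sq, ← hp.star_mul_self]
      exact le_maxNorm hp _
    calc maxNorm x * maxNorm x
        ≤ Real.sqrt (maxNorm (star x * x)) * Real.sqrt (maxNorm (star x * x)) :=
          mul_le_mul h h (maxNorm_nonneg x) (Real.sqrt_nonneg _)
      _ = _ := Real.mul_self_sqrt (maxNorm_nonneg _)

variable (A B) in
/-- The algebraic tensor product of two C*-algebras, carrying the largest C*-seminorm. -/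
def AlgTensor : Type _ := A ⊗[ℂ] B

/-- Elementary tensors in the algebraic tensor product. -/
def AlgTensor.tmul (a : A) (b : B) : AlgTensor A B := a ⊗ₜ[ℂ] b

instance : NonUnitalRing (AlgTensor A B) := inferInstanceAs (NonUnitalRing (A ⊗[ℂ] B))
instance : StarRing (AlgTensor A B) := inferInstanceAs (StarRing (A ⊗[ℂ] B))
instance : Module ℂ (AlgTensor A B) := inferInstanceAs (Module ℂ (A ⊗[ℂ] B))
instance : StarModule ℂ (AlgTensor A B) := inferInstanceAs (StarModule ℂ (A ⊗[ℂ] B))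
instance : IsScalarTower ℂ (AlgTensor A B) (AlgTensor A B) :=
  inferInstanceAs (IsScalarTower ℂ (A ⊗[ℂ] B) (A ⊗[ℂ] B))
instance : SMulCommClass ℂ (AlgTensor A B) (AlgTensor A B) :=
  inferInstanceAs (SMulCommClass ℂ (A ⊗[ℂ] B) (A ⊗[ℂ] B))

instance : NonUnitalSeminormedRing (AlgTensor A B) :=
  { (inferInstance : NonUnitalRing (AlgTensor A B)),
    AddGroupSeminorm.toSeminormedAddCommGroup (E := AlgTensor A B)
      { toFun := maxNorm (A := A) (B := B)
        map_zero' := le_antisymm (maxNorm_le fun p _ => (map_zero p).le) (maxNorm_nonneg _)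
        add_le' := fun x y => maxNorm_le fun p hp => (map_add_le_add p x y).trans
          (add_le_add (le_maxNorm hp x) (le_maxNorm hp y))
        neg' := fun x => iSup_congr fun p => map_neg_eq_map p.1 x } with
    norm_mul_le := maxNorm_mul_le }

theorem AlgTensor.norm_def (x : AlgTensor A B) : ‖x‖ = maxNorm (A := A) (B := B) x := rfl

instance : NormedSpace ℂ (AlgTensor A B) where
  norm_smul_le c x := maxNorm_le fun p hp => by
    refine (map_smul_eq_mul p c (show A ⊗[ℂ] B from x)).le.trans ?_
    exact mul_le_mul_of_nonneg_left (le_maxNorm hp x) (norm_nonneg c)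

instance : NormedStarGroup (AlgTensor A B) where
  norm_star_le x := (maxNorm_star (A := A) (B := B) x).le

variable (A B) in
/-- The C*-tensor product: the completion of the algebraic tensor product in the largest
C*-(semi)norm. If one of the factors is nuclear, as the compact operators are, this is the only
C*-norm on the algebraic tensor product. -/
def CTensor : Type _ := UniformSpace.Completion (AlgTensor A B)

namespace CTensor

instance : NormedAddCommGroup (CTensor A B) :=
  inferInstanceAs (NormedAddCommGroup (UniformSpace.Completion (AlgTensor A B)))
instance : NormedSpace ℂ (CTensor A B) :=
  inferInstanceAs (NormedSpace ℂ (UniformSpace.Completion (AlgTensor A B)))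
instance : CompleteSpace (CTensor A B) :=
  inferInstanceAs (CompleteSpace (UniformSpace.Completion (AlgTensor A B)))

variable (A B) in
/-- The canonical map of the algebraic tensor product into its completion. -/
def incl : AlgTensor A B →L[ℂ] CTensor A B := UniformSpace.Completion.toComplL

theorem norm_incl (x : AlgTensor A B) : ‖incl A B x‖ = ‖x‖ := UniformSpace.Completion.norm_coe x

theorem denseRange_incl : DenseRange (incl A B) := UniformSpace.Completion.denseRange_coe

@[elab_as_elim]
theorem induction {P : CTensor A B → Prop} (x : CTensor A B) (hc : IsClosed {x | P x})
    (h : ∀ x, P (incl A B x)) : P x :=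
  denseRange_incl.induction_on x hc h

/-- Extension of a bounded linear map from the algebraic tensor product to the completion. -/
def extend {E : Type*} [NormedAddCommGroup E] [NormedSpace ℂ E] [CompleteSpace E]
    (f : AlgTensor A B →L[ℂ] E) : CTensor A B →L[ℂ] E := f.fromCompletion

@[simp]
theorem extend_incl {E : Type*} [NormedAddCommGroup E] [NormedSpace ℂ E] [CompleteSpace E]
    (f : AlgTensor A B →L[ℂ] E) (x : AlgTensor A B) : extend f (incl A B x) = f x :=
  f.fromCompletion_apply_coe x

theorem norm_extend_le {E : Type*} [NormedAddCommGroup E] [NormedSpace ℂ E] [CompleteSpace E]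
    (f : AlgTensor A B →L[ℂ] E) {C : ℝ} (h : ∀ x, ‖f x‖ ≤ C * ‖x‖) (x : CTensor A B) :
    ‖extend f x‖ ≤ C * ‖x‖ := by
  induction x using CTensor.induction with
  | hc => exact isClosed_le (by fun_prop) (by fun_prop)
  | h x => rw [extend_incl, norm_incl]; exact h x

/-- Multiplication of an element of the algebraic tensor product with one of the completion. -/
def mulAux : AlgTensor A B →L[ℂ] CTensor A B →L[ℂ] CTensor A B :=
  LinearMap.mkContinuous
    { toFun := fun x => extend ((incl A B).comp (ContinuousLinearMap.mul ℂ (AlgTensor A B) x))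
      map_add' := fun x y => by
        ext z
        induction z using CTensor.induction with
        | hc => exact isClosed_eq (by fun_prop) (by fun_prop)
        | h z => simp
      map_smul' := fun c x => by
        ext z
        induction z using CTensor.induction with
        | hc => exact isClosed_eq (ContinuousLinearMap.continuous _) (ContinuousLinearMap.continuous _)
        | h z => simp } 1 (fun x => by
    rw [one_mul]
    refine ContinuousLinearMap.opNorm_le_bound _ (norm_nonneg x) fun z => ?_
    refine norm_extend_le _ (fun y => ?_) z
    simpa [norm_incl] using norm_mul_le x y)

/-- Multiplication on the completion as a bounded bilinear map. -/
def mulL : CTensor A B →L[ℂ] CTensor A B →L[ℂ] CTensor A B := extend mulAux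

instance : Mul (CTensor A B) := ⟨fun x y => mulL x y⟩

theorem mul_def (x y : CTensor A B) : x * y = mulL x y := rfl

theorem incl_mul (x y : AlgTensor A B) : incl A B (x * y) = incl A B x * incl A B y := by
  simp [mul_def, mulL, mulAux]

theorem continuous_mul' : Continuous fun p : CTensor A B × CTensor A B => p.1 * p.2 := by
  simp only [mul_def]; fun_prop

/-- The involution on the completion. -/
def starAux : CTensor A B → CTensor A B := UniformSpace.Completion.map star

instance : Star (CTensor A B) := ⟨starAux⟩

theorem uniformContinuous_star' : UniformContinuous (star : AlgTensor A B → AlgTensor A B) :=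
  (AddMonoidHomClass.isometry_of_norm (starAddEquiv : AlgTensor A B ≃+ AlgTensor A B)
    (fun x => norm_star x)).uniformContinuous

theorem continuous_star' : Continuous (star : CTensor A B → CTensor A B) :=
  UniformSpace.Completion.continuous_map

theorem incl_star (x : AlgTensor A B) : incl A B (star x) = star (incl A B x) :=
  (UniformSpace.Completion.map_coe uniformContinuous_star' x).symm

instance : NonUnitalCStarAlgebra (CTensor A B) :=
  haveI : ContinuousMul (CTensor A B) := ⟨continuous_mul'⟩
  haveI : ContinuousStar (CTensor A B) := ⟨continuous_star'⟩
  { (inferInstance : NormedAddCommGroup (CTensor A B)),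
    (inferInstance : NormedSpace ℂ (CTensor A B)),
    (inferInstance : CompleteSpace (CTensor A B)) with
    left_distrib := fun x y z => by simp only [mul_def, map_add]
    right_distrib := fun x y z => by simp [mul_def]
    zero_mul := fun x => by simp [mul_def]
    mul_zero := fun x => by simp [mul_def]
    mul_assoc := fun x y z => by
      induction x using CTensor.induction with
      | hc => exact isClosed_eq (by fun_prop) (by fun_prop)
      | h x =>
        induction y using CTensor.induction with
        | hc => exact isClosed_eq (by fun_prop) (by fun_prop)
        | h y =>
          induction z using CTensor.induction with
          | hc => exact isClosed_eq (by fun_prop) (by fun_prop)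
          | h z => simp only [← incl_mul, mul_assoc]
    norm_mul_le := fun x y => by
      induction x using CTensor.induction with
      | hc => exact isClosed_le (by fun_prop) (by fun_prop)
      | h x =>
        induction y using CTensor.induction with
        | hc => exact isClosed_le (by fun_prop) (by fun_prop)
        | h y => simpa only [← incl_mul, norm_incl] using norm_mul_le x y
    star_involutive := fun x => by
      induction x using CTensor.induction with
      | hc => exact isClosed_eq (by fun_prop) (by fun_prop)
      | h x => simp only [← incl_star, star_star]
    star_mul := fun x y => by
      induction x using CTensor.induction with
      | hc => exact isClosed_eq (by fun_prop) (by fun_prop)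
      | h x =>
        induction y using CTensor.induction with
        | hc => exact isClosed_eq (by fun_prop) (by fun_prop)
        | h y => simp only [← incl_mul, ← incl_star, star_mul]
    star_add := fun x y => by
      induction x using CTensor.induction with
      | hc => exact isClosed_eq (by fun_prop) (by fun_prop)
      | h x =>
        induction y using CTensor.induction with
        | hc => exact isClosed_eq (by fun_prop) (by fun_prop)
        | h y => simp only [← map_add, ← incl_star, star_add]
    norm_mul_self_le := fun x => by
      induction x using CTensor.induction with
      | hc => exact isClosed_le (by fun_prop) (by fun_prop)
      | h x =>
        simp only [← incl_mul, ← incl_star, norm_incl]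
        exact (maxNorm_star_mul_self (A := A) (B := B) x).ge
    smul_assoc := fun c x y => by simp [smul_eq_mul, mul_def]
    smul_comm := fun c x y => by simp [smul_eq_mul, mul_def]
    star_smul := fun c x => by
      induction x using CTensor.induction with
      | hc => exact isClosed_eq (continuous_star'.comp (continuous_const_smul c)) (continuous_star'.const_smul (star c))
      | h x => simp only [← map_smul, ← incl_star, star_smul] }

/-- The elementary tensor `a ⊗ b`. -/
def tmul (a : A) (b : B) : CTensor A B := incl A B (AlgTensor.tmul a b)

theorem tmul_mul_tmul (a a' : A) (b b' : B) :
    tmul a b * tmul a' b' = tmul (a * a') (b * b') :=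
  (incl_mul (AlgTensor.tmul a b) (AlgTensor.tmul a' b')).symm.trans
    (congrArg (incl A B) (Algebra.TensorProduct.tmul_mul_tmul a a' b b'))

theorem star_tmul (a : A) (b : B) : star (tmul a b) = tmul (star a) (star b) :=
  (incl_star _).symm

theorem norm_tmul_le (a : A) (b : B) : ‖tmul a b‖ ≤ ‖a‖ * ‖b‖ :=
  (norm_incl _).le.trans (maxNorm_le fun _ hp => hp.tmul_le a b)

theorem add_tmul (a a' : A) (b : B) : tmul (a + a') b = tmul a b + tmul a' b :=
  (congrArg (incl A B) (TensorProduct.add_tmul a a' b)).trans (map_add (incl A B) _ _)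

theorem tmul_add (a : A) (b b' : B) : tmul a (b + b') = tmul a b + tmul a b' :=
  (congrArg (incl A B) (TensorProduct.tmul_add a b b')).trans (map_add (incl A B) _ _)

theorem smul_tmul' (c : ℂ) (a : A) (b : B) : tmul (c • a) b = c • tmul a b :=
  map_smul (incl A B) c (AlgTensor.tmul a b)

theorem tmul_smul (c : ℂ) (a : A) (b : B) : tmul a (c • b) = c • tmul a b :=
  (congrArg (incl A B) (TensorProduct.tmul_smul c a b)).trans
    (map_smul (incl A B) c (AlgTensor.tmul a b))

/-- Finite sums of elementary tensors are dense. -/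
@[elab_as_elim]
theorem induction_tmul {P : CTensor A B → Prop} (x : CTensor A B) (hc : IsClosed {x | P x})
    (h0 : P 0) (hadd : ∀ x y, P x → P y → P (x + y)) (h : ∀ a b, P (tmul a b)) : P x := by
  induction x using CTensor.induction with
  | hc => exact hc
  | h x =>
    refine TensorProduct.induction_on (motive := fun x : A ⊗[ℂ] B => P (incl A B x)) x ?_ ?_ ?_
    · exact (map_zero (incl A B)).symm ▸ h0
    · exact h
    · intro x y hx hy
      exact (map_add (incl A B) x y).symm ▸ hadd _ _ hx hy

variable {A' B' : Type*} [NonUnitalCStarAlgebra A'] [NonUnitalCStarAlgebra B']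

/-- The tensor product of two `*`-homomorphisms on algebraic tensor products. -/
def mapAlg (φ : A →⋆ₙₐ[ℂ] A') (ψ : B →⋆ₙₐ[ℂ] B') : A ⊗[ℂ] B →ₗ[ℂ] A' ⊗[ℂ] B' :=
  TensorProduct.map (LinearMapClass.linearMap φ) (LinearMapClass.linearMap ψ)

theorem mapAlg_tmul (φ : A →⋆ₙₐ[ℂ] A') (ψ : B →⋆ₙₐ[ℂ] B') (a : A) (b : B) :
    mapAlg φ ψ (a ⊗ₜ[ℂ] b) = φ a ⊗ₜ[ℂ] ψ b := rfl

theorem mapAlg_mul (φ : A →⋆ₙₐ[ℂ] A') (ψ : B →⋆ₙₐ[ℂ] B') (x y : A ⊗[ℂ] B) :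
    mapAlg φ ψ (x * y) = mapAlg φ ψ x * mapAlg φ ψ y := by
  induction x using TensorProduct.induction_on with
  | zero => simp
  | add x x' hx hx' => simp only [add_mul, map_add, hx, hx']
  | tmul a b =>
    induction y using TensorProduct.induction_on with
    | zero => simp
    | add y y' hy hy' => simp only [mul_add, map_add, hy, hy']
    | tmul a' b' => simp [mapAlg_tmul]

theorem mapAlg_star (φ : A →⋆ₙₐ[ℂ] A') (ψ : B →⋆ₙₐ[ℂ] B') (x : A ⊗[ℂ] B) :
    mapAlg φ ψ (star x) = star (mapAlg φ ψ x) := by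
  induction x using TensorProduct.induction_on with
  | zero => simp
  | add x x' hx hx' => simp only [star_add, map_add, hx, hx']
  | tmul a b => simp [mapAlg_tmul, map_star]

theorem maxNorm_mapAlg_le (φ : A →⋆ₙₐ[ℂ] A') (ψ : B →⋆ₙₐ[ℂ] B') (x : A ⊗[ℂ] B) :
    maxNorm (mapAlg φ ψ x) ≤ maxNorm x :=
  maxNorm_le fun p hp => by
    refine le_maxNorm (p := p.comp (mapAlg φ ψ)) ⟨fun x y => ?_, fun x => ?_, fun a b => ?_⟩ x
    · simp only [Seminorm.comp_apply, mapAlg_mul]; exact hp.mul_le _ _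
    · simp only [Seminorm.comp_apply, mapAlg_mul, mapAlg_star]; exact hp.star_mul_self _
    · simp only [Seminorm.comp_apply, mapAlg_tmul]
      exact (hp.tmul_le _ _).trans (mul_le_mul (NonUnitalStarAlgHom.norm_apply_le φ a)
        (NonUnitalStarAlgHom.norm_apply_le ψ b) (norm_nonneg _) (norm_nonneg _))

/-- `mapAlg` as a contraction for the largest C*-norms. -/
def mapAlgL (φ : A →⋆ₙₐ[ℂ] A') (ψ : B →⋆ₙₐ[ℂ] B') : AlgTensor A B →L[ℂ] AlgTensor A' B' :=
  LinearMap.mkContinuous (E := AlgTensor A B) (F := AlgTensor A' B') (σ := RingHom.id ℂ)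
    (mapAlg φ ψ) 1 (fun x => by
      rw [one_mul]; exact maxNorm_mapAlg_le φ ψ x)

/-- The tensor product `φ ⊗ ψ` of two `*`-homomorphisms. -/
def map (φ : A →⋆ₙₐ[ℂ] A') (ψ : B →⋆ₙₐ[ℂ] B') : CTensor A B →⋆ₙₐ[ℂ] CTensor A' B' where
  toFun := extend ((incl A' B').comp (mapAlgL φ ψ))
  map_smul' c x := by simp
  map_zero' := by simp
  map_add' x y := by simp
  map_mul' x y := by
    induction x using CTensor.induction with
    | hc => exact isClosed_eq (by fun_prop) (by fun_prop)
    | h x =>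
      induction y using CTensor.induction with
      | hc => exact isClosed_eq (by fun_prop) (by fun_prop)
      | h y =>
        rw [← incl_mul]
        simp only [extend_incl, ContinuousLinearMap.comp_apply, ← incl_mul]
        exact congrArg _ (mapAlg_mul φ ψ x y)
  map_star' x := by
    induction x using CTensor.induction with
    | hc => exact isClosed_eq (by fun_prop) (by fun_prop)
    | h x =>
      rw [← incl_star]
      simp only [extend_incl, ContinuousLinearMap.comp_apply, ← incl_star]
      exact congrArg _ (mapAlg_star φ ψ x)

theorem continuous_map (φ : A →⋆ₙₐ[ℂ] A') (ψ : B →⋆ₙₐ[ℂ] B') : Continuous (map φ ψ) :=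
  (extend ((incl A' B').comp (mapAlgL φ ψ))).continuous

@[simp]
theorem map_tmul (φ : A →⋆ₙₐ[ℂ] A') (ψ : B →⋆ₙₐ[ℂ] B') (a : A) (b : B) :
    map φ ψ (tmul a b) = tmul (φ a) (ψ b) :=
  extend_incl ((incl A' B').comp (mapAlgL φ ψ)) _

theorem hom_ext {D : Type*} [NonUnitalCStarAlgebra D] {f g : CTensor A B →⋆ₙₐ[ℂ] D}
    (h : ∀ a b, f (tmul a b) = g (tmul a b)) : f = g := by
  have cont : ∀ f : CTensor A B →⋆ₙₐ[ℂ] D, Continuous f := fun f =>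
    AddMonoidHomClass.continuous_of_bound f 1 fun x => by
      simpa using NonUnitalStarAlgHom.norm_apply_le f x
  ext x
  induction x using CTensor.induction_tmul with
  | hc => exact isClosed_eq (cont f) (cont g)
  | h0 => simp
  | hadd x y hx hy => simp [hx, hy]
  | h a b => exact h a b

theorem map_id : map (NonUnitalStarAlgHom.id ℂ A) (NonUnitalStarAlgHom.id ℂ B) =
    NonUnitalStarAlgHom.id ℂ (CTensor A B) := hom_ext fun a b => by simp

theorem map_comp_map {A'' B'' : Type*} [NonUnitalCStarAlgebra A''] [NonUnitalCStarAlgebra B'']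
    (φ' : A' →⋆ₙₐ[ℂ] A'') (ψ' : B' →⋆ₙₐ[ℂ] B'') (φ : A →⋆ₙₐ[ℂ] A') (ψ : B →⋆ₙₐ[ℂ] B') :
    (map φ' ψ').comp (map φ ψ) = map (φ'.comp φ) (ψ'.comp ψ) := hom_ext fun a b => by simp

theorem map_map {A'' B'' : Type*} [NonUnitalCStarAlgebra A''] [NonUnitalCStarAlgebra B'']
    (φ' : A' →⋆ₙₐ[ℂ] A'') (ψ' : B' →⋆ₙₐ[ℂ] B'') (φ : A →⋆ₙₐ[ℂ] A') (ψ : B →⋆ₙₐ[ℂ] B')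
    (x : CTensor A B) : map φ' ψ' (map φ ψ x) = map (φ'.comp φ) (ψ'.comp ψ) x :=
  congrArg (fun f => f x) (map_comp_map φ' ψ' φ ψ)

end CTensor

end CStarTensor

section Compacts

variable {H H₁ H₂ H₃ : Type*} [NormedAddCommGroup H] [InnerProductSpace ℂ H] [CompleteSpace H]
  [NormedAddCommGroup H₁] [InnerProductSpace ℂ H₁] [CompleteSpace H₁]
  [NormedAddCommGroup H₂] [InnerProductSpace ℂ H₂] [CompleteSpace H₂]
  [NormedAddCommGroup H₃] [InnerProductSpace ℂ H₃] [CompleteSpace H₃]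

/-- The adjoint of a compact operator is compact. -/
theorem isCompactOperator_star {T : H →L[ℂ] H} (hT : IsCompactOperator T) :
    IsCompactOperator (star T : H →L[ℂ] H) := by
  have h2 : IsCompactOperator (T * star T : H →L[ℂ] H) := hT.comp_clm (star T)
  have h3 : TotallyBounded ((T * star T : H →L[ℂ] H) '' Metric.closedBall 0 1) :=
    (h2.isCompact_closure_image_closedBall (𝕜₁ := ℂ)
      (f := ((T * star T : H →L[ℂ] H) : H →ₗ[ℂ] H)) 1).totallyBounded.subset subset_closure
  refine (isCompactOperator_iff_isCompact_closure_image_closedBall (𝕜₁ := ℂ)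
    ((star T : H →L[ℂ] H) : H →ₗ[ℂ] H) zero_lt_one).2 ?_
  refine TotallyBounded.isCompact_of_isClosed (TotallyBounded.closure ?_) isClosed_closure
  rw [Metric.totallyBounded_iff]
  intro ε hε
  obtain ⟨t, hts, htf, ht⟩ := totallyBounded_iff_subset.1 h3 _
    (Metric.dist_mem_uniformity (show 0 < ε ^ 2 / 2 by positivity))
  choose! f hf hf' using fun y (hy : y ∈ t) => hts hy
  refine ⟨(fun y => (star T : H →L[ℂ] H) (f y)) '' t, htf.image _, ?_⟩
  rintro _ ⟨x, hx, rfl⟩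
  have := ht ⟨x, hx, rfl⟩
  simp only [Set.mem_iUnion, Set.mem_ofPred_eq] at this
  obtain ⟨y, hy, hxy⟩ := this
  simp only [Set.mem_iUnion]
  refine ⟨_, ⟨y, hy, rfl⟩, ?_⟩
  rw [Metric.mem_ball, dist_eq_norm]
  rw [← hf' y hy, dist_eq_norm, ← map_sub] at hxy
  change ‖(star T : H →L[ℂ] H) x - (star T : H →L[ℂ] H) (f y)‖ < ε
  rw [← map_sub]
  have hx1 : ‖x‖ ≤ 1 := by simpa using hx
  have hy1 : ‖f y‖ ≤ 1 := by simpa using hf y hy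
  have hz : ‖x - f y‖ ≤ 2 := (norm_sub_le _ _).trans (by linarith)
  set z := x - f y
  have h4 : ‖(star T : H →L[ℂ] H) z‖ ^ 2 ≤ ‖(T * star T : H →L[ℂ] H) z‖ * ‖z‖ := by
    have h5 : inner ℂ ((T * star T : H →L[ℂ] H) z) z =
        inner ℂ ((star T : H →L[ℂ] H) z) ((star T : H →L[ℂ] H) z) := by
      rw [ContinuousLinearMap.star_eq_adjoint, ContinuousLinearMap.adjoint_inner_right]; rfl
    have h6 := norm_inner_le_norm (𝕜 := ℂ) ((T * star T : H →L[ℂ] H) z) z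
    rw [h5, inner_self_eq_norm_sq_to_K] at h6
    simpa using h6
  have h7 : ‖(star T : H →L[ℂ] H) z‖ ^ 2 < ε ^ 2 := by
    have := norm_nonneg ((T * star T : H →L[ℂ] H) z)
    nlinarith [norm_nonneg z]
  exact lt_of_pow_lt_pow_left₀ 2 hε.le h7

variable (H) in
/-- The compact operators on the Hilbert space `H` as a subalgebra of the bounded operators. -/
def compacts : NonUnitalStarSubalgebra ℂ (H →L[ℂ] H) where
  carrier := {T | IsCompactOperator T}
  add_mem' := fun h h' => IsCompactOperator.add h h'
  zero_mem' := isCompactOperator_zero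
  mul_mem' := fun {_ T} hS _ => IsCompactOperator.comp_clm hS T
  smul_mem' := fun c _ h => IsCompactOperator.smul h c
  star_mem' := isCompactOperator_star

instance : IsClosed (compacts H : Set (H →L[ℂ] H)) :=
  isClosed_setOfPred_isCompactOperator (σ₁₂ := RingHom.id ℂ) (M₁ := H) (M₂ := H)

variable (H) in
/-- The C*-algebra `K(H)` of compact operators on the Hilbert space `H`. -/
def K : Type _ := compacts H

instance : NonUnitalCStarAlgebra (K H) := inferInstanceAs (NonUnitalCStarAlgebra (compacts H))

/-- A compact operator as a bounded operator. -/
def K.op (T : K H) : H →L[ℂ] H := Subtype.val (p := (· ∈ compacts H)) T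

/-- Compact operators as elements of `K(H)`. -/
def K.ofOp (T : H →L[ℂ] H) (hT : IsCompactOperator T) : K H := ⟨T, hT⟩

theorem K.isCompact (T : K H) : IsCompactOperator T.op := T.2

theorem K.ext {S T : K H} (h : ∀ x, S.op x = T.op x) : S = T :=
  Subtype.ext (ContinuousLinearMap.ext h)

@[simp] theorem K.op_ofOp (T : H →L[ℂ] H) (hT : IsCompactOperator T) : (K.ofOp T hT).op = T := rfl
@[simp] theorem K.op_zero : (0 : K H).op = 0 := rfl
@[simp] theorem K.op_add (S T : K H) : (S + T).op = S.op + T.op := rfl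
@[simp] theorem K.op_sub (S T : K H) : (S - T).op = S.op - T.op := rfl
@[simp] theorem K.op_mul (S T : K H) : (S * T).op = S.op * T.op := rfl
@[simp] theorem K.op_smul (c : ℂ) (T : K H) : (c • T).op = c • T.op := rfl
@[simp] theorem K.op_star (T : K H) : (star T).op = star T.op := rfl
theorem K.norm_def (T : K H) : ‖T‖ = ‖T.op‖ := rfl

theorem isCompactOperator_conj (V : H₁ →ₗᵢ[ℂ] H₂) (T : K H₁) : IsCompactOperator
    (V.toContinuousLinearMap ∘L T.op ∘L V.toContinuousLinearMap.adjoint : H₂ →L[ℂ] H₂) :=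
  (T.isCompact.comp_clm _).clm_comp _

/-- For an isometry `V : H₁ → H₂`, the `*`-homomorphism `K(H₁) → K(H₂)`, `T ↦ V T V*`. -/
def adIsom (V : H₁ →ₗᵢ[ℂ] H₂) : K H₁ →⋆ₙₐ[ℂ] K H₂ where
  toFun T := K.ofOp (V.toContinuousLinearMap ∘L T.op ∘L V.toContinuousLinearMap.adjoint)
    (isCompactOperator_conj V T)
  map_smul' c T := by apply K.ext; simp
  map_zero' := by apply K.ext; simp
  map_add' S T := by apply K.ext; simp
  map_mul' S T := by
    apply K.ext
    intro x
    have h : ∀ y, V.toContinuousLinearMap.adjoint (V y) = y := fun y => by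
      refine ext_inner_right ℂ fun z => ?_
      rw [ContinuousLinearMap.adjoint_inner_left]
      exact V.inner_map_map y z
    simp [h]
  map_star' T := by
    apply K.ext
    simp [ContinuousLinearMap.star_eq_adjoint, ContinuousLinearMap.adjoint_comp]

theorem adIsom_op (V : H₁ →ₗᵢ[ℂ] H₂) (T : K H₁) (x : H₂) :
    (adIsom V T).op x = V (T.op (V.toContinuousLinearMap.adjoint x)) := rfl

theorem adIsom_id : adIsom (LinearIsometry.id : H →ₗᵢ[ℂ] H) = NonUnitalStarAlgHom.id ℂ (K H) := by
  refine NonUnitalStarAlgHom.ext fun T => K.ext fun x => ?_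
  have h : (LinearIsometry.id : H →ₗᵢ[ℂ] H).toContinuousLinearMap = 1 := rfl
  simp [adIsom_op, h, ← ContinuousLinearMap.star_eq_adjoint]

theorem adIsom_comp (V : H₂ →ₗᵢ[ℂ] H₃) (W : H₁ →ₗᵢ[ℂ] H₂) :
    (adIsom V).comp (adIsom W) = adIsom (V.comp W) := by
  refine NonUnitalStarAlgHom.ext fun T => K.ext fun x => ?_
  have h : (V.comp W).toContinuousLinearMap =
    V.toContinuousLinearMap ∘L W.toContinuousLinearMap := rfl
  simp [adIsom_op, h, ContinuousLinearMap.adjoint_comp]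

end Compacts

section Actions

variable {G : Type*} [Group G] [TopologicalSpace G]

theorem isClosed_setOf_continuous_orbit {X E F : Type*} [TopologicalSpace X]
    [PseudoMetricSpace E] [PseudoMetricSpace F] (f : X → E → F)
    (hf : ∀ g x y, dist (f g x) (f g y) ≤ dist x y) :
    IsClosed {x | Continuous fun g => f g x} := by
  refine isClosed_of_closure_subset fun x hx => ?_
  refine continuous_of_uniform_approx_of_continuous fun u hu => ?_
  obtain ⟨ε, hε, hεu⟩ := Metric.mem_uniformity_dist.1 hu
  obtain ⟨y, hy, hxy⟩ := Metric.mem_closure_iff.1 hx ε hε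
  exact ⟨_, hy, fun g => hεu ((hf g x y).trans_lt hxy)⟩

variable (G) in
/-- A (strongly continuous) action of the topological group `G` on the C*-algebra `A`. Since
`G` is a group, each `*`-endomorphism `α g` is an automorphism. -/
structure CAction (A : Type*) [NonUnitalCStarAlgebra A] where
  hom : G → A →⋆ₙₐ[ℂ] A
  map_one : hom 1 = NonUnitalStarAlgHom.id ℂ A
  map_mul : ∀ g h, hom (g * h) = (hom g).comp (hom h)
  continuous : ∀ a, Continuous fun g => hom g a

instance (A : Type*) [NonUnitalCStarAlgebra A] : CoeFun (CAction G A) fun _ => G → A →⋆ₙₐ[ℂ] A :=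
  ⟨CAction.hom⟩

/-- The trivial action. -/
def CAction.trivial (A : Type*) [NonUnitalCStarAlgebra A] : CAction G A where
  hom _ := NonUnitalStarAlgHom.id ℂ A
  map_one := rfl
  map_mul _ _ := rfl
  continuous _ := continuous_const

theorem dist_hom_le {A B : Type*} [NonUnitalCStarAlgebra A] [NonUnitalCStarAlgebra B]
    (φ : A →⋆ₙₐ[ℂ] B) (x y : A) : dist (φ x) (φ y) ≤ dist x y := by
  rw [dist_eq_norm, dist_eq_norm, ← map_sub]; exact NonUnitalStarAlgHom.norm_apply_le φ _

theorem continuous_tmul {A B : Type*} [NonUnitalCStarAlgebra A] [NonUnitalCStarAlgebra B] :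
    Continuous fun p : A × B => CTensor.tmul p.1 p.2 := by
  let L : A →ₗ[ℂ] B →ₗ[ℂ] CTensor A B := LinearMap.mk₂ ℂ CTensor.tmul CTensor.add_tmul
    CTensor.smul_tmul' CTensor.tmul_add CTensor.tmul_smul
  exact (L.mkContinuous₂ 1 fun a b => by
    rw [one_mul]; exact CTensor.norm_tmul_le a b).continuous₂

/-- The tensor product action `α ⊗ γ`. -/
def CAction.tensor {A B : Type*} [NonUnitalCStarAlgebra A] [NonUnitalCStarAlgebra B]
    (α : CAction G A) (γ : CAction G B) : CAction G (CTensor A B) where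
  hom g := CTensor.map (α g) (γ g)
  map_one := by rw [α.map_one, γ.map_one, CTensor.map_id]
  map_mul g h := by rw [α.map_mul, γ.map_mul, CTensor.map_comp_map]
  continuous x := by
    induction x using CTensor.induction_tmul with
    | hc => exact isClosed_setOf_continuous_orbit _ fun g => dist_hom_le _
    | h0 => simpa using continuous_const
    | hadd x y hx hy => simp only [_root_.map_add]; exact hx.add hy
    | h a b =>
      simp only [CTensor.map_tmul]
      exact continuous_tmul.comp ((α.continuous a).prodMk (γ.continuous b))

variable (G) in
/-- A strongly continuous unitary representation of `G` on a separable Hilbert space. -/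
structure SepRep where
  H : Type
  [normed : NormedAddCommGroup H]
  [inner : InnerProductSpace ℂ H]
  [complete : CompleteSpace H]
  [separable : TopologicalSpace.SeparableSpace H]
  U : G →* (H ≃ₗᵢ[ℂ] H)
  continuous : ∀ ξ, Continuous fun g => U g ξ

attribute [instance] SepRep.normed SepRep.inner SepRep.complete SepRep.separable

end Actions

section Actions
variable {G : Type*} [Group G] [TopologicalSpace G]

namespace SepRep

/-- The orbit maps of a representation are uniformly continuous on compact sets: for a compact
operator `S`, the map `g ↦ U_g S` is norm continuous. -/
theorem continuous_comp_compact (μ : SepRep G) {S : μ.H →L[ℂ] μ.H} (hS : IsCompactOperator S) :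
    Continuous fun g => (μ.U g).toLinearIsometry.toContinuousLinearMap ∘L S := by
  rw [continuous_iff_continuousAt]
  intro g₀
  rw [ContinuousAt, Metric.tendsto_nhds]
  intro ε hε
  have hC := hS.isCompact_closure_image_closedBall (𝕜₁ := ℂ) (f := (S : μ.H →ₗ[ℂ] μ.H)) 1
  have joint : Continuous fun p : G × μ.H => μ.U p.1 p.2 := by
    rw [continuous_iff_continuousAt]
    rintro ⟨g, x⟩
    rw [ContinuousAt, tendsto_iff_dist_tendsto_zero]
    have h1 : Filter.Tendsto (fun p : G × μ.H => dist p.2 x + dist (μ.U p.1 x) (μ.U g x))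
        (𝓝 (g, x)) (𝓝 0) := by
      have : Continuous fun p : G × μ.H => dist p.2 x + dist (μ.U p.1 x) (μ.U g x) := by
        have := (μ.continuous x).comp (continuous_fst (X := G) (Y := μ.H))
        exact (continuous_snd.dist continuous_const).add (this.dist continuous_const)
      simpa using this.tendsto (g, x)
    refine squeeze_zero (fun _ => dist_nonneg) (fun p => ?_) h1
    refine (dist_triangle _ (μ.U p.1 x) _).trans ?_
    rw [LinearIsometryEquiv.dist_map]
  have h2 : ∀ᶠ g in 𝓝 g₀, ∀ y ∈ closure ((S : μ.H →ₗ[ℂ] μ.H) '' Metric.closedBall 0 1),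
      dist (μ.U g y) (μ.U g₀ y) < ε / 2 := by
    refine hC.eventually_forall_of_forall_eventually fun y _ => ?_
    have : Continuous fun p : G × μ.H => dist (μ.U p.1 p.2) (μ.U g₀ p.2) :=
      joint.dist ((μ.U g₀).continuous.comp continuous_snd)
    exact (this.tendsto (g₀, y)).eventually (gt_mem_nhds (by simpa using half_pos hε))
  filter_upwards [h2] with g hg
  refine lt_of_le_of_lt ?_ (half_lt_self hε)
  rw [dist_eq_norm]
  refine ContinuousLinearMap.opNorm_le_bound _ (half_pos hε).le fun x => ?_
  by_cases hx : x = 0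
  · simp [hx]
  have hx' : ‖x‖ ≠ 0 := norm_ne_zero_iff.2 hx
  have h3 := hg (S ((‖x‖⁻¹ : ℂ) • x)) (subset_closure ⟨_, by simp [norm_smul, hx'], rfl⟩)
  rw [dist_eq_norm] at h3
  have h4 : ‖(((μ.U g).toLinearIsometry.toContinuousLinearMap ∘L S) -
      ((μ.U g₀).toLinearIsometry.toContinuousLinearMap ∘L S)) x‖ =
      ‖x‖ * ‖μ.U g (S ((‖x‖⁻¹ : ℂ) • x)) - μ.U g₀ (S ((‖x‖⁻¹ : ℂ) • x))‖ := by
    rw [map_smul, map_smul, map_smul, ← smul_sub, norm_smul]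
    simp only [norm_inv, Complex.norm_real, norm_norm]
    rw [← mul_assoc, mul_inv_cancel₀ hx', one_mul]
    rfl
  rw [h4, mul_comm]
  exact mul_le_mul_of_nonneg_right h3.le (norm_nonneg x)

theorem norm_toCLM_le {E F : Type*} [NormedAddCommGroup E] [InnerProductSpace ℂ E]
    [NormedAddCommGroup F] [InnerProductSpace ℂ F] (V : E →ₗᵢ[ℂ] F) :
    ‖V.toContinuousLinearMap‖ ≤ 1 :=
  ContinuousLinearMap.opNorm_le_bound _ zero_le_one fun x => by simp

/-- The action `g ↦ Ad(μ_g)` on the compact operators, `T ↦ μ_g T μ_g*`. -/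
def ad (μ : SepRep G) : CAction G (K μ.H) where
  hom g := adIsom (μ.U g).toLinearIsometry
  map_one := by rw [_root_.map_one]; exact adIsom_id
  map_mul g h := by rw [_root_.map_mul, adIsom_comp]; rfl
  continuous T := by
    have h1 := μ.continuous_comp_compact T.isCompact
    have h2 := μ.continuous_comp_compact (K.isCompact (star T))
    rw [continuous_iff_continuousAt] at h1 h2 ⊢
    intro g₀
    have h3 := (tendsto_iff_norm_sub_tendsto_zero.1 (h1 g₀)).add
      (tendsto_iff_norm_sub_tendsto_zero.1 (h2 g₀))
    rw [add_zero] at h3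
    rw [ContinuousAt, tendsto_iff_norm_sub_tendsto_zero]
    refine squeeze_zero (fun _ => norm_nonneg _) (fun g => ?_) h3
    let V : G → μ.H →L[ℂ] μ.H := fun g => (μ.U g).toLinearIsometry.toContinuousLinearMap
    have hV : ∀ g, ‖V g‖ ≤ 1 := fun g => norm_toCLM_le _
    change ‖V g * (T.op * star (V g)) - V g₀ * (T.op * star (V g₀))‖ ≤
      ‖V g * T.op - V g₀ * T.op‖ + ‖V g * star T.op - V g₀ * star T.op‖
    have e : V g * (T.op * star (V g)) - V g₀ * (T.op * star (V g₀)) =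
        (V g * T.op - V g₀ * T.op) * star (V g) +
        V g₀ * star (V g * star T.op - V g₀ * star T.op) := by
      simp only [star_sub, star_mul, star_star]; noncomm_ring
    rw [e]
    refine (norm_add_le _ _).trans (add_le_add ?_ ?_)
    · refine (norm_mul_le _ _).trans (mul_le_of_le_one_right (norm_nonneg _) ?_)
      rw [norm_star]; exact hV g
    · refine (norm_mul_le _ _).trans ?_
      rw [norm_star]
      exact mul_le_of_le_one_left (norm_nonneg _) (hV g₀)

/-- The trivial representation on a separable Hilbert space. -/
def trivial (H : Type) [NormedAddCommGroup H] [InnerProductSpace ℂ H] [CompleteSpace H]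
    [TopologicalSpace.SeparableSpace H] : SepRep G where
  H := H
  U := 1
  continuous _ := continuous_const

/-- The direct sum of two representations, on the Hilbert space direct sum. -/
def sum (μ ν : SepRep G) : SepRep G where
  H := WithLp 2 (μ.H × ν.H)
  separable :=
    haveI := UniformSpace.secondCountable_of_separable μ.H
    haveI := UniformSpace.secondCountable_of_separable ν.H
    inferInstance
  U :=
    { toFun := fun g => LinearIsometryEquiv.withLpProdCongr 2 (μ.U g) (ν.U g)
      map_one' := by
        ext x : 1
        simp only [_root_.map_one]
        rfl
      map_mul' := fun g h => by
        ext x : 1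
        simp only [_root_.map_mul]
        rfl }
  continuous ξ := by
    have h1 := μ.continuous ξ.fst
    have h2 := ν.continuous ξ.snd
    exact (WithLp.prod_continuous_toLp 2 μ.H ν.H).comp (h1.prodMk h2)

/-- Extension of an isometry of inner product spaces to their completions. -/
def complIsom {E F : Type*} [NormedAddCommGroup E] [InnerProductSpace ℂ E]
    [NormedAddCommGroup F] [InnerProductSpace ℂ F] (V : E →ₗᵢ[ℂ] F) :
    UniformSpace.Completion E →ₗᵢ[ℂ] UniformSpace.Completion F where
  toLinearMap := V.toContinuousLinearMap.completion
  norm_map' x := by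
    induction x using UniformSpace.Completion.induction_on with
    | hp =>
      exact isClosed_eq (V.toContinuousLinearMap.completion.continuous.norm) continuous_norm
    | ih x =>
      change ‖V.toContinuousLinearMap.completion x‖ = _
      rw [ContinuousLinearMap.completion_apply_coe, UniformSpace.Completion.norm_coe,
        UniformSpace.Completion.norm_coe]
      exact V.norm_map x

@[simp]
theorem complIsom_coe {E F : Type*} [NormedAddCommGroup E] [InnerProductSpace ℂ E]
    [NormedAddCommGroup F] [InnerProductSpace ℂ F] (V : E →ₗᵢ[ℂ] F) (x : E) :
    complIsom V (x : UniformSpace.Completion E) = (V x : UniformSpace.Completion F) :=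
  V.toContinuousLinearMap.completion_apply_coe x

/-- The unitary `U ⊗ V` on the Hilbert space tensor product. -/
def tensorIsom {E F : Type*} [NormedAddCommGroup E] [InnerProductSpace ℂ E]
    [NormedAddCommGroup F] [InnerProductSpace ℂ F] (U : E ≃ₗᵢ[ℂ] E) (V : F ≃ₗᵢ[ℂ] F) :
    UniformSpace.Completion (E ⊗[ℂ] F) →ₗᵢ[ℂ] UniformSpace.Completion (E ⊗[ℂ] F) :=
  complIsom (TensorProduct.mapIsometry U.toLinearIsometry V.toLinearIsometry)

theorem tensorIsom_tmul {E F : Type*} [NormedAddCommGroup E] [InnerProductSpace ℂ E]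
    [NormedAddCommGroup F] [InnerProductSpace ℂ F] (U : E ≃ₗᵢ[ℂ] E) (V : F ≃ₗᵢ[ℂ] F)
    (x : E) (y : F) : tensorIsom U V ((x ⊗ₜ[ℂ] y : E ⊗[ℂ] F) : UniformSpace.Completion _) =
      ((U x ⊗ₜ[ℂ] V y : E ⊗[ℂ] F) : UniformSpace.Completion _) := by
  simp [tensorIsom]

/-- Finite sums of elementary tensors are dense in the Hilbert space tensor product. -/
theorem hilbert_induction {E F : Type*} [NormedAddCommGroup E] [InnerProductSpace ℂ E]
    [NormedAddCommGroup F] [InnerProductSpace ℂ F]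
    {P : UniformSpace.Completion (E ⊗[ℂ] F) → Prop} (x : UniformSpace.Completion (E ⊗[ℂ] F))
    (hc : IsClosed {x | P x}) (h0 : P 0) (hadd : ∀ x y, P x → P y → P (x + y))
    (h : ∀ (a : E) (b : F), P ((a ⊗ₜ[ℂ] b : E ⊗[ℂ] F) : UniformSpace.Completion _)) : P x := by
  induction x using UniformSpace.Completion.induction_on with
  | hp => exact hc
  | ih x =>
    induction x using TensorProduct.induction_on with
    | zero => exact h0
    | tmul a b => exact h a b
    | add x y hx hy => rw [UniformSpace.Completion.coe_add]; exact hadd _ _ hx hy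

theorem tensorIsom_comp {E F : Type*} [NormedAddCommGroup E] [InnerProductSpace ℂ E]
    [NormedAddCommGroup F] [InnerProductSpace ℂ F] (U U' : E ≃ₗᵢ[ℂ] E) (V V' : F ≃ₗᵢ[ℂ] F)
    (x : UniformSpace.Completion (E ⊗[ℂ] F)) :
    tensorIsom U V (tensorIsom U' V' x) = tensorIsom (U * U') (V * V') x := by
  induction x using hilbert_induction with
  | hc =>
    exact isClosed_eq ((tensorIsom U V).continuous.comp (tensorIsom U' V').continuous)
      (tensorIsom (U * U') (V * V')).continuous
  | h0 => simp
  | hadd x y hx hy => simp only [_root_.map_add, hx, hy]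
  | h a b => simp only [tensorIsom_tmul]; rfl

theorem tensorIsom_one {E F : Type*} [NormedAddCommGroup E] [InnerProductSpace ℂ E]
    [NormedAddCommGroup F] [InnerProductSpace ℂ F] (x : UniformSpace.Completion (E ⊗[ℂ] F)) :
    tensorIsom 1 1 x = x := by
  induction x using hilbert_induction with
  | hc => exact isClosed_eq (tensorIsom 1 1).continuous continuous_id
  | h0 => simp
  | hadd x y hx hy => simp only [_root_.map_add, hx, hy]
  | h a b => simp only [tensorIsom_tmul]; rfl

/-- The Hilbert space tensor product of two representations. -/
def tensor (μ ν : SepRep G) : SepRep G where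
  H := UniformSpace.Completion (μ.H ⊗[ℂ] ν.H)
  separable := by
    have h : TopologicalSpace.IsSeparable
        (Set.range fun p : μ.H × ν.H => p.1 ⊗ₜ[ℂ] p.2) :=
      TopologicalSpace.isSeparable_range (TensorProduct.continuous_tmul)
    have h2 := h.span (R := ℂ)
    have h3 : (Submodule.span ℂ (Set.range fun p : μ.H × ν.H => p.1 ⊗ₜ[ℂ] p.2) :
        Set (μ.H ⊗[ℂ] ν.H)) = Set.univ := by
      have := TensorProduct.span_tmul_eq_top ℂ μ.H ν.H
      rw [← Submodule.top_coe (R := ℂ), ← this]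
      congr 2
      ext x; simp
    rw [h3, TopologicalSpace.isSeparable_univ_iff] at h2
    infer_instance
  U :=
    { toFun := fun g =>
        { tensorIsom (μ.U g) (ν.U g) with
          invFun := tensorIsom (μ.U g⁻¹) (ν.U g⁻¹)
          left_inv := fun x => by
            change tensorIsom _ _ (tensorIsom _ _ x) = x
            rw [tensorIsom_comp, ← _root_.map_mul, ← _root_.map_mul, inv_mul_cancel,
              _root_.map_one, _root_.map_one, tensorIsom_one]
          right_inv := fun x => by
            change tensorIsom _ _ (tensorIsom _ _ x) = x
            rw [tensorIsom_comp, ← _root_.map_mul, ← _root_.map_mul, mul_inv_cancel,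
              _root_.map_one, _root_.map_one, tensorIsom_one] }
      map_one' := by
        ext x : 1
        change tensorIsom _ _ x = x
        rw [_root_.map_one, _root_.map_one, tensorIsom_one]
      map_mul' := fun g h => by
        ext x : 1
        change tensorIsom _ _ x = tensorIsom _ _ (tensorIsom _ _ x)
        rw [_root_.map_mul, _root_.map_mul, tensorIsom_comp] }
  continuous ξ := by
    change Continuous fun g => tensorIsom (μ.U g) (ν.U g) ξ
    induction ξ using hilbert_induction with
    | hc =>
      exact isClosed_setOf_continuous_orbit _ fun g x y =>
        ((tensorIsom (μ.U g) (ν.U g)).dist_map x y).le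
    | h0 => simpa using continuous_const
    | hadd x y hx hy => simp only [_root_.map_add]; exact hx.add hy
    | h a b =>
      simp only [tensorIsom_tmul]
      exact UniformSpace.Completion.continuous_coe _ |>.comp
        ((TensorProduct.continuous_tmul).comp ((μ.continuous a).prodMk (ν.continuous b)))

end SepRep
end Actions

section Sums

variable {H₁ H₂ H₃ : Type*} [NormedAddCommGroup H₁] [InnerProductSpace ℂ H₁] [CompleteSpace H₁]
  [NormedAddCommGroup H₂] [InnerProductSpace ℂ H₂] [CompleteSpace H₂]
  [NormedAddCommGroup H₃] [InnerProductSpace ℂ H₃] [CompleteSpace H₃]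

variable (H₁ H₂) in
/-- The inclusion of the first summand of a Hilbert space direct sum. -/
def inlIsom : H₁ →ₗᵢ[ℂ] WithLp 2 (H₁ × H₂) where
  toFun x := WithLp.toLp 2 (x, 0)
  map_add' x y := by apply WithLp.ofLp_injective; simp
  map_smul' c x := by apply WithLp.ofLp_injective; simp
  norm_map' x := WithLp.norm_toLp_fst 2 H₁ H₂ x

variable (H₁ H₂) in
/-- The inclusion of the second summand of a Hilbert space direct sum. -/
def inrIsom : H₂ →ₗᵢ[ℂ] WithLp 2 (H₁ × H₂) where
  toFun x := WithLp.toLp 2 (0, x)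
  map_add' x y := by apply WithLp.ofLp_injective; simp
  map_smul' c x := by apply WithLp.ofLp_injective; simp
  norm_map' x := WithLp.norm_toLp_snd 2 H₁ H₂ x

variable {A B : Type*} [NonUnitalCStarAlgebra A] [NonUnitalCStarAlgebra B]

/-- The `*`-homomorphism `Ad(V) ⊗ id : K(H₁) ⊗ A → K(H₂) ⊗ A` given by an isometry `V`. -/
def adA (A : Type*) [NonUnitalCStarAlgebra A] (V : H₁ →ₗᵢ[ℂ] H₂) :
    CTensor (K H₁) A →⋆ₙₐ[ℂ] CTensor (K H₂) A :=
  CTensor.map (adIsom V) (NonUnitalStarAlgHom.id ℂ A)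

/-- Images under `Ad(V) ⊗ id` and `Ad(W) ⊗ id` are orthogonal if the ranges of `V` and `W` are. -/
theorem adA_mul_adA (V : H₁ →ₗᵢ[ℂ] H₃) (W : H₂ →ₗᵢ[ℂ] H₃) (h : ∀ x y, inner ℂ (V x) (W y) = 0)
    (x : CTensor (K H₁) A) (y : CTensor (K H₂) A) : adA A V x * adA A W y = 0 := by
  have hVW : ∀ y, V.toContinuousLinearMap.adjoint (W y) = 0 := fun y => by
    refine ext_inner_left ℂ fun z => ?_
    rw [ContinuousLinearMap.adjoint_inner_right, inner_zero_right]
    exact h z y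
  have hVW' : ∀ S T, adIsom V S * adIsom W T = 0 := fun S T => by
    refine K.ext fun x => ?_
    simp [adIsom_op, hVW]
  have c1 := CTensor.continuous_map (adIsom V) (NonUnitalStarAlgHom.id ℂ A)
  have c2 := CTensor.continuous_map (adIsom W) (NonUnitalStarAlgHom.id ℂ A)
  induction x using CTensor.induction_tmul with
  | hc => exact isClosed_eq (c1.mul continuous_const) continuous_const
  | h0 => simp
  | hadd x x' hx hx' => rw [map_add, add_mul, hx, hx', add_zero]
  | h S a =>
    induction y using CTensor.induction_tmul with
    | hc => exact isClosed_eq (continuous_const.mul c2) continuous_const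
    | h0 => simp
    | hadd x x' hx hx' => rw [map_add, mul_add, hx, hx', add_zero]
    | h T b =>
      simp only [adA, CTensor.map_tmul, CTensor.tmul_mul_tmul, hVW']
      simpa using CTensor.smul_tmul' (0 : ℂ) (0 : K H₃)
        (NonUnitalStarAlgHom.id ℂ A a * NonUnitalStarAlgHom.id ℂ A b)

end Sums

namespace SepRep

variable {G : Type*} [Group G] [TopologicalSpace G]

/-- The inclusion of the first summand. -/
def inl (μ ν : SepRep G) : μ.H →ₗᵢ[ℂ] (μ.sum ν).H := inlIsom μ.H ν.H

/-- The inclusion of the second summand. -/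
def inr (μ ν : SepRep G) : ν.H →ₗᵢ[ℂ] (μ.sum ν).H := inrIsom μ.H ν.H

theorem inner_inl_inr (μ ν : SepRep G) (x : μ.H) (y : ν.H) :
    Inner.inner ℂ (μ.inl ν x) (μ.inr ν y) = 0 := by
  change Inner.inner ℂ (inlIsom μ.H ν.H x) (inrIsom μ.H ν.H y) = 0
  simp [inlIsom, inrIsom, WithLp.prod_inner_apply]

theorem sum_U_inl (μ ν : SepRep G) (g : G) :
    ((μ.sum ν).U g).toLinearIsometry.comp (μ.inl ν) =
      (μ.inl ν).comp (μ.U g).toLinearIsometry := by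
  ext x : 1
  change WithLp.toLp 2 (μ.U g x, ν.U g 0) = WithLp.toLp 2 (μ.U g x, 0)
  rw [_root_.map_zero]

theorem sum_U_inr (μ ν : SepRep G) (g : G) :
    ((μ.sum ν).U g).toLinearIsometry.comp (μ.inr ν) =
      (μ.inr ν).comp (ν.U g).toLinearIsometry := by
  ext x : 1
  change WithLp.toLp 2 (μ.U g 0, ν.U g x) = WithLp.toLp 2 (0, ν.U g x)
  rw [_root_.map_zero]

end SepRep

section Corner

variable {G : Type*} [Group G] [TopologicalSpace G]
  {A B : Type*} [NonUnitalCStarAlgebra A] [NonUnitalCStarAlgebra B]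

/-- The space `K(H_ν, H_μ) ⊗ A`, as an off-diagonal corner of `K(H_μ ⊕ H_ν) ⊗ A`. -/
def offDiag (μ ν : SepRep G) (A : Type*) [NonUnitalCStarAlgebra A] :
    Submodule ℂ (CTensor (K (μ.sum ν).H) A) :=
  (Submodule.span ℂ {z | ∃ (T : K (μ.sum ν).H) (a : A),
    (∀ x, T.op (μ.inl ν x) = 0) ∧ (∀ y, ∃ x, T.op y = μ.inl ν x) ∧
      z = CTensor.tmul T a}).topologicalClosure

theorem map_mem_offDiag {μ ν : SepRep G} (ψ : A →⋆ₙₐ[ℂ] B) {d : CTensor (K (μ.sum ν).H) A}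
    (hd : d ∈ offDiag μ ν A) :
    CTensor.map (NonUnitalStarAlgHom.id ℂ _) ψ d ∈ offDiag μ ν B := by
  have hf := CTensor.continuous_map (NonUnitalStarAlgHom.id ℂ (K (μ.sum ν).H)) ψ
  refine map_mem_closure hf hd fun z hz => ?_
  refine (Submodule.span_le.2 ?_ : _ ≤ (Submodule.span ℂ _).comap (LinearMapClass.linearMap
    (CTensor.map (NonUnitalStarAlgHom.id ℂ (K (μ.sum ν).H)) ψ))) hz
  rintro _ ⟨T, a, h1, h2, rfl⟩
  exact Submodule.subset_span ⟨T, ψ a, h1, h2, CTensor.map_tmul _ _ _ _⟩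

end Corner


section CuntzSemigroup

variable {G : Type*} [Group G] [TopologicalSpace G]
variable {A B : Type*} [NonUnitalCStarAlgebra A] [NonUnitalCStarAlgebra B]
  {α : CAction G A} {β : CAction G B}

/-- The diagonal action `Ad(μ) ⊗ α` on `K(H_μ) ⊗ A`. -/
def stabAction (μ : SepRep G) (α : CAction G A) : CAction G (CTensor (K μ.H) A) :=
  μ.ad.tensor α

/-- Positive elements of the fixed point algebras `(K(H_μ) ⊗ A)^G`, where `μ` is some separable
unitary representation of `G`. -/
structure PosElem (α : CAction G A) where
  rep : SepRep G
  val : CTensor (K rep.H) A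
  pos : ∃ c, val = star c * c
  invariant : ∀ g, stabAction rep α g val = val

namespace PosElem

/-- `a`, placed in the upper left corner of `K(H_μ ⊕ H_ν) ⊗ A`. -/
def inl (a : PosElem α) (ν : SepRep G) : CTensor (K (a.rep.sum ν).H) A :=
  adA A (a.rep.inl ν) a.val

/-- `a`, placed in the lower right corner of `K(H_ν ⊕ H_μ) ⊗ A`. -/
def inr (ν : SepRep G) (a : PosElem α) : CTensor (K (ν.sum a.rep).H) A :=
  adA A (ν.inr a.rep) a.val

theorem stabAction_adA {μ ν : SepRep G} {V : μ.H →ₗᵢ[ℂ] ν.H} {g : G}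
    (h : (ν.U g).toLinearIsometry.comp V = V.comp (μ.U g).toLinearIsometry)
    (x : CTensor (K μ.H) A) :
    stabAction ν α g (adA A V x) = adA A V (stabAction μ α g x) := by
  refine (CTensor.map_map (adIsom (ν.U g).toLinearIsometry) (α g) (adIsom V)
    (NonUnitalStarAlgHom.id ℂ A) x).trans (Eq.trans ?_ (CTensor.map_map (adIsom V)
    (NonUnitalStarAlgHom.id ℂ A) (adIsom (μ.U g).toLinearIsometry) (α g) x).symm)
  rw [adIsom_comp, adIsom_comp, h]
  rfl

/-- The direct sum `a ⊕ b`. -/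
def sum (a b : PosElem α) : PosElem α where
  rep := a.rep.sum b.rep
  val := a.inl b.rep + b.inr a.rep
  pos := by
    obtain ⟨c, hc⟩ := a.pos
    obtain ⟨d, hd⟩ := b.pos
    refine ⟨adA A (a.rep.inl b.rep) c + adA A (a.rep.inr b.rep) d, ?_⟩
    have h1 := adA_mul_adA (A := A) (a.rep.inl b.rep) (a.rep.inr b.rep)
      (a.rep.inner_inl_inr b.rep)
    have h2 := adA_mul_adA (A := A) (a.rep.inr b.rep) (a.rep.inl b.rep)
      fun x y => inner_eq_zero_symm.1 (a.rep.inner_inl_inr b.rep y x)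
    rw [inl, inr, hc, hd, star_add, add_mul, mul_add, mul_add, ← map_star, ← map_star, h1, h2,
      add_zero, zero_add, ← map_mul, ← map_mul]
  invariant g := by
    rw [map_add, inl, inr, stabAction_adA (a.rep.sum_U_inl b.rep g),
      stabAction_adA (a.rep.sum_U_inr b.rep g), a.invariant, b.invariant]

/-- The zero element of `K(ℂ) ⊗ A`. -/
def zero (α : CAction G A) : PosElem α where
  rep := SepRep.trivial ℂ
  val := 0
  pos := ⟨0, by simp⟩
  invariant g := map_zero _

end PosElem

/-- Cuntz subequivalence `a ≲_G b` of positive invariant elements. -/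
def CuntzLE (a b : PosElem α) : Prop :=
  ∃ d : ℕ → CTensor (K (a.rep.sum b.rep).H) A,
    (∀ n, d n ∈ offDiag a.rep b.rep A) ∧
    (∀ n g, stabAction (a.rep.sum b.rep) α g (d n) = d n) ∧
    Filter.Tendsto (fun n => d n * b.inr a.rep * star (d n)) Filter.atTop (𝓝 (a.inl b.rep))

/-- Cuntz equivalence `a ∼_G b`. -/
def CuntzEquiv (a b : PosElem α) : Prop := CuntzLE a b ∧ CuntzLE b a

/-- The equivariant Cuntz semigroup `Cu^G(A, α)`. -/
def CuG (α : CAction G A) : Type _ := Quot (CuntzEquiv (α := α))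

namespace CuG

/-- The class `[a]`. -/
def mk (a : PosElem α) : CuG α := Quot.mk _ a

/-- `[a] ≤ [b]` if `a ≲_G b`. -/
instance : LE (CuG α) := ⟨fun x y => ∃ a b, mk a = x ∧ mk b = y ∧ CuntzLE a b⟩

/-- `[a] + [b] = [a ⊕ b]`. -/
instance : Add (CuG α) := ⟨fun x y => mk ((Quot.out x).sum (Quot.out y))⟩

instance : Zero (CuG α) := ⟨mk (PosElem.zero α)⟩

instance : Inhabited (CuG α) := ⟨0⟩

end CuG

/-- Unitary equivalence of representations. -/
def SepRep.Equivalent (μ ν : SepRep G) : Prop :=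
  ∃ V : μ.H ≃ₗᵢ[ℂ] ν.H, ∀ g x, V (μ.U g x) = ν.U g (V x)

variable (G) in
/-- Unitary equivalence classes of separable representations of `G`, i.e. the elements of the
representation semiring `Cu(G)`. -/
def RepSemiring : Type _ := Quot (SepRep.Equivalent (G := G))

open scoped ComplexOrder in
/-- `s` is a strictly positive element of the C*-algebra `A`: it is positive, and every nonzero
positive functional is strictly positive on it. -/
def IsStrictlyPositiveElem (s : A) : Prop :=
  (∃ c, s = star c * c) ∧
    ∀ f : A →ₗ[ℂ] ℂ, (∀ c, 0 ≤ f (star c * c)) → f ≠ 0 → 0 < f s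

/-- The elementary tensor `ξ ⊗ η` in the Hilbert space tensor product `H_ν ⊗ H_μ`. -/
def SepRep.pure (ν μ : SepRep G) (ξ : ν.H) (η : μ.H) : (ν.tensor μ).H :=
  ((ξ ⊗ₜ[ℂ] η : ν.H ⊗[ℂ] μ.H) : UniformSpace.Completion (ν.H ⊗[ℂ] μ.H))

/-- `z = s ⊗ x`, where `s ∈ K(H_ν)`, `x ∈ K(H_μ) ⊗ A` and `z ∈ K(H_ν ⊗ H_μ) ⊗ A`. The graph of
the bounded linear map `x ↦ s ⊗ x` is the closed linear span of the pairs
`(k ⊗ a, (s ⊗ k) ⊗ a)`, where `s ⊗ k` is the operator `T` with `T (ξ ⊗ η) = s ξ ⊗ k η`. -/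
def IsOuterTensor (ν μ : SepRep G) (s : K ν.H) (x : CTensor (K μ.H) A)
    (z : CTensor (K (ν.tensor μ).H) A) : Prop :=
  (x, z) ∈ (Submodule.span ℂ {p : CTensor (K μ.H) A × CTensor (K (ν.tensor μ).H) A |
    ∃ (k : K μ.H) (T : K (ν.tensor μ).H) (a : A),
      (∀ ξ η, T.op (ν.pure μ ξ η) = ν.pure μ (s.op ξ) (k.op η)) ∧
      p = (CTensor.tmul k a, CTensor.tmul T a)}).topologicalClosure

/-- The relation `[ν] · [a] = [s ⊗ a]` defining the action of `Cu(G)`: here `s` is a strictly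
positive invariant element of `K(H_ν)`, and `z = s ⊗ a` lives in `K(H_ν ⊗ H_μ) ⊗ A`. -/
def IsSMul (r : RepSemiring G) (x y : CuG α) : Prop :=
  ∃ (ν : SepRep G) (a : PosElem α) (s : K ν.H) (z : CTensor (K (ν.tensor a.rep).H) A)
    (hz : ∃ c, z = star c * c) (hz' : ∀ g, stabAction (ν.tensor a.rep) α g z = z),
    Quot.mk _ ν = r ∧ CuG.mk a = x ∧
    IsStrictlyPositiveElem s ∧ (∀ g, ν.ad g s = s) ∧ IsOuterTensor ν a.rep s a.val z ∧
    CuG.mk ⟨ν.tensor a.rep, z, hz, hz'⟩ = y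

/-- The `Cu(G)`-semimodule structure of `Cu^G(A, α)`: the class `r · x` is the one with
`IsSMul r x (r · x)`. -/
instance : SMul (RepSemiring G) (CuG α) := ⟨fun r x => Classical.epsilon (IsSMul r x)⟩

/-- Equivariant `*`-homomorphisms. -/
structure EquivHom (α : CAction G A) (β : CAction G B) where
  toHom : A →⋆ₙₐ[ℂ] B
  equivariant : ∀ g a, toHom (α g a) = β g (toHom a)

namespace EquivHom

theorem stabAction_map (ψ : EquivHom α β) (μ : SepRep G) (g : G) (x : CTensor (K μ.H) A) :
    stabAction μ β g (CTensor.map (NonUnitalStarAlgHom.id ℂ _) ψ.toHom x) =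
      CTensor.map (NonUnitalStarAlgHom.id ℂ _) ψ.toHom (stabAction μ α g x) := by
  have h : (β g).comp ψ.toHom = ψ.toHom.comp (α g) := by
    ext a; exact (ψ.equivariant g a).symm
  refine (CTensor.map_map _ _ _ _ _).trans (Eq.trans ?_ (CTensor.map_map _ _ _ _ _).symm)
  rw [h]
  rfl

/-- `(id ⊗ ψ)(a)`. -/
def mapPos (ψ : EquivHom α β) (a : PosElem α) : PosElem β where
  rep := a.rep
  val := CTensor.map (NonUnitalStarAlgHom.id ℂ _) ψ.toHom a.val
  pos := by
    obtain ⟨c, hc⟩ := a.pos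
    exact ⟨CTensor.map (NonUnitalStarAlgHom.id ℂ _) ψ.toHom c, by rw [hc, map_mul, map_star]⟩
  invariant g := by rw [stabAction_map, a.invariant]

theorem map_adA {H₁ H₂ : Type*} [NormedAddCommGroup H₁] [InnerProductSpace ℂ H₁] [CompleteSpace H₁]
    [NormedAddCommGroup H₂] [InnerProductSpace ℂ H₂] [CompleteSpace H₂] (ψ : A →⋆ₙₐ[ℂ] B)
    (V : H₁ →ₗᵢ[ℂ] H₂) (x : CTensor (K H₁) A) :
    adA B V (CTensor.map (NonUnitalStarAlgHom.id ℂ _) ψ x) =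
      CTensor.map (NonUnitalStarAlgHom.id ℂ _) ψ (adA A V x) :=
  (CTensor.map_map (adIsom V) (NonUnitalStarAlgHom.id ℂ B) (NonUnitalStarAlgHom.id ℂ (K H₁)) ψ
    x).trans (CTensor.map_map (NonUnitalStarAlgHom.id ℂ (K H₂)) ψ (adIsom V)
    (NonUnitalStarAlgHom.id ℂ A) x).symm

theorem cuntzLE_mapPos (ψ : EquivHom α β) {a b : PosElem α} (h : CuntzLE a b) :
    CuntzLE (ψ.mapPos a) (ψ.mapPos b) := by
  obtain ⟨d, h1, h2, h3⟩ := h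
  refine ⟨fun n => CTensor.map (NonUnitalStarAlgHom.id ℂ _) ψ.toHom (d n),
    fun n => map_mem_offDiag _ (h1 n), fun n g => ?_, ?_⟩
  · exact (stabAction_map ψ _ g _).trans (congrArg _ (h2 n g))
  · have hc := CTensor.continuous_map (NonUnitalStarAlgHom.id ℂ (K (a.rep.sum b.rep).H)) ψ.toHom
    have h4 := (hc.tendsto _).comp h3
    have e1 : (ψ.mapPos b).inr (ψ.mapPos a).rep = CTensor.map (NonUnitalStarAlgHom.id ℂ _) ψ.toHom
        (b.inr a.rep) := map_adA _ _ _
    have e2 : (ψ.mapPos a).inl (ψ.mapPos b).rep = CTensor.map (NonUnitalStarAlgHom.id ℂ _) ψ.toHom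
        (a.inl b.rep) := map_adA _ _ _
    rw [e1, e2]
    refine h4.congr fun n => ?_
    simp only [Function.comp_apply, map_mul, map_star]
    rfl

/-- The equivariant homomorphism `ψ ⊗ id`. -/
def tensorId (ψ : EquivHom α β) {D : Type*} [NonUnitalCStarAlgebra D] (γ : CAction G D) :
    EquivHom (α.tensor γ) (β.tensor γ) where
  toHom := CTensor.map ψ.toHom (NonUnitalStarAlgHom.id ℂ D)
  equivariant g x := by
    refine (CTensor.map_map _ _ _ _ _).trans (Eq.trans ?_ (CTensor.map_map _ _ _ _ _).symm)
    have h : (β g).comp ψ.toHom = ψ.toHom.comp (α g) := by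
      ext a; exact (ψ.equivariant g a).symm
    rw [h]
    rfl

/-- The `*`-homomorphism `a ↦ a ⊗ q`, for a projection `q`. -/
def cornerHom (A : Type*) [NonUnitalCStarAlgebra A] {D : Type*} [NonUnitalCStarAlgebra D] {q : D}
    (hq : IsStarProjection q) : A →⋆ₙₐ[ℂ] CTensor A D where
  toFun a := CTensor.tmul a q
  map_smul' c a := CTensor.smul_tmul' c a q
  map_zero' := by simpa using CTensor.smul_tmul' (0 : ℂ) (0 : A) q
  map_add' a b := CTensor.add_tmul a b q
  map_mul' a b := by rw [CTensor.tmul_mul_tmul, hq.isIdempotentElem.eq]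
  map_star' a := by rw [CTensor.star_tmul, hq.isSelfAdjoint.star_eq]

/-- The corner inclusion `ι_q : (A, α) → (A ⊗ D, α ⊗ id)`, `a ↦ a ⊗ q`, for a projection `q`. -/
def corner (α : CAction G A) {D : Type*} [NonUnitalCStarAlgebra D] {q : D}
    (hq : IsStarProjection q) : EquivHom α (α.tensor (CAction.trivial D)) where
  toHom := cornerHom A hq
  equivariant g a :=
    (CTensor.map_tmul (α g) (NonUnitalStarAlgHom.id ℂ D) a q).symm

end EquivHom

/-- The map `Cu^G(ψ)`, `[a] ↦ [(id ⊗ ψ)(a)]`. -/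
def CuG.map (ψ : EquivHom α β) : CuG α → CuG β :=
  Quot.map (ra := CuntzEquiv) (rb := CuntzEquiv) ψ.mapPos
    (fun _ _ h => And.intro (ψ.cuntzLE_mapPos h.1) (ψ.cuntzLE_mapPos h.2))

end CuntzSemigroup

section Morphisms

variable {X Y R : Type*} [Zero X] [Add X] [LE X] [SMul R X] [Zero Y] [Add Y] [LE Y] [SMul R Y]

/-- `s ≪ t`: whenever `t` lies below the supremum of an increasing sequence, `s` lies below
one of its terms. -/
def WayBelow {X : Type*} [LE X] (s t : X) : Prop :=
  ∀ (u : ℕ → X) (v : X), (∀ n, u n ≤ u (n + 1)) → IsLUB (Set.range u) v → t ≤ v → ∃ n, s ≤ u n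

/-- Morphisms of `CCu^G`: order preserving homomorphisms of semimodules which preserve zero,
suprema of increasing sequences, and the relation `≪`. -/
structure IsCCuGMorphism (R : Type*) {X Y : Type*} [Zero X] [Add X] [LE X] [SMul R X]
    [Zero Y] [Add Y] [LE Y] [SMul R Y] (f : X → Y) : Prop where
  map_zero : f 0 = 0
  map_add : ∀ x y, f (x + y) = f x + f y
  map_smul : ∀ (r : R) x, f (r • x) = r • f x
  mono : ∀ x y, x ≤ y → f x ≤ f y
  map_sup : ∀ (u : ℕ → X) (v : X), (∀ n, u n ≤ u (n + 1)) → IsLUB (Set.range u) v →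
    IsLUB (Set.range (f ∘ u)) (f v)
  map_wayBelow : ∀ s t, WayBelow s t → WayBelow (f s) (f t)

/-- Isomorphisms of `CCu^G`: morphisms with an inverse morphism. -/
def IsCCuGIso (R : Type*) {X Y : Type*} [Zero X] [Add X] [LE X] [SMul R X]
    [Zero Y] [Add Y] [LE Y] [SMul R Y] (f : X → Y) : Prop :=
  IsCCuGMorphism R f ∧ ∃ g : Y → X,
    IsCCuGMorphism R g ∧ Function.LeftInverse g f ∧ Function.RightInverse g f

end Morphisms

section InnerAction

variable {G : Type*} [Group G] [TopologicalSpace G]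
  {A : Type*} [NonUnitalCStarAlgebra A]

/-- For `d ∈ K(L) ⊗ (A ⊗ K(H_μ))`, where `ν` is a representation on `L`, the equation
`d = ω_g · (Ad(ν_g) ⊗ (α_g ⊗ id))(d)` with the unitary `ω_g = 1 ⊗ 1 ⊗ μ_g`. The graph of the
bounded linear map on the right hand side is the closed linear span of the pairs
`(x ⊗ (a ⊗ k), ν_g x ν_g* ⊗ (α_g a ⊗ μ_g k))`. -/
def IsTwistedInvariant (α : CAction G A) (μ ν : SepRep G)
    (d : CTensor (K ν.H) (CTensor A (K μ.H))) : Prop :=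
  ∀ g, (d, d) ∈ (Submodule.span ℂ {p : CTensor (K ν.H) (CTensor A (K μ.H)) ×
      CTensor (K ν.H) (CTensor A (K μ.H)) |
    ∃ (x : K ν.H) (a : A) (k k' : K μ.H), (∀ ξ, k'.op ξ = μ.U g (k.op ξ)) ∧
      p = (CTensor.tmul x (CTensor.tmul a k),
        CTensor.tmul (ν.ad g x) (CTensor.tmul (α g a) k'))}).topologicalClosure

/-- Let `B = A ⊗ K(H_μ)`, let `(E, ρ)` be the equivariant Hilbert module over `(B, α ⊗ Ad(μ))`
generated by `a`, i.e. the closure of `a (H_ν ⊗ B)`, and let `(F, σ)` be the equivariant Hilbert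
module over `(B, α ⊗ id)` generated by `b`. With `ω_g = 1 ⊗ μ_g`, the module `(E, ρ^ω)`,
`ρ^ω_g(x) = ρ_g(x) ω_g`, is equivariant over `(B, α ⊗ id)`. The relation says that `(E, ρ^ω)` and
`(F, σ)` are Cuntz equivalent: `d` is equivariant as a module map from `H_λ ⊗ B` to the twisted
module `(H_ν ⊗ B)^ω` precisely if it is twisted invariant. -/
def TwistedEquiv {α : CAction G A} {μ : SepRep G} (a : PosElem (α.tensor μ.ad))
    (b : PosElem (α.tensor (CAction.trivial (K μ.H)))) : Prop :=
  (∃ d : ℕ → CTensor (K (a.rep.sum b.rep).H) (CTensor A (K μ.H)),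
    (∀ n, d n ∈ offDiag a.rep b.rep (CTensor A (K μ.H))) ∧
    (∀ n, IsTwistedInvariant α μ (a.rep.sum b.rep) (d n)) ∧
    Filter.Tendsto (fun n => d n * b.inr a.rep * star (d n)) Filter.atTop (𝓝 (a.inl b.rep))) ∧
  (∃ d : ℕ → CTensor (K (a.rep.sum b.rep).H) (CTensor A (K μ.H)),
    (∀ n, d n ∈ offDiag a.rep b.rep (CTensor A (K μ.H))) ∧
    (∀ n, IsTwistedInvariant α μ (a.rep.sum b.rep) (d n)) ∧
    Filter.Tendsto (fun n => star (d n) * a.inl b.rep * d n) Filter.atTop (𝓝 (b.inr a.rep)))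

/-- `ε : Cu^G(A ⊗ K(H_μ), α ⊗ Ad(μ)) → Cu^G(A ⊗ K(H_μ), α ⊗ id)` is the isomorphism
`[(E, ρ)] ↦ [(E, ρ^ω)]` given by the cocycle equivalence `ω_g = 1 ⊗ μ_g` of the two actions. -/
def IsCocycleIso {α : CAction G A} {μ : SepRep G}
    (ε : CuG (α.tensor μ.ad) ≃ CuG (α.tensor (CAction.trivial (K μ.H)))) : Prop :=
  IsCCuGIso (RepSemiring G) ε ∧
    ∀ a b, ε (CuG.mk a) = CuG.mk b ↔ TwistedEquiv a b

end InnerAction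

/-- Rank one projections. -/
def IsRankOneProjection {H : Type*} [NormedAddCommGroup H] [InnerProductSpace ℂ H]
    [CompleteSpace H] (q : K H) : Prop :=
  IsStarProjection q ∧ Module.finrank ℂ (LinearMap.range (q.op : H →ₗ[ℂ] H)) = 1

end EqCuntz
end

/-!
The theorem rests on one isomorphism. Let `κ` be a representation of `G` on `H_κ ≠ 0`. Regrouping
`K(H_ν) ⊗ (A ⊗ K(H_κ)) ≅ K(H_ν ⊗ H_κ) ⊗ A` (`HTensor.shuffle`) turns a positive invariant element
over `(A ⊗ K(H_κ), α ⊗ Ad(κ))`, represented on `H_ν`, into one over `(A, α)`, represented on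
`H_ν ⊗ H_κ`. This gives the absorption map `CuG.absorb : Cu^G(A ⊗ K(H_κ)) → Cu^G(A)`.

* It preserves and reflects the order. Cuntz subequivalence of `a` and `b` can be tested after moving
  both into one Hilbert space by any isometries which intertwine the representations, and with
  arbitrary invariant `d_n`, not only off-diagonal ones (`cuntzLE_iff`), so the regrouping, an
  equivariant *-isomorphism, respects it (`cuntzLE_shuffle_iff`).
* It is surjective (`CuG.absorb_surjective`). The representation `κ̄ ⊗ κ` has an invariant unit vector:
  the average of the orbit of `ē ⊗ e` does not vanish, as its inner product with `ē ⊗ e` is the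
  integral of `|⟨e, κ_g e⟩|²` (`SepRep.exists_invariant_vector`). So `H_ν` embeds equivariantly in
  `(H_ν ⊗ H_κ̄) ⊗ H_κ`, and every element over `A`, represented on `H_ν`, comes from an element over
  `A ⊗ K(H_κ)` represented on `H_ν ⊗ H_κ̄`.
* It is additive and `Cu(G)`-linear (`CuG.absorb_add`, `CuG.absorb_smul`). For the latter one needs
  that `[s ⊗ a]` does not depend on the strictly positive invariant element `s`
  (`subeq_of_strictlyPositive`), and that such elements exist (`SepRep.exists_strictlyPositive`),
  both by averaging.

The tensor product with `K(H)` is taken in the largest C*-norm. Its universal property yields the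
regrouping homomorphism, and the latter is injective since slice maps separate the points of
`K(H) ⊗ A` (`eq_zero_of_slice_eq_zero`). All comparisons of different Hilbert spaces are made with the
bounded maps `z ↦ (X ⊗ 1) z (Y ⊗ 1)*` (`sandwich`).

An order isomorphism preserves suprema of increasing sequences and `≪`, so `CuG.absorb` is a
`CCu^G`-isomorphism. If `κ` is trivial, then it is a left inverse of the map induced by the corner
embedding `a ↦ a ⊗ q` (`CuG.absorb_map_corner`): if `q` is the projection onto `ℂ e`, the element
`a ⊗ q` is the image of `a` under the isometry `ξ ↦ ξ ⊗ e`. This proves the first part; naturality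
holds because absorption is natural and injective.

For the second part, a twisted invariant `d` becomes under regrouping an invariant operator between
`H_ν ⊗ H_μ` and `H_ρ ⊗ H_μ`, where `H_μ` carries `μ` in the former and the trivial representation
in the latter. So `[(E_a, ρ^ω)] = [E_b]` means precisely that `a` and `b` have the same image under
absorption of `μ` and of the trivial representation, respectively (`twistedEquiv_iff`). The map `ε`
is therefore the composition of one absorption isomorphism and the inverse of the other, it is
unique, and `ε⁻¹ ∘ Cu^G(ι_q)` is the inverse of absorption of `μ`.
-/

set_option linter.unusedSectionVars false

noncomputable section
namespace EqCuntz

/-! ### Hilbert space tensor products -/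

section HilbertTensor

/-- A realisation of the Hilbert space tensor product of `H` and `L` on the space `T`: a bilinear
map `(ξ, η) ↦ ξ ⊗ η` which multiplies inner products and whose image has dense linear span. -/
structure HTensor (H L T : Type*) [NormedAddCommGroup H] [InnerProductSpace ℂ H]
    [NormedAddCommGroup L] [InnerProductSpace ℂ L] [NormedAddCommGroup T]
    [InnerProductSpace ℂ T] where
  pure : H →ₗ[ℂ] L →ₗ[ℂ] T
  inner_pure : ∀ ξ ξ' η η', inner ℂ (pure ξ η) (pure ξ' η') = inner ℂ ξ ξ' * inner ℂ η η'
  denseRange : DenseRange (TensorProduct.lift pure)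

variable {H H' H'' L L' L'' T T' T'' : Type*}
  [NormedAddCommGroup H] [InnerProductSpace ℂ H] [CompleteSpace H]
  [NormedAddCommGroup H'] [InnerProductSpace ℂ H'] [CompleteSpace H']
  [NormedAddCommGroup H''] [InnerProductSpace ℂ H''] [CompleteSpace H'']
  [NormedAddCommGroup L] [InnerProductSpace ℂ L] [CompleteSpace L]
  [NormedAddCommGroup L'] [InnerProductSpace ℂ L'] [CompleteSpace L']
  [NormedAddCommGroup L''] [InnerProductSpace ℂ L''] [CompleteSpace L'']
  [NormedAddCommGroup T] [InnerProductSpace ℂ T] [CompleteSpace T]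
  [NormedAddCommGroup T'] [InnerProductSpace ℂ T'] [CompleteSpace T']
  [NormedAddCommGroup T''] [InnerProductSpace ℂ T''] [CompleteSpace T'']

/-- A bounded operator `X` on a Hilbert space satisfies `‖X‖² - X* X = Y* Y` for some `Y`. -/
theorem exists_adjoint_comp_self_add (X : H →L[ℂ] H') : ∃ Y : H →L[ℂ] H,
    X.adjoint ∘L X + Y.adjoint ∘L Y = ((‖X‖ ^ 2 : ℝ) : ℂ) • ContinuousLinearMap.id ℂ H := by
  have h : (((‖X‖ ^ 2 : ℝ) : ℂ) • ContinuousLinearMap.id ℂ H - X.adjoint ∘L X).IsPositive := by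
    rw [ContinuousLinearMap.isPositive_iff_complex]
    intro x
    have e : inner ℂ ((((‖X‖ ^ 2 : ℝ) : ℂ) • ContinuousLinearMap.id ℂ H - X.adjoint ∘L X) x) x =
        ((‖X‖ ^ 2 * ‖x‖ ^ 2 - ‖X x‖ ^ 2 : ℝ) : ℂ) := by
      simp only [sub_apply, inner_sub_left, smul_apply,
        ContinuousLinearMap.id_apply, inner_smul_left, ContinuousLinearMap.comp_apply,
        ContinuousLinearMap.adjoint_inner_left, inner_self_eq_norm_sq_to_K]
      simp
    rw [e]
    refine ⟨by rw [RCLike.re_to_complex, Complex.ofReal_re], ?_⟩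
    have := X.le_opNorm x
    simp only [RCLike.re_to_complex, Complex.ofReal_re]
    have h2 : ‖X x‖ ^ 2 ≤ (‖X‖ * ‖x‖) ^ 2 := by gcongr
    nlinarith
  obtain ⟨Y, hY⟩ := CStarAlgebra.nonneg_iff_eq_star_mul_self.1
    ((ContinuousLinearMap.nonneg_iff_isPositive _).2 h)
  refine ⟨Y, ?_⟩
  rw [ContinuousLinearMap.star_eq_adjoint] at hY
  change X.adjoint ∘L X + Y.adjoint * Y = _
  rw [← hY]; abel

theorem inner_map_map_adjoint (X : H →L[ℂ] H') (Y : L →L[ℂ] L') (x : H ⊗[ℂ] L)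
    (y : H' ⊗[ℂ] L') :
    inner ℂ (TensorProduct.map X.toLinearMap Y.toLinearMap x) y =
      inner ℂ x (TensorProduct.map X.adjoint.toLinearMap Y.adjoint.toLinearMap y) := by
  induction x using TensorProduct.induction_on with
  | zero => simp
  | add x x' hx hx' => simp only [map_add, inner_add_left, hx, hx']
  | tmul a b =>
    induction y using TensorProduct.induction_on with
    | zero => simp
    | add y y' hy hy' => simp only [map_add, inner_add_right, hy, hy']
    | tmul c d => simp [ContinuousLinearMap.adjoint_inner_right]

theorem norm_map_id_sq (Z : H →L[ℂ] H') (x : H ⊗[ℂ] L) :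
    ((‖TensorProduct.map Z.toLinearMap (ContinuousLinearMap.id ℂ L).toLinearMap x‖ ^ 2 : ℝ) : ℂ) =
      inner ℂ x (TensorProduct.map (Z.adjoint ∘L Z).toLinearMap
        (ContinuousLinearMap.id ℂ L).toLinearMap x) := by
  have := inner_self_eq_norm_sq_to_K (𝕜 := ℂ)
    (TensorProduct.map Z.toLinearMap (ContinuousLinearMap.id ℂ L).toLinearMap x)
  rw [inner_map_map_adjoint] at this
  have e1 : ContinuousLinearMap.adjoint (ContinuousLinearMap.id ℂ L) =
    ContinuousLinearMap.id ℂ L := star_one (L →L[ℂ] L)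
  rw [e1, ← LinearMap.comp_apply, ← TensorProduct.map_comp] at this
  push_cast
  exact this.symm

/-- The operator `X ⊗ 1` is bounded by `‖X‖`: with `Y* Y = ‖X‖² - X* X`, the squares of the norms of
`(X ⊗ 1) x` and `(Y ⊗ 1) x` add up to `‖X‖² ‖x‖²`. -/
theorem norm_map_id_le (X : H →L[ℂ] H') (x : H ⊗[ℂ] L) :
    ‖TensorProduct.map X.toLinearMap (ContinuousLinearMap.id ℂ L).toLinearMap x‖ ≤
      ‖X‖ * ‖x‖ := by
  obtain ⟨Y, hY⟩ := exists_adjoint_comp_self_add X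
  have h1 := norm_map_id_sq X x
  have h2 := norm_map_id_sq Y x
  have h3 : ((‖TensorProduct.map X.toLinearMap (ContinuousLinearMap.id ℂ L).toLinearMap x‖ ^ 2 +
      ‖TensorProduct.map Y.toLinearMap (ContinuousLinearMap.id ℂ L).toLinearMap x‖ ^ 2 : ℝ) : ℂ) =
      ((‖X‖ ^ 2 * ‖x‖ ^ 2 : ℝ) : ℂ) := by
    rw [Complex.ofReal_add, h1, h2]
    refine (inner_add_right (𝕜 := ℂ) x _ _).symm.trans ?_
    rw [← LinearMap.add_apply, ← TensorProduct.map_add_left]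
    have : (X.adjoint ∘L X).toLinearMap + (Y.adjoint ∘L Y).toLinearMap =
      ((‖X‖ ^ 2 : ℝ) : ℂ) • (ContinuousLinearMap.id ℂ H).toLinearMap :=
      congrArg ContinuousLinearMap.toLinearMap hY
    rw [this, TensorProduct.map_smul_left]
    simp [inner_smul_right, inner_self_eq_norm_sq_to_K]
  have h4 := Complex.ofReal_injective h3
  refine le_of_sq_le_sq ?_ (by positivity)
  nlinarith [sq_nonneg ‖TensorProduct.map Y.toLinearMap
    (ContinuousLinearMap.id ℂ L).toLinearMap x‖]

theorem norm_map_clm_le (X : H →L[ℂ] H') (Y : L →L[ℂ] L') (x : H ⊗[ℂ] L) :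
    ‖TensorProduct.map X.toLinearMap Y.toLinearMap x‖ ≤ ‖X‖ * ‖Y‖ * ‖x‖ := by
  have e : TensorProduct.map X.toLinearMap Y.toLinearMap x =
      TensorProduct.comm ℂ _ _ (TensorProduct.map Y.toLinearMap
        (ContinuousLinearMap.id ℂ H').toLinearMap (TensorProduct.comm ℂ _ _
        (TensorProduct.map X.toLinearMap (ContinuousLinearMap.id ℂ L).toLinearMap x))) := by
    induction x using TensorProduct.induction_on with
    | zero => simp
    | add x x' hx hx' => simp only [map_add, hx, hx']
    | tmul a b => simp
  rw [e, TensorProduct.norm_comm]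
  refine (norm_map_id_le _ _).trans ?_
  rw [TensorProduct.norm_comm, mul_comm ‖X‖, mul_assoc]
  exact mul_le_mul_of_nonneg_left (norm_map_id_le _ _) (norm_nonneg _)

namespace HTensor

/-- The Hilbert space tensor product obtained by completing the algebraic tensor product. -/
def completion (H L : Type*) [NormedAddCommGroup H] [InnerProductSpace ℂ H]
    [NormedAddCommGroup L] [InnerProductSpace ℂ L] :
    HTensor H L (UniformSpace.Completion (H ⊗[ℂ] L)) where
  pure := (TensorProduct.mk ℂ H L).compr₂ UniformSpace.Completion.toComplₗᵢ.toLinearMap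
  inner_pure ξ ξ' η η' := by simp
  denseRange := by
    have : (TensorProduct.lift ((TensorProduct.mk ℂ H L).compr₂
        (UniformSpace.Completion.toComplₗᵢ (𝕜 := ℂ) (E := H ⊗[ℂ] L)).toLinearMap)) =
        UniformSpace.Completion.toComplₗᵢ.toLinearMap := by
      ext; simp
    rw [this]
    exact UniformSpace.Completion.denseRange_coe

/-- The inclusion of the algebraic tensor product. -/
def incl (P : HTensor H L T) : H ⊗[ℂ] L →ₗ[ℂ] T := TensorProduct.lift P.pure

@[simp]
theorem incl_tmul (P : HTensor H L T) (ξ : H) (η : L) : P.incl (ξ ⊗ₜ η) = P.pure ξ η := by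
  simp [incl]

theorem inner_incl (P : HTensor H L T) (x y : H ⊗[ℂ] L) :
    inner ℂ (P.incl x) (P.incl y) = inner ℂ x y := by
  induction x using TensorProduct.induction_on with
  | zero => simp
  | add x x' hx hx' => simp only [map_add, inner_add_left, hx, hx']
  | tmul a b =>
    induction y using TensorProduct.induction_on with
    | zero => simp
    | add y y' hy hy' => simp only [map_add, inner_add_right, hy, hy']
    | tmul c d => simp [P.inner_pure]

theorem norm_incl (P : HTensor H L T) (x : H ⊗[ℂ] L) : ‖P.incl x‖ = ‖x‖ := by
  rw [@norm_eq_sqrt_re_inner ℂ, P.inner_incl, norm_eq_sqrt_re_inner (𝕜 := ℂ) x]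

theorem norm_pure (P : HTensor H L T) (ξ : H) (η : L) : ‖P.pure ξ η‖ = ‖ξ‖ * ‖η‖ := by
  rw [← P.incl_tmul, P.norm_incl, TensorProduct.norm_tmul]

/-- Finite sums of elementary tensors are dense. -/
@[elab_as_elim]
theorem induction (P : HTensor H L T) {p : T → Prop} (x : T)
    (hc : IsClosed {x | p x}) (h0 : p 0) (hadd : ∀ x y, p x → p y → p (x + y))
    (h : ∀ ξ η, p (P.pure ξ η)) : p x := by
  refine P.denseRange.induction_on x hc fun x => ?_
  induction x using TensorProduct.induction_on with
  | zero => simpa using h0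
  | tmul a b => simpa using h a b
  | add x y hx hy => rw [map_add]; exact hadd _ _ hx hy

theorem denseRange_incl (P : HTensor H L T) : DenseRange P.incl := P.denseRange

theorem ext_clm (P : HTensor H L T) {X Y : T →L[ℂ] T'}
    (h : ∀ ξ η, X (P.pure ξ η) = Y (P.pure ξ η)) : X = Y := by
  ext x
  induction x using P.induction with
  | hc => exact isClosed_eq X.continuous Y.continuous
  | h0 => simp
  | hadd x y hx hy => simp only [map_add, hx, hy]
  | h ξ η => exact h ξ η

variable (P : HTensor H L T) (P' : HTensor H' L' T') (P'' : HTensor H'' L'' T'')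

theorem norm_incl_map_le (X : H →L[ℂ] H') (Y : L →L[ℂ] L') (x : H ⊗[ℂ] L) :
    ‖(P'.incl ∘ₗ TensorProduct.map X.toLinearMap Y.toLinearMap) x‖ ≤
      ‖X‖ * ‖Y‖ * ‖P.incl x‖ := by
  rw [LinearMap.comp_apply, P'.norm_incl, P.norm_incl]
  exact norm_map_clm_le X Y x

/-- The tensor product `X ⊗ Y` of two bounded operators. -/
def op (X : H →L[ℂ] H') (Y : L →L[ℂ] L') : T →L[ℂ] T' :=
  (P'.incl ∘ₗ TensorProduct.map X.toLinearMap Y.toLinearMap).extendOfNorm P.incl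

@[simp]
theorem op_pure (X : H →L[ℂ] H') (Y : L →L[ℂ] L') (ξ : H) (η : L) :
    P.op P' X Y (P.pure ξ η) = P'.pure (X ξ) (Y η) := by
  rw [← P.incl_tmul, op, LinearMap.extendOfNorm_eq P.denseRange_incl
    ⟨_, P.norm_incl_map_le P' X Y⟩]
  simp

theorem norm_op_le (X : H →L[ℂ] H') (Y : L →L[ℂ] L') : ‖P.op P' X Y‖ ≤ ‖X‖ * ‖Y‖ := by
  refine ContinuousLinearMap.opNorm_le_bound _ (by positivity) fun x => ?_
  induction x using P.denseRange.induction_on with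
  | hp => exact isClosed_le (by fun_prop) (by fun_prop)
  | ih x =>
    change ‖P.op P' X Y (P.incl x)‖ ≤ ‖X‖ * ‖Y‖ * ‖P.incl x‖
    rw [op, LinearMap.extendOfNorm_eq P.denseRange_incl ⟨_, P.norm_incl_map_le P' X Y⟩]
    exact P.norm_incl_map_le P' X Y x

theorem op_comp (X' : H' →L[ℂ] H'') (Y' : L' →L[ℂ] L'') (X : H →L[ℂ] H') (Y : L →L[ℂ] L') :
    P'.op P'' X' Y' ∘L P.op P' X Y = P.op P'' (X' ∘L X) (Y' ∘L Y) :=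
  P.ext_clm fun ξ η => by simp

theorem op_apply_op (X' : H' →L[ℂ] H'') (Y' : L' →L[ℂ] L'') (X : H →L[ℂ] H') (Y : L →L[ℂ] L')
    (x : T) : P'.op P'' X' Y' (P.op P' X Y x) = P.op P'' (X' ∘L X) (Y' ∘L Y) x :=
  congrArg (fun f => f x) (P.op_comp P' P'' X' Y' X Y)

theorem op_id : P.op P (ContinuousLinearMap.id ℂ H) (ContinuousLinearMap.id ℂ L) =
    ContinuousLinearMap.id ℂ T := P.ext_clm fun ξ η => by simp

theorem op_add_left (X X' : H →L[ℂ] H') (Y : L →L[ℂ] L') :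
    P.op P' (X + X') Y = P.op P' X Y + P.op P' X' Y := P.ext_clm fun ξ η => by simp

theorem op_add_right (X : H →L[ℂ] H') (Y Y' : L →L[ℂ] L') :
    P.op P' X (Y + Y') = P.op P' X Y + P.op P' X Y' := P.ext_clm fun ξ η => by simp

theorem op_smul_left (c : ℂ) (X : H →L[ℂ] H') (Y : L →L[ℂ] L') :
    P.op P' (c • X) Y = c • P.op P' X Y := P.ext_clm fun ξ η => by simp

theorem op_smul_right (c : ℂ) (X : H →L[ℂ] H') (Y : L →L[ℂ] L') :
    P.op P' X (c • Y) = c • P.op P' X Y := P.ext_clm fun ξ η => by simp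

theorem op_adjoint (X : H →L[ℂ] H') (Y : L →L[ℂ] L') :
    (P.op P' X Y).adjoint = P'.op P X.adjoint Y.adjoint := by
  symm
  rw [ContinuousLinearMap.eq_adjoint_iff]
  intro x y
  induction x using P'.induction with
  | hc => exact isClosed_eq (by fun_prop) (by fun_prop)
  | h0 => simp
  | hadd x x' hx hx' => simp only [map_add, inner_add_left, hx, hx']
  | h ξ η =>
    induction y using P.induction with
    | hc => exact isClosed_eq (by fun_prop) (by fun_prop)
    | h0 => simp
    | hadd x x' hx hx' => simp only [map_add, inner_add_right, hx, hx']
    | h ξ' η' => simp [P.inner_pure, P'.inner_pure, ContinuousLinearMap.adjoint_inner_left]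

/-- The isometry `X ⊗ Y` for isometries `X` and `Y`. -/
def isom (V : H →ₗᵢ[ℂ] H') (W : L →ₗᵢ[ℂ] L') : T →ₗᵢ[ℂ] T' where
  toLinearMap := P.op P' V.toContinuousLinearMap W.toContinuousLinearMap
  norm_map' x := by
    induction x using P.denseRange.induction_on with
    | hp => exact isClosed_eq (P.op P' _ _).continuous.norm continuous_norm
    | ih x =>
      change ‖P.op P' V.toContinuousLinearMap W.toContinuousLinearMap (P.incl x)‖ = ‖P.incl x‖
      rw [op, LinearMap.extendOfNorm_eq P.denseRange_incl ⟨_, P.norm_incl_map_le P' _ _⟩,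
        LinearMap.comp_apply, P'.norm_incl, P.norm_incl]
      exact TensorProduct.norm_map V W x

theorem isom_toCLM (V : H →ₗᵢ[ℂ] H') (W : L →ₗᵢ[ℂ] L') : (P.isom P' V W).toContinuousLinearMap =
    P.op P' V.toContinuousLinearMap W.toContinuousLinearMap := rfl

@[simp]
theorem isom_pure (V : H →ₗᵢ[ℂ] H') (W : L →ₗᵢ[ℂ] L') (ξ : H) (η : L) :
    P.isom P' V W (P.pure ξ η) = P'.pure (V ξ) (W η) :=
  P.op_pure P' _ _ ξ η

/-- The bounded operator `ξ ↦ ξ ⊗ η`. -/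
def creRight (η : L) : H →L[ℂ] T :=
  (P.pure.flip η).mkContinuous ‖η‖ fun ξ => by
    rw [LinearMap.flip_apply, P.norm_pure, mul_comm]

end HTensor

/-! ### Compact operators -/

/-- The rank one operator `ζ ↦ ⟨η, ζ⟩ ξ` as an element of `K(H)`. -/
def K.rankOne (ξ η : H) : K H := K.ofOp (InnerProductSpace.rankOne ℂ ξ η) (by
  rw [InnerProductSpace.rankOne_def']
  have : IsCompactOperator (ContinuousLinearMap.id ℂ ℂ) := by
    have := FiniteDimensional.proper ℂ ℂ
    exact ⟨Metric.closedBall 0 1, isCompact_closedBall _ _,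
      Metric.closedBall_mem_nhds _ one_pos⟩
  exact (this.comp_clm (innerSL ℂ η)).clm_comp (ContinuousLinearMap.toSpanSingleton ℂ ξ))

@[simp]
theorem K.rankOne_op (ξ η ζ : H) : (K.rankOne ξ η).op ζ = inner ℂ η ζ • ξ := rfl

theorem isCompactOperator_of_finite_range (T : H →L[ℂ] H)
    [FiniteDimensional ℂ (LinearMap.range T.toLinearMap)] : IsCompactOperator T := by
  have := FiniteDimensional.proper ℂ (LinearMap.range T.toLinearMap)
  have h : IsCompactOperator (ContinuousLinearMap.id ℂ (LinearMap.range T.toLinearMap)) :=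
    ⟨Metric.closedBall 0 1, isCompact_closedBall _ _, Metric.closedBall_mem_nhds _ one_pos⟩
  exact (h.comp_clm (T.codRestrict _ (LinearMap.mem_range_self T.toLinearMap))).clm_comp
    (LinearMap.range T.toLinearMap).subtypeL

/-- Compact operators are approximated by their products with projections of finite rank: the
range of the projection is the span of an `ε`-net of the image of the unit ball. -/
theorem exists_finiteDimensional_norm_sub_lt (T : K H) {ε : ℝ} (hε : 0 < ε) :
    ∃ E : Submodule ℂ H, ∃ _ : FiniteDimensional ℂ E,
      ‖T.op - E.starProjection ∘L T.op‖ < ε := by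
  have hc := T.isCompact.isCompact_closure_image_closedBall (𝕜₁ := ℂ)
    (f := (T.op : H →ₗ[ℂ] H)) 1
  obtain ⟨t, htf, ht⟩ := Metric.totallyBounded_iff.1 hc.totallyBounded (ε / 4) (by positivity)
  have hfin : FiniteDimensional ℂ (Submodule.span ℂ t) := FiniteDimensional.span_of_finite ℂ htf
  refine ⟨Submodule.span ℂ t, hfin, lt_of_le_of_lt (b := ε / 2) ?_ (by linarith)⟩
  refine ContinuousLinearMap.opNorm_le_of_unit_norm (by positivity) fun x hx => ?_
  have h1 := ht (subset_closure ⟨x, by simp [hx], rfl⟩)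
  simp only [Set.mem_iUnion] at h1
  obtain ⟨y, hy, hxy⟩ := h1
  rw [Metric.mem_ball, dist_eq_norm] at hxy
  have h2 : (Submodule.span ℂ t).starProjection y = y :=
    Submodule.starProjection_eq_self_iff.2 (Submodule.subset_span hy)
  change ‖T.op x - (Submodule.span ℂ t).starProjection (T.op x)‖ ≤ ε / 2
  have h3 : T.op x - (Submodule.span ℂ t).starProjection (T.op x) =
      (T.op x - y) - (Submodule.span ℂ t).starProjection (T.op x - y) := by
    rw [map_sub, h2]; abel
  rw [h3]
  have h4 := Submodule.norm_starProjection_apply_le (Submodule.span ℂ t) (T.op x - y)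
  have h5 : ‖T.op x - y‖ < ε / 4 := hxy
  linarith [norm_sub_le (T.op x - y) ((Submodule.span ℂ t).starProjection (T.op x - y))]

/-- The orthogonal projection onto a subspace of finite dimension as a compact operator. -/
def K.proj (E : Submodule ℂ H) [FiniteDimensional ℂ E] : K H :=
  K.ofOp E.starProjection (by
    have : FiniteDimensional ℂ (LinearMap.range E.starProjection.toLinearMap) := by
      rw [Submodule.range_starProjection]; infer_instance
    exact isCompactOperator_of_finite_range _)

@[simp]
theorem K.op_proj (E : Submodule ℂ H) [FiniteDimensional ℂ E] :
    (K.proj E).op = E.starProjection := rfl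

theorem K.isStarProjection_proj (E : Submodule ℂ H) [FiniteDimensional ℂ E] :
    IsStarProjection (K.proj E) where
  isIdempotentElem := K.ext fun x => by
    simp [Submodule.starProjection_eq_self_iff]
  isSelfAdjoint := K.ext fun x => by
    have := isSelfAdjoint_starProjection E
    rw [K.op_star, K.op_proj, this.star_eq]

theorem K.exists_norm_sub_mul_lt (T : K H) {ε : ℝ} (hε : 0 < ε) :
    ∃ E : Submodule ℂ H, ∃ _ : FiniteDimensional ℂ E, ‖T - T * K.proj E‖ < ε := by
  obtain ⟨E, hE, h⟩ := exists_finiteDimensional_norm_sub_lt (star T) hε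
  refine ⟨E, hE, ?_⟩
  rw [← norm_star, star_sub, star_mul, (K.isStarProjection_proj E).isSelfAdjoint.star_eq]
  exact h

/-- A compact operator restricted to a subspace of finite dimension is a sum of operators of rank
one, one for each vector of an orthonormal basis. -/
theorem K.mul_proj_mem_span (T : K H) (E : Submodule ℂ H) [FiniteDimensional ℂ E] :
    T * K.proj E ∈ Submodule.span ℂ (Set.range fun p : H × H => K.rankOne p.1 p.2) := by
  let b := stdOrthonormalBasis ℂ E
  have h : T * K.proj E = ∑ i, K.rankOne (T.op (b i)) (b i) := by
    refine K.ext fun x => ?_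
    have e : (∑ i, K.rankOne (T.op (b i)) (b i)).op = ∑ i, (K.rankOne (T.op (b i)) (b i)).op := by
      exact map_sum ((compacts H).toSubmodule.subtype : K H →ₗ[ℂ] (H →L[ℂ] H)) _ _
    rw [e, K.op_mul, mul_apply_eq_comp, K.op_proj, Submodule.starProjection_apply,
      ← b.sum_repr' (E.orthogonalProjectionOnto x)]
    simp
  rw [h]
  exact Submodule.sum_mem _ fun i _ => Submodule.subset_span ⟨(_, _), rfl⟩

/-- The operators of rank one span a dense subspace of the compact operators. -/
@[elab_as_elim]
theorem K.induction {p : K H → Prop} (T : K H) (hc : IsClosed {T | p T}) (h0 : p 0)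
    (hadd : ∀ S T, p S → p T → p (S + T)) (h : ∀ ξ η, p (K.rankOne ξ η)) : p T := by
  have hspan : ∀ S ∈ Submodule.span ℂ (Set.range fun q : H × H => K.rankOne q.1 q.2), p S := by
    intro S hS
    induction hS using Submodule.closure_induction with
    | zero => exact h0
    | add x y _ _ hx hy => exact hadd _ _ hx hy
    | smul_mem c x hx =>
      obtain ⟨⟨ξ, η⟩, rfl⟩ := hx
      have : c • K.rankOne ξ η = K.rankOne (c • ξ) η := K.ext fun x => by
        simp [smul_comm c]
      change p (c • K.rankOne ξ η)
      rw [this]; exact h _ _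
  have hT : T ∈ closure {T | p T} := by
    refine Metric.mem_closure_iff.2 fun ε hε => ?_
    obtain ⟨E, hE, hlt⟩ := T.exists_norm_sub_mul_lt hε
    exact ⟨_, hspan _ (T.mul_proj_mem_span E), by rwa [dist_eq_norm]⟩
  rwa [hc.closure_eq] at hT

/-- Tensor products of compact operators are compact. -/
theorem HTensor.isCompactOperator_op (P : HTensor H L T) (s : K H) (k : K L) :
    IsCompactOperator (P.op P s.op k.op) := by
  have hcl : IsClosed {S : T →L[ℂ] T | IsCompactOperator S} :=
    isClosed_setOfPred_isCompactOperator (σ₁₂ := RingHom.id ℂ) (M₁ := T) (M₂ := T)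
  have hopc : Continuous (K.op : K H → H →L[ℂ] H) := continuous_subtype_val
  have hopc' : Continuous (K.op : K L → L →L[ℂ] L) := continuous_subtype_val
  let B : (H →L[ℂ] H) →ₗ[ℂ] (L →L[ℂ] L) →ₗ[ℂ] (T →L[ℂ] T) := LinearMap.mk₂ ℂ (P.op P)
    (P.op_add_left P) (P.op_smul_left P) (P.op_add_right P) (P.op_smul_right P)
  have hB : Continuous fun p : (H →L[ℂ] H) × (L →L[ℂ] L) => P.op P p.1 p.2 :=
    (B.mkContinuous₂ 1 fun x y => by rw [one_mul]; exact P.norm_op_le P x y).continuous₂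
  induction s using K.induction with
  | hc =>
    exact hcl.preimage (hB.comp (hopc.prodMk continuous_const))
  | h0 =>
    have : P.op P (0 : K H).op k.op = 0 := P.ext_clm fun ξ η => by simp
    rw [this]; exact isCompactOperator_zero
  | hadd S S' h h' => rw [K.op_add, P.op_add_left]; exact h.add h'
  | h ξ η =>
    induction k using K.induction with
    | hc => exact hcl.preimage (hB.comp (continuous_const.prodMk hopc'))
    | h0 =>
      have : P.op P (K.rankOne ξ η).op (0 : K L).op = 0 := P.ext_clm fun ξ η => by simp
      rw [this]; exact isCompactOperator_zero
    | hadd S S' h h' => rw [K.op_add, P.op_add_right]; exact h.add h'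
    | h ξ' η' =>
      have : P.op P (K.rankOne ξ η).op (K.rankOne ξ' η').op =
          (K.rankOne (P.pure ξ ξ') (P.pure η η')).op := P.ext_clm fun x y => by
        simp [P.inner_pure, smul_smul, mul_comm]
      rw [this]; exact K.isCompact _

namespace HTensor

variable (P : HTensor H L T)

/-- The tensor product `s ⊗ k` of two compact operators. -/
def tensK (s : K H) (k : K L) : K T := K.ofOp (P.op P s.op k.op) (P.isCompactOperator_op s k)

@[simp] theorem tensK_op (s : K H) (k : K L) : (P.tensK s k).op = P.op P s.op k.op := rfl

theorem tensK_rankOne (ξ η : H) (ξ' η' : L) :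
    P.tensK (K.rankOne ξ η) (K.rankOne ξ' η') = K.rankOne (P.pure ξ ξ') (P.pure η η') := by
  have : P.op P (K.rankOne ξ η).op (K.rankOne ξ' η').op =
      (K.rankOne (P.pure ξ ξ') (P.pure η η')).op := P.ext_clm fun x y => by
    simp [P.inner_pure, smul_smul, mul_comm]
  exact K.ext fun x => congrArg (fun f => f x) this

theorem tensK_add_left (s s' : K H) (k : K L) :
    P.tensK (s + s') k = P.tensK s k + P.tensK s' k :=
  K.ext fun x => congrArg (fun f => f x) (P.op_add_left P s.op s'.op k.op)

theorem tensK_add_right (s : K H) (k k' : K L) :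
    P.tensK s (k + k') = P.tensK s k + P.tensK s k' :=
  K.ext fun x => congrArg (fun f => f x) (P.op_add_right P s.op k.op k'.op)

theorem tensK_smul_left (c : ℂ) (s : K H) (k : K L) : P.tensK (c • s) k = c • P.tensK s k :=
  K.ext fun x => congrArg (fun f => f x) (P.op_smul_left P c s.op k.op)

theorem tensK_smul_right (c : ℂ) (s : K H) (k : K L) : P.tensK s (c • k) = c • P.tensK s k :=
  K.ext fun x => congrArg (fun f => f x) (P.op_smul_right P c s.op k.op)

theorem tensK_mul (s s' : K H) (k k' : K L) :
    P.tensK s k * P.tensK s' k' = P.tensK (s * s') (k * k') :=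
  K.ext fun x => P.op_apply_op P P s.op k.op s'.op k'.op x

theorem star_tensK (s : K H) (k : K L) : star (P.tensK s k) = P.tensK (star s) (star k) :=
  K.ext fun x => congrArg (fun f => f x) (P.op_adjoint P s.op k.op)

theorem norm_tensK_le (s : K H) (k : K L) : ‖P.tensK s k‖ ≤ ‖s‖ * ‖k‖ := P.norm_op_le P s.op k.op

end HTensor

end HilbertTensor

/-! ### Positivity in C*-algebras -/

section Positivity

variable {D : Type*} [NonUnitalCStarAlgebra D]

theorem norm_le_of_star_mul_self_add_eq {x y z : D} {r : ℝ} (hr : 0 ≤ r)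
    (h : star x * x + star y * y = ((r ^ 2 : ℝ) : ℂ) • (star z * z)) : ‖x‖ ≤ r * ‖z‖ := by
  let _ := CStarAlgebra.spectralOrder D
  have := CStarAlgebra.spectralOrderedRing D
  have h1 : star x * x ≤ ((r ^ 2 : ℝ) : ℂ) • (star z * z) := by
    rw [← h]; exact le_add_of_nonneg_right (star_mul_self_nonneg y)
  have h2 := CStarAlgebra.norm_le_norm_of_nonneg_of_le (star_mul_self_nonneg x) h1
  rw [norm_smul, CStarRing.norm_star_mul_self, CStarRing.norm_star_mul_self] at h2
  refine le_of_sq_le_sq ?_ (by positivity)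
  have : ‖((r ^ 2 : ℝ) : ℂ)‖ = r ^ 2 := by
    rw [Complex.norm_real, Real.norm_of_nonneg (by positivity)]
  rw [this] at h2
  nlinarith

open scoped ComplexOrder in
/-- The positive functionals separate the elements `c* c` from `0`: this is the Hahn-Banach
theorem, applied to `-c* c` and the closed cone of positive elements. -/
theorem exists_positive_apply_ne_zero [PartialOrder D] [StarOrderedRing D] {c : D} (hc : c ≠ 0) :
    ∃ f : D →ₚ[ℂ] ℂ, f (star c * c) ≠ 0 := by
  have hneg : -(star c * c) ∉ ProperCone.positive ℝ D := by
    intro h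
    have h1 : star c * c ≤ 0 := neg_nonneg.1 h
    have h2 := le_antisymm h1 (star_mul_self_nonneg c)
    exact hc (CStarRing.star_mul_self_eq_zero_iff c |>.1 h2)
  obtain ⟨g, hg, hg'⟩ := (ProperCone.positive ℝ D).hyperplane_separation_point hneg
  let F : D →ₗ[ℂ] ℂ :=
    { toFun := fun x => (g (realPart x : D) : ℂ) + Complex.I * (g (imaginaryPart x : D) : ℂ)
      map_add' := fun x y => by simp; ring
      map_smul' := fun z x => by
        simp only [realPart_smul, imaginaryPart_smul, AddSubgroupClass.coe_sub,
          selfAdjoint.val_smul, map_sub, map_smul, smul_eq_mul, AddSubgroup.coe_add, map_add,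
          RingHom.id_apply]
        apply Complex.ext <;> simp }
  have hF : ∀ x : D, 0 ≤ x → F x = g x := fun x hx => by
    have h1 := (IsSelfAdjoint.of_nonneg hx)
    change (g (realPart x : D) : ℂ) + Complex.I * (g (imaginaryPart x : D) : ℂ) = g x
    rw [h1.imaginaryPart, h1.coe_realPart]
    simp
  refine ⟨PositiveLinearMap.mk₀ F fun x hx => ?_, ?_⟩
  · rw [hF x hx]
    exact_mod_cast hg x hx
  · change F _ ≠ 0
    rw [hF _ (star_mul_self_nonneg c)]
    rw [map_neg] at hg'
    exact_mod_cast (neg_lt_zero.1 hg').ne'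

end Positivity

/-! ### Homomorphisms and multipliers on C*-tensor products -/

namespace CTensor

variable {A B D : Type*} [NonUnitalCStarAlgebra A] [NonUnitalCStarAlgebra B]
  [NonUnitalCStarAlgebra D]

theorem zero_tmul (b : B) : tmul (0 : A) b = 0 := by
  simpa using smul_tmul' (0 : ℂ) (0 : A) b

theorem tmul_zero (a : A) : tmul a (0 : B) = 0 := by
  simpa using tmul_smul (0 : ℂ) a (0 : B)

/-- The bilinear map underlying the elementary tensors. -/
def tmulₗ : A →ₗ[ℂ] B →ₗ[ℂ] CTensor A B := LinearMap.mk₂ ℂ tmul add_tmul smul_tmul' tmul_add tmul_smul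

theorem continuous_tmul_left (b : B) : Continuous fun a : A => tmul a b :=
  continuous_tmul.comp (continuous_id.prodMk continuous_const)

theorem continuous_tmul_right (a : A) : Continuous fun b : B => tmul a b :=
  continuous_tmul.comp (continuous_const.prodMk continuous_id)

theorem clm_ext {E : Type*} [NormedAddCommGroup E] [NormedSpace ℂ E]
    {f g : CTensor A B →L[ℂ] E} (h : ∀ a b, f (tmul a b) = g (tmul a b)) : f = g := by
  ext x
  induction x using induction_tmul with
  | hc => exact isClosed_eq f.continuous g.continuous
  | h0 => simp
  | hadd x y hx hy => simp only [map_add, hx, hy]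
  | h a b => exact h a b

@[elab_as_elim]
theorem _root_.EqCuntz.AlgTensor.induction_on {p : AlgTensor A B → Prop} (x : AlgTensor A B)
    (h0 : p 0) (hadd : ∀ x y, p x → p y → p (x + y)) (h : ∀ a b, p (AlgTensor.tmul a b)) : p x :=
  TensorProduct.induction_on (motive := p) x h0 h hadd

theorem _root_.EqCuntz.AlgTensor.tmul_mul_tmul (a a' : A) (b b' : B) :
    AlgTensor.tmul a b * AlgTensor.tmul a' b' = AlgTensor.tmul (a * a') (b * b') :=
  Algebra.TensorProduct.tmul_mul_tmul a a' b b'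

theorem _root_.EqCuntz.AlgTensor.star_tmul (a : A) (b : B) :
    star (AlgTensor.tmul a b) = AlgTensor.tmul (star a) (star b) := rfl

theorem _root_.EqCuntz.AlgTensor.add_tmul (a a' : A) (b : B) :
    AlgTensor.tmul (a + a') b = AlgTensor.tmul a b + AlgTensor.tmul a' b :=
  TensorProduct.add_tmul a a' b

theorem _root_.EqCuntz.AlgTensor.smul_tmul' (c : ℂ) (a : A) (b : B) :
    AlgTensor.tmul (c • a) b = c • AlgTensor.tmul a b := rfl

section Lift

variable (β : A →ₗ[ℂ] B →ₗ[ℂ] D)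
  (hmul : ∀ a a' b b', β a b * β a' b' = β (a * a') (b * b'))
  (hstar : ∀ a b, star (β a b) = β (star a) (star b))
  (hnorm : ∀ a b, ‖β a b‖ ≤ ‖a‖ * ‖b‖)

include hmul in
theorem lift_mul_aux (x y : A ⊗[ℂ] B) : TensorProduct.lift β (x * y) =
    TensorProduct.lift β x * TensorProduct.lift β y := by
  induction x using TensorProduct.induction_on with
  | zero => simp
  | add x x' hx hx' => simp only [add_mul, map_add, hx, hx']
  | tmul a b =>
    induction y using TensorProduct.induction_on with
    | zero => simp
    | add y y' hy hy' => simp only [mul_add, map_add, hy, hy']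
    | tmul a' b' => simp [hmul]

include hstar in
theorem lift_star_aux (x : A ⊗[ℂ] B) : TensorProduct.lift β (star x) =
    star (TensorProduct.lift β x) := by
  induction x using TensorProduct.induction_on with
  | zero => simp
  | add x x' hx hx' => simp only [star_add, map_add, hx, hx']
  | tmul a b => simp [hstar]

include hmul hstar hnorm in
theorem norm_lift_le (x : A ⊗[ℂ] B) : ‖TensorProduct.lift β x‖ ≤ maxNorm x := by
  refine le_maxNorm (p := (normSeminorm ℂ D).comp (TensorProduct.lift β)) ⟨fun x y => ?_,
    fun x => ?_, fun a b => ?_⟩ x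
  · simp only [Seminorm.comp_apply, coe_normSeminorm, lift_mul_aux β hmul]
    exact norm_mul_le _ _
  · simp only [Seminorm.comp_apply, coe_normSeminorm, lift_mul_aux β hmul,
      lift_star_aux β hstar]
    exact CStarRing.norm_star_mul_self
  · simpa using hnorm a b

/-- The extension of the linearisation of `β` to the completed tensor product. -/
def liftL : CTensor A B →L[ℂ] D :=
  extend (LinearMap.mkContinuous (E := AlgTensor A B) (σ := RingHom.id ℂ)
    (TensorProduct.lift β) 1 fun x => by
      rw [one_mul]; exact norm_lift_le β hmul hstar hnorm x)

theorem liftL_incl (x : AlgTensor A B) :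
    liftL β hmul hstar hnorm (incl A B x) = TensorProduct.lift β x := extend_incl _ x

/-- The universal property of the largest C*-norm: a bilinear map which is multiplicative,
preserves the involution and is bounded on elementary tensors induces a `*`-homomorphism. -/
def lift : CTensor A B →⋆ₙₐ[ℂ] D where
  toFun := liftL β hmul hstar hnorm
  map_smul' c x := map_smul _ c x
  map_zero' := map_zero _
  map_add' x y := map_add _ x y
  map_mul' x y := by
    induction x using CTensor.induction with
    | hc => exact isClosed_eq (by fun_prop) (by fun_prop)
    | h x =>
      induction y using CTensor.induction with
      | hc => exact isClosed_eq (by fun_prop) (by fun_prop)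
      | h y =>
        rw [← incl_mul, liftL_incl, liftL_incl, liftL_incl]
        exact lift_mul_aux β hmul x y
  map_star' x := by
    induction x using CTensor.induction with
    | hc => exact isClosed_eq (by fun_prop) (by fun_prop)
    | h x =>
      rw [← incl_star, liftL_incl, liftL_incl]
      exact lift_star_aux β hstar x

@[simp]
theorem lift_tmul (a : A) (b : B) : lift β hmul hstar hnorm (tmul a b) = β a b :=
  (liftL_incl β hmul hstar hnorm _).trans (TensorProduct.lift.tmul a b)

end Lift

variable (A B) in
/-- The flip `A ⊗ B → B ⊗ A`. -/
def flip : CTensor A B →⋆ₙₐ[ℂ] CTensor B A :=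
  lift (tmulₗ (A := B) (B := A)).flip (fun a a' b b' => tmul_mul_tmul b b' a a')
    (fun a b => star_tmul b a) fun a b => (norm_tmul_le b a).trans_eq (mul_comm _ _)

@[simp]
theorem flip_tmul (a : A) (b : B) : flip A B (tmul a b) = tmul b a := lift_tmul _ _ _ _ a b

theorem flip_flip (x : CTensor A B) : flip B A (flip A B x) = x :=
  congrArg (fun f => f x) (show (flip B A).comp (flip A B) = NonUnitalStarAlgHom.id ℂ _ from
    hom_ext fun a b => by simp)

theorem continuous_hom (f : CTensor A B →⋆ₙₐ[ℂ] D) : Continuous f :=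
  AddMonoidHomClass.continuous_of_bound f 1 fun x => by
    simpa using NonUnitalStarAlgHom.norm_apply_le f x

end CTensor

section Multipliers

variable {H H₁ H₂ H₃ : Type*} [NormedAddCommGroup H] [InnerProductSpace ℂ H] [CompleteSpace H]
  [NormedAddCommGroup H₁] [InnerProductSpace ℂ H₁] [CompleteSpace H₁]
  [NormedAddCommGroup H₂] [InnerProductSpace ℂ H₂] [CompleteSpace H₂]
  [NormedAddCommGroup H₃] [InnerProductSpace ℂ H₃] [CompleteSpace H₃]
variable {A : Type*} [NonUnitalCStarAlgebra A]

theorem isCompactOperator_sandwich (X Y : H₁ →L[ℂ] H₂) (T : K H₁) : IsCompactOperator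
    (X ∘L T.op ∘L Y.adjoint : H₂ →L[ℂ] H₂) := (T.isCompact.comp_clm _).clm_comp _

/-- The map `T ↦ X T Y*` on compact operators. -/
def K.sandwich (X Y : H₁ →L[ℂ] H₂) : K H₁ →ₗ[ℂ] K H₂ where
  toFun T := K.ofOp (X ∘L T.op ∘L Y.adjoint) (isCompactOperator_sandwich X Y T)
  map_add' S T := K.ext fun x => by simp
  map_smul' c T := K.ext fun x => by simp

theorem K.sandwich_op (X Y : H₁ →L[ℂ] H₂) (T : K H₁) (x : H₂) :
    (K.sandwich X Y T).op x = X (T.op (Y.adjoint x)) := rfl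

/-- Left multiplication by `X ⊗ 1` on the algebraic tensor product `K(H) ⊗ A`. -/
def lmulAlg (A : Type*) [NonUnitalCStarAlgebra A] (X : H →L[ℂ] H) :
    AlgTensor (K H) A →ₗ[ℂ] AlgTensor (K H) A :=
  TensorProduct.map (K.sandwich X 1) LinearMap.id

theorem lmulAlg_tmul (X : H →L[ℂ] H) (S : K H) (a : A) :
    lmulAlg A X (AlgTensor.tmul S a) = AlgTensor.tmul (K.sandwich X 1 S) a := rfl

theorem one_adjoint_apply (x : H) : (1 : H →L[ℂ] H).adjoint x = x := by
  rw [← ContinuousLinearMap.star_eq_adjoint, star_one]; rfl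

theorem star_lmulAlg_mul (X : H →L[ℂ] H) (s t : AlgTensor (K H) A) :
    star (lmulAlg A X s) * lmulAlg A X t = star s * lmulAlg A (X.adjoint ∘L X) t := by
  induction s using AlgTensor.induction_on with
  | h0 => simp
  | hadd s s' hs hs' => simp only [map_add, star_add, add_mul, hs, hs']
  | h S a =>
    induction t using AlgTensor.induction_on with
    | h0 => simp
    | hadd t t' ht ht' => simp only [map_add, mul_add, ht, ht']
    | h T b =>
      have h : star (K.sandwich X 1 S) * K.sandwich X 1 T =
          star S * K.sandwich (X.adjoint ∘L X) 1 T := by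
        refine K.ext fun x => ext_inner_left ℂ fun y => ?_
        simp [K.sandwich_op, ContinuousLinearMap.star_eq_adjoint,
          ContinuousLinearMap.adjoint_inner_right, one_adjoint_apply]
      simp only [lmulAlg_tmul, AlgTensor.star_tmul, AlgTensor.tmul_mul_tmul, h]

theorem lmulAlg_adjoint_add {X Y : H →L[ℂ] H} {c : ℂ}
    (h : X.adjoint ∘L X + Y.adjoint ∘L Y = c • ContinuousLinearMap.id ℂ H)
    (t : AlgTensor (K H) A) :
    lmulAlg A (X.adjoint ∘L X) t + lmulAlg A (Y.adjoint ∘L Y) t = c • t := by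
  induction t using AlgTensor.induction_on with
  | h0 => simp
  | hadd s s' hs hs' => rw [map_add, map_add, smul_add, ← hs, ← hs']; abel
  | h S a =>
    rw [lmulAlg_tmul, lmulAlg_tmul, ← AlgTensor.add_tmul, ← AlgTensor.smul_tmul']
    congr 1
    refine K.ext fun x => ?_
    simp only [K.op_add, add_apply, K.sandwich_op, one_adjoint_apply]
    exact congrArg (fun f => f (S.op x)) h

/-- Left multiplication by `X ⊗ 1` is bounded by `‖X‖`: with `Y* Y = ‖X‖² - X* X`, one has
`(X t)* (X t) + (Y t)* (Y t) = ‖X‖² t* t`. -/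
theorem norm_incl_lmulAlg_le (X : H →L[ℂ] H) (t : AlgTensor (K H) A) :
    ‖CTensor.incl (K H) A (lmulAlg A X t)‖ ≤ ‖X‖ * ‖t‖ := by
  obtain ⟨Y, hY⟩ := exists_adjoint_comp_self_add X
  rw [← CTensor.norm_incl t]
  refine norm_le_of_star_mul_self_add_eq (y := CTensor.incl (K H) A (lmulAlg A Y t))
    (norm_nonneg X) ?_
  simp only [← CTensor.incl_star, ← CTensor.incl_mul]
  rw [← map_add, ← map_smul, star_lmulAlg_mul, star_lmulAlg_mul, ← mul_add,
    lmulAlg_adjoint_add hY, mul_smul_comm]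

/-- Left multiplication by `X ⊗ 1` on `K(H) ⊗ A`. -/
def lmul (A : Type*) [NonUnitalCStarAlgebra A] (X : H →L[ℂ] H) :
    CTensor (K H) A →L[ℂ] CTensor (K H) A :=
  CTensor.extend (LinearMap.mkContinuous (E := AlgTensor (K H) A) (σ := RingHom.id ℂ)
    ((CTensor.incl (K H) A).toLinearMap ∘ₗ lmulAlg A X) ‖X‖ (norm_incl_lmulAlg_le X))

theorem lmul_incl (X : H →L[ℂ] H) (t : AlgTensor (K H) A) :
    lmul A X (CTensor.incl (K H) A t) = CTensor.incl (K H) A (lmulAlg A X t) :=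
  CTensor.extend_incl _ t

theorem lmul_tmul (X : H →L[ℂ] H) (T : K H) (a : A) :
    lmul A X (CTensor.tmul T a) = CTensor.tmul (K.sandwich X 1 T) a :=
  lmul_incl X _

theorem norm_lmul_le (X : H →L[ℂ] H) (z : CTensor (K H) A) : ‖lmul A X z‖ ≤ ‖X‖ * ‖z‖ :=
  CTensor.norm_extend_le _ (norm_incl_lmulAlg_le X) z

end Multipliers

/-! ### Slice maps -/

section Slices

variable {H L T : Type*} [NormedAddCommGroup H] [InnerProductSpace ℂ H] [CompleteSpace H]
  [NormedAddCommGroup L] [InnerProductSpace ℂ L] [CompleteSpace L]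
  [NormedAddCommGroup T] [InnerProductSpace ℂ T] [CompleteSpace T]
variable {A : Type*} [NonUnitalCStarAlgebra A]

/-- The representation `S ⊗ a ↦ S ⊗ π(a)` of `K(H) ⊗ A` on `H ⊗ L`, for a representation `π` of
`A` on `L`. -/
def tensorRep (P : HTensor H L T) (π : A →⋆ₙₐ[ℂ] (L →L[ℂ] L)) :
    CTensor (K H) A →⋆ₙₐ[ℂ] (T →L[ℂ] T) :=
  CTensor.lift (LinearMap.mk₂ ℂ (fun (S : K H) a => P.op P S.op (π a))
      (fun S S' a => by rw [K.op_add, P.op_add_left])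
      (fun c S a => by rw [K.op_smul, P.op_smul_left])
      (fun S a a' => by rw [map_add, P.op_add_right])
      (fun c S a => by rw [map_smul, P.op_smul_right]))
    (fun S S' a a' => by
      simp only [LinearMap.mk₂_apply, map_mul]; exact P.op_comp P P _ _ _ _)
    (fun S a => by
      simp only [LinearMap.mk₂_apply, map_star]; exact P.op_adjoint P _ _)
    (fun S a => (P.norm_op_le P _ _).trans (mul_le_mul_of_nonneg_left
      (NonUnitalStarAlgHom.norm_apply_le π a) (norm_nonneg _)))

theorem tensorRep_tmul (P : HTensor H L T) (π : A →⋆ₙₐ[ℂ] (L →L[ℂ] L)) (S : K H) (a : A) :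
    tensorRep P π (CTensor.tmul S a) = P.op P S.op (π a) := CTensor.lift_tmul _ _ _ _ S a

/-- The embedding `a ↦ p ⊗ a` of `A` as a corner of `K(H) ⊗ A`. -/
def cornerLeft (A : Type*) [NonUnitalCStarAlgebra A] {p : K H} (hp : IsStarProjection p) :
    A →⋆ₙₐ[ℂ] CTensor (K H) A := (CTensor.flip _ _).comp (EquivHom.cornerHom A hp)

theorem cornerLeft_apply {p : K H} (hp : IsStarProjection p) (a : A) :
    cornerLeft A hp a = CTensor.tmul p a := CTensor.flip_tmul a p

theorem K.isStarProjection_rankOne {e : H} (he : ‖e‖ = 1) :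
    IsStarProjection (K.rankOne e e) where
  isIdempotentElem := K.ext fun x => by
    simp [inner_self_eq_norm_sq_to_K, he]
  isSelfAdjoint := K.ext fun x =>
    congrArg (fun f : H →L[ℂ] H => f x) (InnerProductSpace.adjoint_rankOne (𝕜 := ℂ) e e)

/-- The corner embedding is injective: for `a ≠ 0`, a positive functional which does not vanish on
`(a a*)* (a a*)` yields a representation `π` with `π(a) ≠ 0`, hence a representation of
`K(H) ⊗ A` not vanishing on the image of `a`. -/
theorem cornerLeft_injective {e : H} (he : ‖e‖ = 1) :
    Function.Injective (cornerLeft A (K.isStarProjection_rankOne he)) := by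
  rw [injective_iff_map_eq_zero]
  intro a ha
  by_contra hne
  let _ := CStarAlgebra.spectralOrder A
  have := CStarAlgebra.spectralOrderedRing A
  have hb : a * star a ≠ 0 := fun h => hne (CStarRing.mul_star_self_eq_zero_iff a |>.1 h)
  obtain ⟨f, hf⟩ := exists_positive_apply_ne_zero hb
  let P := HTensor.completion H f.GNS
  have h1 := congrArg (tensorRep P f.gnsNonUnitalStarAlgHom) ha
  rw [cornerLeft_apply, map_zero, tensorRep_tmul] at h1
  have h2 := congrArg (fun g => g (P.pure e ((f.toPreGNS (star a) : f.PreGNS) : f.GNS))) h1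
  simp only [HTensor.op_pure] at h2
  have h3 := congrArg norm h2
  rw [P.norm_pure, K.rankOne_op, norm_smul, inner_self_eq_norm_sq_to_K, he,
    PositiveLinearMap.gnsNonUnitalStarAlgHom_apply_coe] at h3
  simp only [UniformSpace.Completion.norm_coe] at h3
  have h4 : ‖f.toPreGNS (a * star a)‖ = 0 := by simpa using h3
  apply hf
  have h5 := f.preGNS_norm_sq (f.toPreGNS (a * star a))
  rw [h4] at h5
  simpa using h5.symm

theorem norm_rankOne_tmul {e : H} (he : ‖e‖ = 1) (a : A) :
    ‖CTensor.tmul (K.rankOne e e) a‖ = ‖a‖ := by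
  rw [← cornerLeft_apply (K.isStarProjection_rankOne he)]
  exact NonUnitalStarAlgHom.norm_map _ (cornerLeft_injective he) a

/-- The slice map `S ⊗ a ↦ ⟨ξ, S η⟩ a` on the algebraic tensor product. -/
def sliceAlg (A : Type*) [NonUnitalCStarAlgebra A] (ξ η : H) : AlgTensor (K H) A →ₗ[ℂ] A :=
  TensorProduct.lift (LinearMap.mk₂ ℂ (fun (S : K H) (a : A) => (inner ℂ ξ (S.op η) : ℂ) • a)
    (fun S S' a => by rw [K.op_add, add_apply, inner_add_right, add_smul])
    (fun c S a => by rw [K.op_smul, smul_apply, inner_smul_right, smul_smul])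
    (fun S a a' => smul_add _ _ _) (fun c S a => smul_comm _ _ _))

theorem sliceAlg_tmul (ξ η : H) (S : K H) (a : A) :
    sliceAlg A ξ η (AlgTensor.tmul S a) = (inner ℂ ξ (S.op η) : ℂ) • a := rfl

/-- The slice `⟨ξ, · η⟩ ⊗ id` is a compression by operators of rank one. This bounds it in terms of
left multiplications; the multiplication on the right is written by means of the involution. -/
theorem rankOne_tmul_sliceAlg (e ξ η : H) (t : AlgTensor (K H) A) :
    CTensor.tmul (K.rankOne e e) (sliceAlg A ξ η t) =
      lmul A (InnerProductSpace.rankOne ℂ e ξ) (star (lmul A (InnerProductSpace.rankOne ℂ e η)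
        (star (CTensor.incl (K H) A t)))) := by
  induction t using AlgTensor.induction_on with
  | h0 => simp [CTensor.tmul_zero]
  | hadd x y hx hy => simp only [map_add, CTensor.tmul_add, hx, hy, star_add]
  | h S a =>
    change _ = lmul A _ (star (lmul A _ (star (CTensor.tmul S a))))
    rw [CTensor.star_tmul, lmul_tmul, CTensor.star_tmul, lmul_tmul, star_star, sliceAlg_tmul,
      CTensor.tmul_smul, ← CTensor.smul_tmul']
    congr 1
    refine K.ext fun x => ext_inner_left ℂ fun y => ?_
    have h : inner ℂ ξ ((star (K.sandwich (InnerProductSpace.rankOne ℂ e η) 1 (star S))).op x) =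
        inner ℂ ξ (S.op η) * inner ℂ e x := by
      rw [K.op_star, ContinuousLinearMap.star_eq_adjoint,
        ContinuousLinearMap.adjoint_inner_right, K.sandwich_op, one_adjoint_apply,
        InnerProductSpace.rankOne_apply, inner_smul_left, inner_conj_symm, K.op_star,
        ContinuousLinearMap.star_eq_adjoint, ContinuousLinearMap.adjoint_inner_left]
    rw [K.sandwich_op, one_adjoint_apply, InnerProductSpace.rankOne_apply, h]
    simp [smul_smul]

theorem norm_sliceAlg_le (ξ η : H) (t : AlgTensor (K H) A) :
    ‖sliceAlg A ξ η t‖ ≤ ‖ξ‖ * ‖η‖ * ‖t‖ := by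
  by_cases hξ : ξ = 0
  · have : sliceAlg A ξ η t = 0 := by
      induction t using AlgTensor.induction_on with
      | h0 => simp
      | hadd x y hx hy => rw [map_add, hx, hy, add_zero]
      | h S a => rw [sliceAlg_tmul, hξ]; simp
    rw [this, norm_zero]; positivity
  -- Compressing by `|e⟩⟨ξ|` on the left and by `|η⟩⟨e|` on the right yields `|e⟩⟨e| ⊗ slice`.
  obtain ⟨e, he⟩ : ∃ e : H, ‖e‖ = 1 :=
    ⟨((‖ξ‖⁻¹ : ℝ) : ℂ) • ξ, by
      rw [norm_smul, Complex.norm_real, norm_inv, norm_norm,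
        inv_mul_cancel₀ (norm_ne_zero_iff.2 hξ)]⟩
  rw [← norm_rankOne_tmul he, rankOne_tmul_sliceAlg]
  refine (norm_lmul_le _ _).trans ?_
  rw [InnerProductSpace.norm_rankOne, he, one_mul, mul_assoc, norm_star]
  refine mul_le_mul_of_nonneg_left ((norm_lmul_le _ _).trans ?_) (norm_nonneg _)
  rw [InnerProductSpace.norm_rankOne, he, one_mul, norm_star, CTensor.norm_incl]

/-- The slice map `K(H) ⊗ A → A`, `S ⊗ a ↦ ⟨ξ, S η⟩ a`. -/
def slice (A : Type*) [NonUnitalCStarAlgebra A] (ξ η : H) : CTensor (K H) A →L[ℂ] A :=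
  CTensor.extend (LinearMap.mkContinuous (E := AlgTensor (K H) A) (σ := RingHom.id ℂ)
    (sliceAlg A ξ η) (‖ξ‖ * ‖η‖) (norm_sliceAlg_le ξ η))

@[simp]
theorem slice_tmul (ξ η : H) (S : K H) (a : A) :
    slice A ξ η (CTensor.tmul S a) = (inner ℂ ξ (S.op η) : ℂ) • a :=
  (CTensor.extend_incl _ _).trans (sliceAlg_tmul ξ η S a)

theorem rankOne_mul_mul_rankOne (ξ η ξ' η' : H) (a b : A) (z : CTensor (K H) A) :
    CTensor.tmul (K.rankOne ξ η) a * z * CTensor.tmul (K.rankOne ξ' η') b =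
      CTensor.tmul (K.rankOne ξ η') (a * slice A η ξ' z * b) := by
  induction z using CTensor.induction_tmul with
  | hc => exact isClosed_eq (by fun_prop) ((CTensor.continuous_tmul_right _).comp (by fun_prop))
  | h0 => simp [CTensor.tmul_zero]
  | hadd x y hx hy => simp only [mul_add, add_mul, hx, hy, map_add, CTensor.tmul_add]
  | h S c =>
    rw [CTensor.tmul_mul_tmul, CTensor.tmul_mul_tmul, slice_tmul, mul_smul_comm, smul_mul_assoc,
      CTensor.tmul_smul, ← CTensor.smul_tmul']
    congr 1
    exact K.ext fun x => by simp [smul_smul, mul_comm]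

/-- Slice maps separate the elements of `K(H) ⊗ A`. -/
theorem eq_zero_of_slice_eq_zero {z : CTensor (K H) A} (h : ∀ ξ η, slice A ξ η z = 0) : z = 0 := by
  have key : ∀ w w' : CTensor (K H) A, w * z * w' = 0 := by
    intro w w'
    induction w using CTensor.induction_tmul with
    | hc => exact isClosed_eq (by fun_prop) continuous_const
    | h0 => simp
    | hadd x y hx hy => rw [add_mul, add_mul, hx, hy, add_zero]
    | h S a =>
      induction w' using CTensor.induction_tmul with
      | hc => exact isClosed_eq (by fun_prop) continuous_const
      | h0 => simp
      | hadd x y hx hy => rw [mul_add, hx, hy, add_zero]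
      | h S' b =>
        induction S using K.induction with
        | hc =>
          exact isClosed_eq (((CTensor.continuous_tmul_left a).mul continuous_const).mul
            continuous_const) continuous_const
        | h0 => simp [CTensor.zero_tmul]
        | hadd x y hx hy => rw [CTensor.add_tmul, add_mul, add_mul, hx, hy, add_zero]
        | h ξ η =>
          induction S' using K.induction with
          | hc =>
            exact isClosed_eq (continuous_const.mul (CTensor.continuous_tmul_left b))
              continuous_const
          | h0 => simp [CTensor.zero_tmul]
          | hadd x y hx hy => rw [CTensor.add_tmul, mul_add, hx, hy, add_zero]
          | h ξ' η' =>
            rw [rankOne_mul_mul_rankOne, h, mul_zero, zero_mul, CTensor.tmul_zero]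
  have h2 : star (z * star z) * (z * star z) = 0 → z = 0 := fun h => by
    rwa [CStarRing.star_mul_self_eq_zero_iff, CStarRing.mul_star_self_eq_zero_iff] at h
  refine h2 ?_
  rw [star_mul, star_star]
  simpa only [mul_assoc] using key (z * star z) (star z)

end Slices

/-! ### Multiplication of `K(H) ⊗ A` by operators -/

section Sandwich

variable {H H₁ H₂ H₃ H₄ : Type*}
  [NormedAddCommGroup H] [InnerProductSpace ℂ H] [CompleteSpace H]
  [NormedAddCommGroup H₁] [InnerProductSpace ℂ H₁] [CompleteSpace H₁]
  [NormedAddCommGroup H₂] [InnerProductSpace ℂ H₂] [CompleteSpace H₂]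
  [NormedAddCommGroup H₃] [InnerProductSpace ℂ H₃] [CompleteSpace H₃]
  [NormedAddCommGroup H₄] [InnerProductSpace ℂ H₄] [CompleteSpace H₄]
variable {A B : Type*} [NonUnitalCStarAlgebra A] [NonUnitalCStarAlgebra B]

theorem isom_adjoint_apply (V : H₁ →ₗᵢ[ℂ] H₂) (x : H₁) :
    V.toContinuousLinearMap.adjoint (V x) = x := by
  refine ext_inner_right ℂ fun z => ?_
  rw [ContinuousLinearMap.adjoint_inner_left]
  exact V.inner_map_map x z

theorem isom_adjoint_comp (V : H₁ →ₗᵢ[ℂ] H₂) :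
    V.toContinuousLinearMap.adjoint ∘L V.toContinuousLinearMap = ContinuousLinearMap.id ℂ H₁ :=
  ContinuousLinearMap.ext fun x => isom_adjoint_apply V x

theorem adA_tmul (V : H₁ →ₗᵢ[ℂ] H₂) (T : K H₁) (a : A) :
    adA A V (CTensor.tmul T a) = CTensor.tmul (adIsom V T) a :=
  CTensor.map_tmul _ _ _ _

theorem continuous_adA (V : H₁ →ₗᵢ[ℂ] H₂) : Continuous (adA A V) := CTensor.continuous_map _ _

theorem slice_adA (V : H₁ →ₗᵢ[ℂ] H₂) (ξ η : H₁) (z : CTensor (K H₁) A) :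
    slice A (V ξ) (V η) (adA A V z) = slice A ξ η z := by
  have hc := continuous_adA (A := A) V
  induction z using CTensor.induction_tmul with
  | hc => exact isClosed_eq (by fun_prop) (by fun_prop)
  | h0 => simp
  | hadd x y hx hy => simp only [map_add, hx, hy]
  | h S a =>
    rw [adA_tmul, slice_tmul, slice_tmul, adIsom_op, isom_adjoint_apply, V.inner_map_map]

theorem adA_injective (V : H₁ →ₗᵢ[ℂ] H₂) : Function.Injective (adA A V) := by
  rw [injective_iff_map_eq_zero]
  intro z hz
  refine eq_zero_of_slice_eq_zero fun ξ η => ?_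
  rw [← slice_adA V, hz, map_zero]

theorem norm_adA (V : H₁ →ₗᵢ[ℂ] H₂) (z : CTensor (K H₁) A) : ‖adA A V z‖ = ‖z‖ :=
  NonUnitalStarAlgHom.norm_map _ (adA_injective V) z

/-- The map `T ⊗ a ↦ X T Y* ⊗ a` on algebraic tensor products. -/
def sandwichAlg (A : Type*) [NonUnitalCStarAlgebra A] (X Y : H₁ →L[ℂ] H₂) :
    AlgTensor (K H₁) A →ₗ[ℂ] AlgTensor (K H₂) A :=
  TensorProduct.map (K.sandwich X Y) LinearMap.id

/-- An operator `X : H₁ → H₂`, as a corner of an operator on `H₁ ⊕ H₂`. -/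
def cornerOp (X : H₁ →L[ℂ] H₂) : WithLp 2 (H₁ × H₂) →L[ℂ] WithLp 2 (H₁ × H₂) :=
  (inrIsom H₁ H₂).toContinuousLinearMap ∘L X ∘L (inlIsom H₁ H₂).toContinuousLinearMap.adjoint

/-- In `K(H₁ ⊕ H₂) ⊗ A`, multiplication by operators `H₁ → H₂` on both sides is given by left
multiplications and the involution. -/
theorem adA_inr_incl_sandwichAlg (X Y : H₁ →L[ℂ] H₂) (t : AlgTensor (K H₁) A) :
    adA A (inrIsom H₁ H₂) (CTensor.incl (K H₂) A (sandwichAlg A X Y t)) =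
      lmul A (cornerOp X) (star (lmul A (cornerOp Y)
        (star (adA A (inlIsom H₁ H₂) (CTensor.incl (K H₁) A t))))) := by
  induction t using AlgTensor.induction_on with
  | h0 => simp
  | hadd x y hx hy => simp only [map_add, star_add, hx, hy]
  | h S a =>
    change adA A _ (CTensor.tmul (K.sandwich X Y S) a) =
      lmul A _ (star (lmul A _ (star (adA A _ (CTensor.tmul S a)))))
    rw [adA_tmul, adA_tmul, CTensor.star_tmul, lmul_tmul, CTensor.star_tmul, lmul_tmul, star_star]
    congr 1
    refine K.ext fun x => ?_
    rw [K.sandwich_op, one_adjoint_apply, adIsom_op, K.sandwich_op]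
    have h : (star (K.sandwich (cornerOp Y) 1 (star (adIsom (inlIsom H₁ H₂) S)))).op x =
        inlIsom H₁ H₂ (S.op (Y.adjoint ((inrIsom H₁ H₂).toContinuousLinearMap.adjoint x))) := by
      refine ext_inner_left ℂ fun y => ?_
      rw [K.op_star, ContinuousLinearMap.star_eq_adjoint,
        ContinuousLinearMap.adjoint_inner_right, K.sandwich_op, one_adjoint_apply, cornerOp,
        ← map_star, ContinuousLinearMap.comp_apply, ContinuousLinearMap.comp_apply, adIsom_op,
        isom_adjoint_apply, ← ContinuousLinearMap.adjoint_inner_right,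
        ← ContinuousLinearMap.adjoint_inner_right, K.op_star, ContinuousLinearMap.star_eq_adjoint,
        ContinuousLinearMap.adjoint_inner_left, ContinuousLinearMap.adjoint_inner_left]
      rfl
    rw [h, cornerOp, ContinuousLinearMap.comp_apply, ContinuousLinearMap.comp_apply,
      isom_adjoint_apply]
    rfl

theorem norm_incl_sandwichAlg_le (X Y : H₁ →L[ℂ] H₂) (t : AlgTensor (K H₁) A) :
    ‖CTensor.incl (K H₂) A (sandwichAlg A X Y t)‖ ≤ ‖cornerOp X‖ * ‖cornerOp Y‖ * ‖t‖ := by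
  rw [← norm_adA (inrIsom H₁ H₂), adA_inr_incl_sandwichAlg, mul_assoc]
  refine (norm_lmul_le _ _).trans (mul_le_mul_of_nonneg_left ?_ (norm_nonneg _))
  rw [norm_star]
  refine (norm_lmul_le _ _).trans (mul_le_mul_of_nonneg_left ?_ (norm_nonneg _))
  rw [norm_star, norm_adA, CTensor.norm_incl]

/-- The map `z ↦ (X ⊗ 1) z (Y ⊗ 1)*` from `K(H₁) ⊗ A` to `K(H₂) ⊗ A`, for bounded operators
`X, Y : H₁ → H₂`. -/
def sandwich (A : Type*) [NonUnitalCStarAlgebra A] (X Y : H₁ →L[ℂ] H₂) :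
    CTensor (K H₁) A →L[ℂ] CTensor (K H₂) A :=
  CTensor.extend (LinearMap.mkContinuous (E := AlgTensor (K H₁) A) (σ := RingHom.id ℂ)
    ((CTensor.incl (K H₂) A).toLinearMap ∘ₗ sandwichAlg A X Y) _ (norm_incl_sandwichAlg_le X Y))

theorem sandwich_tmul (X Y : H₁ →L[ℂ] H₂) (T : K H₁) (a : A) :
    sandwich A X Y (CTensor.tmul T a) = CTensor.tmul (K.sandwich X Y T) a :=
  CTensor.extend_incl _ _

theorem sandwich_sandwich (X' Y' : H₂ →L[ℂ] H₃) (X Y : H₁ →L[ℂ] H₂) (z : CTensor (K H₁) A) :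
    sandwich A X' Y' (sandwich A X Y z) = sandwich A (X' ∘L X) (Y' ∘L Y) z :=
  congrArg (fun f => f z) (show sandwich A X' Y' ∘L sandwich A X Y = _ from
    CTensor.clm_ext fun T a => by
      rw [ContinuousLinearMap.comp_apply, sandwich_tmul, sandwich_tmul, sandwich_tmul]
      congr 1
      exact K.ext fun x => by
        rw [K.sandwich_op, K.sandwich_op, K.sandwich_op, ContinuousLinearMap.adjoint_comp]; rfl)

theorem star_sandwich (X Y : H₁ →L[ℂ] H₂) (z : CTensor (K H₁) A) :
    star (sandwich A X Y z) = sandwich A Y X (star z) := by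
  induction z using CTensor.induction_tmul with
  | hc => exact isClosed_eq (by fun_prop) (by fun_prop)
  | h0 => simp
  | hadd x y hx hy => simp only [map_add, star_add, hx, hy]
  | h S a =>
    rw [sandwich_tmul, CTensor.star_tmul, CTensor.star_tmul, sandwich_tmul]
    congr 1
    refine K.ext fun x => ext_inner_left ℂ fun y => ?_
    simp only [K.op_star, K.sandwich_op, ContinuousLinearMap.star_eq_adjoint,
      ContinuousLinearMap.adjoint_inner_right]
    rw [← ContinuousLinearMap.adjoint_inner_left, ← ContinuousLinearMap.adjoint_inner_right,
      ← ContinuousLinearMap.adjoint_inner_right]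

theorem adA_eq_sandwich (V : H₁ →ₗᵢ[ℂ] H₂) (z : CTensor (K H₁) A) :
    adA A V z = sandwich A V.toContinuousLinearMap V.toContinuousLinearMap z := by
  have hc := continuous_adA (A := A) V
  induction z using CTensor.induction_tmul with
  | hc => exact isClosed_eq (by fun_prop) (by fun_prop)
  | h0 => simp
  | hadd x y hx hy => simp only [map_add, hx, hy]
  | h S a => rw [adA_tmul, sandwich_tmul]; rfl

theorem sandwich_mul_sandwich_mul_sandwich (X Y X' Y' : H₁ →L[ℂ] H₃) (W W' : H₂ →L[ℂ] H₃)
    (z z' : CTensor (K H₁) A) (w : CTensor (K H₂) A) :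
    sandwich A X Y z * sandwich A W W' w * sandwich A Y' X' z' =
      sandwich A X X' (z * sandwich A (Y.adjoint ∘L W) (Y'.adjoint ∘L W') w * z') := by
  induction z using CTensor.induction_tmul with
  | hc => exact isClosed_eq (by fun_prop) (by fun_prop)
  | h0 => simp
  | hadd x y hx hy => simp only [map_add, add_mul, hx, hy]
  | h S a =>
    induction w using CTensor.induction_tmul with
    | hc => exact isClosed_eq (by fun_prop) (by fun_prop)
    | h0 => simp
    | hadd x y hx hy => simp only [map_add, mul_add, add_mul, hx, hy]
    | h T b =>
      induction z' using CTensor.induction_tmul with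
      | hc => exact isClosed_eq (by fun_prop) (by fun_prop)
      | h0 => simp
      | hadd x y hx hy => simp only [map_add, mul_add, hx, hy]
      | h S' a' =>
        simp only [sandwich_tmul, CTensor.tmul_mul_tmul]
        congr 1
        refine K.ext fun x => ?_
        simp only [K.op_mul, mul_apply_eq_comp, K.sandwich_op, ContinuousLinearMap.adjoint_comp,
          ContinuousLinearMap.adjoint_adjoint, ContinuousLinearMap.comp_apply]

/-- Compressing `d` on both sides compresses `d b d*` on the outside. -/
theorem sandwich_mul_adA_mul_star (X Y : H₁ →L[ℂ] H₃) (W : H₂ →ₗᵢ[ℂ] H₃) (W' : H₂ →ₗᵢ[ℂ] H₁)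
    (h : Y.adjoint ∘L W.toContinuousLinearMap = W'.toContinuousLinearMap)
    (z : CTensor (K H₁) A) (w : CTensor (K H₂) A) :
    sandwich A X Y z * adA A W w * star (sandwich A X Y z) =
      sandwich A X X (z * adA A W' w * star z) := by
  rw [star_sandwich, adA_eq_sandwich, adA_eq_sandwich, sandwich_mul_sandwich_mul_sandwich, h]

theorem map_sandwich (ψ : A →⋆ₙₐ[ℂ] B) (X Y : H₁ →L[ℂ] H₂) (z : CTensor (K H₁) A) :
    CTensor.map (NonUnitalStarAlgHom.id ℂ _) ψ (sandwich A X Y z) =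
      sandwich B X Y (CTensor.map (NonUnitalStarAlgHom.id ℂ _) ψ z) := by
  have h1 := CTensor.continuous_map (NonUnitalStarAlgHom.id ℂ (K H₁)) ψ
  have h2 := CTensor.continuous_map (NonUnitalStarAlgHom.id ℂ (K H₂)) ψ
  induction z using CTensor.induction_tmul with
  | hc => exact isClosed_eq (by fun_prop) (by fun_prop)
  | h0 => simp
  | hadd x y hx hy => simp only [map_add, hx, hy]
  | h S a => simp only [sandwich_tmul, CTensor.map_tmul]; rfl

theorem K.continuous_rankOne : Continuous fun p : H × H => K.rankOne p.1 p.2 := by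
  have h : Isometry (K.op (H := H)) := fun S T => by
    rw [edist_dist, edist_dist, dist_eq_norm, dist_eq_norm]; rfl
  rw [h.isEmbedding.continuous_iff]
  exact (ContinuousLinearMap.smulRightL ℂ H H).continuous₂.comp
    (((innerSL ℂ).continuous.comp continuous_snd).prodMk continuous_fst)

end Sandwich

/-! ### The isomorphism of `K(H) ⊗ (A ⊗ K(L))` and `K(H ⊗ L) ⊗ A` -/

namespace HTensor

variable {H H' L T T' : Type*}
  [NormedAddCommGroup H] [InnerProductSpace ℂ H] [CompleteSpace H]
  [NormedAddCommGroup H'] [InnerProductSpace ℂ H'] [CompleteSpace H']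
  [NormedAddCommGroup L] [InnerProductSpace ℂ L] [CompleteSpace L]
  [NormedAddCommGroup T] [InnerProductSpace ℂ T] [CompleteSpace T]
  [NormedAddCommGroup T'] [InnerProductSpace ℂ T'] [CompleteSpace T']
variable {A B : Type*} [NonUnitalCStarAlgebra A] [NonUnitalCStarAlgebra B]
variable (P : HTensor H L T)

/-- For a projection `p`, the `*`-homomorphism `k ↦ p ⊗ k`. -/
def tensProj {p : K H} (hp : IsStarProjection p) : K L →⋆ₙₐ[ℂ] K T where
  toFun k := P.tensK p k
  map_smul' c k := P.tensK_smul_right c p k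
  map_zero' := by simpa using P.tensK_smul_right 0 p 0
  map_add' k k' := P.tensK_add_right p k k'
  map_mul' k k' := by rw [P.tensK_mul, hp.isIdempotentElem.eq]
  map_star' k := by rw [P.star_tensK, hp.isSelfAdjoint.star_eq]

theorem continuous_tensK : Continuous fun p : K H × K L => P.tensK p.1 p.2 :=
  (LinearMap.mkContinuous₂ (LinearMap.mk₂ ℂ P.tensK P.tensK_add_left P.tensK_smul_left
    P.tensK_add_right P.tensK_smul_right) 1 fun s k => by
      rw [one_mul]; exact P.norm_tensK_le s k).continuous₂

/-- The linear map `k ↦ s ⊗ k`. -/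
def tensKₗ (s : K H) : K L →ₗ[ℂ] K T where
  toFun k := P.tensK s k
  map_add' k k' := P.tensK_add_right s k k'
  map_smul' c k := P.tensK_smul_right c s k

/-- The map `k ⊗ a ↦ (s ⊗ k) ⊗ a` on algebraic tensor products. -/
def leftTensAlg (A : Type*) [NonUnitalCStarAlgebra A] (s : K H) :
    AlgTensor (K L) A →ₗ[ℂ] AlgTensor (K T) A :=
  TensorProduct.map (P.tensKₗ s) LinearMap.id

theorem incl_leftTensAlg_mul_proj (s : K H) {p : K H} (hp : IsStarProjection p)
    (t : AlgTensor (K L) A) :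
    CTensor.incl (K T) A (P.leftTensAlg A (s * p) t) =
      lmul A (P.op P s.op (ContinuousLinearMap.id ℂ L))
        (CTensor.map (P.tensProj hp) (NonUnitalStarAlgHom.id ℂ A) (CTensor.incl (K L) A t)) := by
  induction t using AlgTensor.induction_on with
  | h0 => simp
  | hadd x y hx hy => simp only [map_add, hx, hy]
  | h k a =>
    change CTensor.tmul (P.tensK (s * p) k) a =
      lmul A _ (CTensor.map _ _ (CTensor.tmul k a))
    rw [CTensor.map_tmul, lmul_tmul]
    congr 1
    refine K.ext fun x => ?_
    rw [K.sandwich_op, one_adjoint_apply]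
    exact (P.op_apply_op P P s.op (ContinuousLinearMap.id ℂ L) p.op k.op x).symm

theorem continuous_incl_leftTensAlg (t : AlgTensor (K L) A) :
    Continuous fun s : K H => CTensor.incl (K T) A (P.leftTensAlg A s t) := by
  induction t using AlgTensor.induction_on with
  | h0 => simpa only [map_zero] using continuous_const
  | hadd x y hx hy => simp only [map_add]; exact hx.add hy
  | h k a =>
    have h1 := (CTensor.continuous_tmul_left (A := K T) a).comp
      (P.continuous_tensK.comp (Continuous.prodMk_left k))
    exact h1

/-- The map `k ⊗ a ↦ (s ⊗ k) ⊗ a` is bounded by `‖s‖`. For `s = s p` with a projection `p`, it is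
the product of left multiplication by `s` and the `*`-homomorphism `k ⊗ a ↦ (p ⊗ k) ⊗ a`; the
general case follows by approximation with finite rank projections. -/
theorem norm_incl_leftTensAlg_le (s : K H) (t : AlgTensor (K L) A) :
    ‖CTensor.incl (K T) A (P.leftTensAlg A s t)‖ ≤ ‖s‖ * ‖t‖ := by
  have hcont := P.continuous_incl_leftTensAlg t
  have hcl : IsClosed {s : K H | ‖CTensor.incl (K T) A (P.leftTensAlg A s t)‖ ≤ ‖s‖ * ‖t‖} :=
    isClosed_le hcont.norm (by fun_prop)
  have hs : s ∈ closure {s : K H |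
      ‖CTensor.incl (K T) A (P.leftTensAlg A s t)‖ ≤ ‖s‖ * ‖t‖} := by
    refine Metric.mem_closure_iff.2 fun ε hε => ?_
    obtain ⟨E, hE, hlt⟩ := s.exists_norm_sub_mul_lt hε
    refine ⟨s * K.proj E, ?_, by rwa [dist_eq_norm]⟩
    have hp := K.isStarProjection_proj E
    have e : s * K.proj E = (s * K.proj E) * K.proj E := by
      rw [mul_assoc, hp.isIdempotentElem.eq]
    change ‖CTensor.incl (K T) A (P.leftTensAlg A (s * K.proj E) t)‖ ≤ ‖s * K.proj E‖ * ‖t‖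
    rw [e, P.incl_leftTensAlg_mul_proj _ hp, ← e]
    refine (norm_lmul_le _ _).trans (mul_le_mul ?_ ?_ (norm_nonneg _) (norm_nonneg _))
    · refine (P.norm_op_le P _ _).trans ?_
      exact mul_le_of_le_one_right (norm_nonneg _) ContinuousLinearMap.norm_id_le
    · refine (NonUnitalStarAlgHom.norm_apply_le _ _).trans ?_
      rw [CTensor.norm_incl]
  rwa [hcl.closure_eq] at hs

/-- The map `k ⊗ a ↦ (s ⊗ k) ⊗ a` from `K(L) ⊗ A` to `K(H ⊗ L) ⊗ A`. -/
def leftTens (A : Type*) [NonUnitalCStarAlgebra A] (s : K H) :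
    CTensor (K L) A →L[ℂ] CTensor (K T) A :=
  CTensor.extend (LinearMap.mkContinuous (E := AlgTensor (K L) A) (σ := RingHom.id ℂ)
    ((CTensor.incl (K T) A).toLinearMap ∘ₗ P.leftTensAlg A s) ‖s‖ (P.norm_incl_leftTensAlg_le s))

@[simp]
theorem leftTens_tmul (s : K H) (k : K L) (a : A) :
    P.leftTens A s (CTensor.tmul k a) = CTensor.tmul (P.tensK s k) a :=
  CTensor.extend_incl _ _

theorem norm_leftTens_le (s : K H) (x : CTensor (K L) A) : ‖P.leftTens A s x‖ ≤ ‖s‖ * ‖x‖ :=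
  CTensor.norm_extend_le _ (P.norm_incl_leftTensAlg_le s) x

theorem leftTens_mul (s s' : K H) (x x' : CTensor (K L) A) :
    P.leftTens A s x * P.leftTens A s' x' = P.leftTens A (s * s') (x * x') := by
  induction x using CTensor.induction_tmul with
  | hc => exact isClosed_eq (by fun_prop) (by fun_prop)
  | h0 => simp
  | hadd x y hx hy => simp only [map_add, add_mul, hx, hy]
  | h k a =>
    induction x' using CTensor.induction_tmul with
    | hc => exact isClosed_eq (by fun_prop) (by fun_prop)
    | h0 => simp
    | hadd x y hx hy => simp only [map_add, mul_add, hx, hy]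
    | h k' a' => simp only [leftTens_tmul, CTensor.tmul_mul_tmul, P.tensK_mul]

theorem star_leftTens (s : K H) (x : CTensor (K L) A) :
    star (P.leftTens A s x) = P.leftTens A (star s) (star x) := by
  induction x using CTensor.induction_tmul with
  | hc => exact isClosed_eq (by fun_prop) (by fun_prop)
  | h0 => simp
  | hadd x y hx hy => simp only [map_add, star_add, hx, hy]
  | h k a => simp only [leftTens_tmul, CTensor.star_tmul, P.star_tensK]

/-- The bilinear map `(s, x) ↦ s ⊗ x` from `K(H) × (K(L) ⊗ A)` to `K(H ⊗ L) ⊗ A`. -/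
def leftTensₗ (A : Type*) [NonUnitalCStarAlgebra A] :
    K H →ₗ[ℂ] CTensor (K L) A →ₗ[ℂ] CTensor (K T) A where
  toFun s := (P.leftTens A s).toLinearMap
  map_add' s s' := by
    refine congrArg ContinuousLinearMap.toLinearMap (a₂ := P.leftTens A s + P.leftTens A s') ?_
    exact CTensor.clm_ext fun k a => by
      rw [add_apply, leftTens_tmul, leftTens_tmul, leftTens_tmul, P.tensK_add_left,
        CTensor.add_tmul]
  map_smul' c s := by
    refine congrArg ContinuousLinearMap.toLinearMap (a₂ := c • P.leftTens A s) ?_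
    exact CTensor.clm_ext fun k a => by
      rw [smul_apply, leftTens_tmul, leftTens_tmul, P.tensK_smul_left, CTensor.smul_tmul']

/-- The `*`-homomorphism `s ⊗ (k ⊗ a) ↦ (s ⊗ k) ⊗ a` from `K(H) ⊗ (K(L) ⊗ A)` to
`K(H ⊗ L) ⊗ A`. -/
def assocK (A : Type*) [NonUnitalCStarAlgebra A] :
    CTensor (K H) (CTensor (K L) A) →⋆ₙₐ[ℂ] CTensor (K T) A :=
  CTensor.lift (P.leftTensₗ A) (fun s s' x x' => P.leftTens_mul s s' x x')
    (fun s x => P.star_leftTens s x) (fun s x => P.norm_leftTens_le s x)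

@[simp]
theorem assocK_tmul (s : K H) (x : CTensor (K L) A) :
    P.assocK A (CTensor.tmul s x) = P.leftTens A s x := CTensor.lift_tmul _ _ _ _ s x

theorem slice_leftTens (ξ ξ' : H) (η η' : L) (s : K H) (x : CTensor (K L) A) :
    slice A (P.pure ξ η) (P.pure ξ' η') (P.leftTens A s x) =
      (inner ℂ ξ (s.op ξ') : ℂ) • slice A η η' x := by
  induction x using CTensor.induction_tmul with
  | hc => exact isClosed_eq (by fun_prop) (by fun_prop)
  | h0 => simp
  | hadd x y hx hy => simp only [map_add, smul_add, hx, hy]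
  | h k a =>
    rw [leftTens_tmul, slice_tmul, slice_tmul, tensK_op, op_pure, P.inner_pure, smul_smul]

theorem slice_assocK (ξ ξ' : H) (η η' : L) (z : CTensor (K H) (CTensor (K L) A)) :
    slice A (P.pure ξ η) (P.pure ξ' η') (P.assocK A z) = slice A η η' (slice _ ξ ξ' z) := by
  have hc := CTensor.continuous_hom (P.assocK A)
  induction z using CTensor.induction_tmul with
  | hc => exact isClosed_eq (by fun_prop) (by fun_prop)
  | h0 => simp
  | hadd x y hx hy => simp only [map_add, hx, hy]
  | h s x => rw [assocK_tmul, slice_leftTens, slice_tmul, map_smul]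

/-- Slices of `assocK z` are iterated slices of `z`. -/
theorem assocK_injective : Function.Injective (P.assocK A) := by
  rw [injective_iff_map_eq_zero]
  intro z hz
  refine eq_zero_of_slice_eq_zero fun ξ ξ' => eq_zero_of_slice_eq_zero fun η η' => ?_
  rw [← P.slice_assocK, hz, map_zero]

theorem norm_assocK (z : CTensor (K H) (CTensor (K L) A)) : ‖P.assocK A z‖ = ‖z‖ :=
  NonUnitalStarAlgHom.norm_map _ P.assocK_injective z

/-- The range is closed and contains the elements `|ξ ⊗ η⟩⟨ξ' ⊗ η'| ⊗ a`, which have dense linear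
span. -/
theorem assocK_surjective : Function.Surjective (P.assocK A) := by
  have hiso : Isometry (P.assocK A) := AddMonoidHomClass.isometry_of_norm _ P.norm_assocK
  have hcl : IsClosed (Set.range (P.assocK A)) := hiso.isClosedEmbedding.isClosed_range
  intro z
  change z ∈ Set.range (P.assocK A)
  induction z using CTensor.induction_tmul with
  | hc => exact hcl
  | h0 => exact ⟨0, map_zero _⟩
  | hadd x y hx hy =>
    obtain ⟨x, rfl⟩ := hx
    obtain ⟨y, rfl⟩ := hy
    exact ⟨x + y, map_add _ x y⟩
  | h S a =>
    induction S using K.induction with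
    | hc => exact hcl.preimage (CTensor.continuous_tmul_left a)
    | h0 => exact ⟨0, by rw [map_zero, CTensor.zero_tmul]⟩
    | hadd S S' h h' =>
      obtain ⟨x, hx⟩ := h
      obtain ⟨y, hy⟩ := h'
      exact ⟨x + y, by rw [map_add, hx, hy, CTensor.add_tmul]⟩
    | h ζ ω =>
      induction ζ using P.induction with
      | hc =>
        exact hcl.preimage ((CTensor.continuous_tmul_left a).comp
          (K.continuous_rankOne.comp (continuous_id.prodMk continuous_const)))
      | h0 =>
        have : K.rankOne (0 : T) ω = 0 := K.ext fun x => by simp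
        exact ⟨0, by rw [map_zero, this, CTensor.zero_tmul]⟩
      | hadd ζ ζ' h h' =>
        obtain ⟨x, hx⟩ := h
        obtain ⟨y, hy⟩ := h'
        have : K.rankOne (ζ + ζ') ω = K.rankOne ζ ω + K.rankOne ζ' ω := K.ext fun x => by simp
        exact ⟨x + y, by rw [map_add, hx, hy, this, CTensor.add_tmul]⟩
      | h ξ η =>
        induction ω using P.induction with
        | hc =>
          exact hcl.preimage ((CTensor.continuous_tmul_left a).comp
            (K.continuous_rankOne.comp (continuous_const.prodMk continuous_id)))
        | h0 =>
          have : K.rankOne (P.pure ξ η) (0 : T) = 0 := K.ext fun x => by simp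
          exact ⟨0, by rw [map_zero, this, CTensor.zero_tmul]⟩
        | hadd ζ ζ' h h' =>
          obtain ⟨x, hx⟩ := h
          obtain ⟨y, hy⟩ := h'
          have : K.rankOne (P.pure ξ η) (ζ + ζ') = K.rankOne (P.pure ξ η) ζ +
            K.rankOne (P.pure ξ η) ζ' := K.ext fun x => by simp [add_smul]
          exact ⟨x + y, by rw [map_add, hx, hy, this, CTensor.add_tmul]⟩
        | h ξ' η' =>
          exact ⟨CTensor.tmul (K.rankOne ξ ξ') (CTensor.tmul (K.rankOne η η') a), by
            rw [assocK_tmul, leftTens_tmul, P.tensK_rankOne]⟩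

/-- The `*`-homomorphism `s ⊗ (a ⊗ k) ↦ (s ⊗ k) ⊗ a` from `K(H) ⊗ (A ⊗ K(L))` to
`K(H ⊗ L) ⊗ A`. -/
def shuffle (A : Type*) [NonUnitalCStarAlgebra A] :
    CTensor (K H) (CTensor A (K L)) →⋆ₙₐ[ℂ] CTensor (K T) A :=
  (P.assocK A).comp (CTensor.map (NonUnitalStarAlgHom.id ℂ _) (CTensor.flip A (K L)))

@[simp]
theorem shuffle_tmul (s : K H) (a : A) (k : K L) :
    P.shuffle A (CTensor.tmul s (CTensor.tmul a k)) = CTensor.tmul (P.tensK s k) a := by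
  simp [shuffle]

theorem continuous_shuffle : Continuous (P.shuffle A) := CTensor.continuous_hom _

theorem map_flip_map_flip (D A B : Type*) [NonUnitalCStarAlgebra D] [NonUnitalCStarAlgebra A]
    [NonUnitalCStarAlgebra B] (x : CTensor D (CTensor A B)) :
    CTensor.map (NonUnitalStarAlgHom.id ℂ D) (CTensor.flip B A)
      (CTensor.map (NonUnitalStarAlgHom.id ℂ D) (CTensor.flip A B) x) = x := by
  have h : (CTensor.flip B A).comp (CTensor.flip A B) = NonUnitalStarAlgHom.id ℂ (CTensor A B) :=
    CTensor.hom_ext fun a b => by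
      rw [NonUnitalStarAlgHom.comp_apply, CTensor.flip_flip]; rfl
  rw [CTensor.map_map, h]
  exact congrArg (fun f => f x) CTensor.map_id

theorem shuffle_bijective : Function.Bijective (P.shuffle A) := by
  refine ⟨fun x y h => ?_, fun z => ?_⟩
  · rw [← map_flip_map_flip (K H) A (K L) x, ← map_flip_map_flip (K H) A (K L) y]
    exact congrArg _ (P.assocK_injective h)
  · obtain ⟨w, rfl⟩ := P.assocK_surjective z
    refine ⟨CTensor.map (NonUnitalStarAlgHom.id ℂ (K H)) (CTensor.flip (K L) A) w, ?_⟩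
    exact congrArg (P.assocK A) (map_flip_map_flip (K H) (K L) A w)

/-- The isomorphism `K(H) ⊗ (A ⊗ K(L)) ≅ K(H ⊗ L) ⊗ A`. -/
def shuffleEquiv (A : Type*) [NonUnitalCStarAlgebra A] :
    CTensor (K H) (CTensor A (K L)) ≃⋆ₐ[ℂ] CTensor (K T) A :=
  StarAlgEquiv.ofBijective (P.shuffle A) P.shuffle_bijective

@[simp]
theorem shuffle_symm_apply (z : CTensor (K T) A) :
    P.shuffle A ((P.shuffleEquiv A).symm z) = z := (P.shuffleEquiv A).apply_symm_apply z

@[simp]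
theorem symm_shuffle_apply (z : CTensor (K H) (CTensor A (K L))) :
    (P.shuffleEquiv A).symm (P.shuffle A z) = z := (P.shuffleEquiv A).symm_apply_apply z

theorem continuous_shuffle_symm : Continuous (P.shuffleEquiv A).symm :=
  AddMonoidHomClass.continuous_of_bound (P.shuffleEquiv A).symm 1 fun x => by
    rw [one_mul]
    obtain ⟨y, rfl⟩ := P.shuffle_bijective.2 x
    rw [symm_shuffle_apply, NonUnitalStarAlgHom.norm_map _ P.shuffle_bijective.1]

/-- Two bounded linear maps on `K(H) ⊗ (A ⊗ K(L))` agree if they agree on elementary tensors. -/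
theorem clm_ext₃ {E : Type*} [NormedAddCommGroup E] [NormedSpace ℂ E]
    {f g : CTensor (K H) (CTensor A (K L)) →L[ℂ] E}
    (h : ∀ s a k, f (CTensor.tmul s (CTensor.tmul a k)) = g (CTensor.tmul s (CTensor.tmul a k))) :
    f = g := by
  refine CTensor.clm_ext fun s x => ?_
  induction x using CTensor.induction_tmul with
  | hc =>
    exact isClosed_eq (f.continuous.comp (CTensor.continuous_tmul_right s))
      (g.continuous.comp (CTensor.continuous_tmul_right s))
  | h0 => simp [CTensor.tmul_zero]
  | hadd x y hx hy => simp only [CTensor.tmul_add, map_add, hx, hy]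
  | h a k => exact h s a k

/-- `shuffle` as a bounded linear map. -/
def shuffleL (A : Type*) [NonUnitalCStarAlgebra A] :
    CTensor (K H) (CTensor A (K L)) →L[ℂ] CTensor (K T) A :=
  ⟨LinearMapClass.linearMap (P.shuffle A), P.continuous_shuffle⟩

theorem shuffleL_apply (z : CTensor (K H) (CTensor A (K L))) : P.shuffleL A z = P.shuffle A z := rfl

theorem shuffle_sandwich (P' : HTensor H' L T') (X Y : H →L[ℂ] H')
    (z : CTensor (K H) (CTensor A (K L))) :
    P'.shuffle A (sandwich _ X Y z) =
      sandwich A (P.op P' X (ContinuousLinearMap.id ℂ L))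
        (P.op P' Y (ContinuousLinearMap.id ℂ L)) (P.shuffle A z) :=
  congrArg (fun f => f z) (show P'.shuffleL A ∘L sandwich _ X Y =
    sandwich A (P.op P' X (ContinuousLinearMap.id ℂ L))
      (P.op P' Y (ContinuousLinearMap.id ℂ L)) ∘L P.shuffleL A from clm_ext₃ fun s a k => by
    rw [ContinuousLinearMap.comp_apply, ContinuousLinearMap.comp_apply, shuffleL_apply,
      shuffleL_apply, sandwich_tmul, shuffle_tmul, shuffle_tmul, sandwich_tmul]
    congr 1
    refine K.ext fun x => ?_
    rw [K.sandwich_op, tensK_op, tensK_op, op_adjoint, op_apply_op, op_apply_op,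
      show (ContinuousLinearMap.id ℂ L).adjoint = ContinuousLinearMap.id ℂ L from
        star_one (L →L[ℂ] L)]
    rfl)

theorem shuffle_adA (P' : HTensor H' L T') (V : H →ₗᵢ[ℂ] H')
    (z : CTensor (K H) (CTensor A (K L))) :
    P'.shuffle A (adA _ V z) = adA A (P.isom P' V LinearIsometry.id) (P.shuffle A z) := by
  rw [adA_eq_sandwich, adA_eq_sandwich, P.shuffle_sandwich P']
  rfl

theorem map_shuffle (ψ : A →⋆ₙₐ[ℂ] B) (z : CTensor (K H) (CTensor A (K L))) :
    CTensor.map (NonUnitalStarAlgHom.id ℂ _) ψ (P.shuffle A z) =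
      P.shuffle B (CTensor.map (NonUnitalStarAlgHom.id ℂ _)
        (CTensor.map ψ (NonUnitalStarAlgHom.id ℂ _)) z) := by
  have h1 := CTensor.continuous_map (NonUnitalStarAlgHom.id ℂ (K T)) ψ
  have h2 := CTensor.continuous_map (NonUnitalStarAlgHom.id ℂ (K H))
    (CTensor.map ψ (NonUnitalStarAlgHom.id ℂ (K L)))
  have h3 := P.continuous_shuffle (A := A)
  have h4 := P.continuous_shuffle (A := B)
  induction z using CTensor.induction_tmul with
  | hc => exact isClosed_eq (by fun_prop) (by fun_prop)
  | h0 => simp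
  | hadd x y hx hy => simp only [map_add, hx, hy]
  | h s x =>
    have h5 := CTensor.continuous_map ψ (NonUnitalStarAlgHom.id ℂ (K L))
    have h6 := CTensor.continuous_tmul_right (A := K H) (B := CTensor A (K L)) s
    induction x using CTensor.induction_tmul with
    | hc => exact isClosed_eq (by fun_prop) (by fun_prop)
    | h0 => simp [CTensor.tmul_zero]
    | hadd x y hx hy => simp only [CTensor.tmul_add, map_add, hx, hy]
    | h a k => simp

end HTensor

/-! ### Intertwining operators -/

section Intertwiners

variable {H₁ H₂ H₃ H₄ : Type*}
  [NormedAddCommGroup H₁] [InnerProductSpace ℂ H₁] [CompleteSpace H₁]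
  [NormedAddCommGroup H₂] [InnerProductSpace ℂ H₂] [CompleteSpace H₂]
  [NormedAddCommGroup H₃] [InnerProductSpace ℂ H₃] [CompleteSpace H₃]
  [NormedAddCommGroup H₄] [InnerProductSpace ℂ H₄] [CompleteSpace H₄]
variable {A B : Type*} [NonUnitalCStarAlgebra A] [NonUnitalCStarAlgebra B]

theorem adA_adA (V : H₂ →ₗᵢ[ℂ] H₃) (W : H₁ →ₗᵢ[ℂ] H₂) (x : CTensor (K H₁) A) :
    adA A V (adA A W x) = adA A (V.comp W) x := by
  refine (CTensor.map_map (adIsom V) (NonUnitalStarAlgHom.id ℂ A) (adIsom W)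
    (NonUnitalStarAlgHom.id ℂ A) x).trans ?_
  rw [adIsom_comp]
  rfl

theorem adA_id (x : CTensor (K H₁) A) : adA A LinearIsometry.id x = x := by
  unfold adA
  rw [adIsom_id]
  exact congrArg (fun f => f x) CTensor.map_id

/-- The isometry `(x, y) ↦ V x + W y` on `H₁ ⊕ H₂`, for isometries `V` and `W` with orthogonal
ranges. -/
def coprodIsom (V : H₁ →ₗᵢ[ℂ] H₃) (W : H₂ →ₗᵢ[ℂ] H₃) (h : ∀ x y, inner ℂ (V x) (W y) = 0) :
    WithLp 2 (H₁ × H₂) →ₗᵢ[ℂ] H₃ where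
  toFun x := V x.fst + W x.snd
  map_add' x y := by simp only [WithLp.add_fst, WithLp.add_snd, map_add]; abel
  map_smul' c x := by simp
  norm_map' x := by
    have h1 : ‖V x.fst + W x.snd‖ * ‖V x.fst + W x.snd‖ = ‖x‖ * ‖x‖ := by
      rw [norm_add_sq_eq_norm_sq_add_norm_sq_of_inner_eq_zero _ _ (h _ _), V.norm_map,
        W.norm_map, ← sq ‖x‖, WithLp.prod_norm_sq_eq_of_L2, sq, sq]
    exact (mul_self_inj (norm_nonneg _) (norm_nonneg _)).1 h1

theorem coprodIsom_comp_inl (V : H₁ →ₗᵢ[ℂ] H₃) (W : H₂ →ₗᵢ[ℂ] H₃)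
    (h : ∀ x y, inner ℂ (V x) (W y) = 0) : (coprodIsom V W h).comp (inlIsom H₁ H₂) = V := by
  ext x
  change V x + W 0 = V x
  simp

theorem coprodIsom_comp_inr (V : H₁ →ₗᵢ[ℂ] H₃) (W : H₂ →ₗᵢ[ℂ] H₃)
    (h : ∀ x y, inner ℂ (V x) (W y) = 0) : (coprodIsom V W h).comp (inrIsom H₁ H₂) = W := by
  ext x
  change V 0 + W x = W x
  simp

theorem adjoint_comp_eq_zero {V : H₁ →ₗᵢ[ℂ] H₃} {W : H₂ →ₗᵢ[ℂ] H₃}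
    (h : ∀ x y, inner ℂ (V x) (W y) = 0) :
    V.toContinuousLinearMap.adjoint ∘L W.toContinuousLinearMap = 0 :=
  ContinuousLinearMap.ext fun y => ext_inner_left ℂ fun x => by
    rw [ContinuousLinearMap.comp_apply, ContinuousLinearMap.adjoint_inner_right]
    exact (h x y).trans (inner_zero_right _).symm

/-- The sum of the images under `Ad(V) ⊗ id` and `Ad(W) ⊗ id` is multiplicative, for isometries
with orthogonal ranges. -/
theorem adA_add_adA_mul {V : H₁ →ₗᵢ[ℂ] H₃} {W : H₂ →ₗᵢ[ℂ] H₃}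
    (h : ∀ x y, inner ℂ (V x) (W y) = 0) (x x' : CTensor (K H₁) A) (y y' : CTensor (K H₂) A) :
    (adA A V x + adA A W y) * (adA A V x' + adA A W y') = adA A V (x * x') + adA A W (y * y') := by
  rw [add_mul, mul_add, mul_add, adA_mul_adA V W h,
    adA_mul_adA W V fun x y => inner_eq_zero_symm.1 (h y x), map_mul, map_mul, add_zero, zero_add]

end Intertwiners

section Intertwines

variable {G : Type*} [Group G] [TopologicalSpace G]
variable {A B : Type*} [NonUnitalCStarAlgebra A] [NonUnitalCStarAlgebra B]
  {α : CAction G A} {β : CAction G B}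

/-- The operator `X : H_μ → H_ν` intertwines the representations `μ` and `ν`. -/
def SepRep.Intertwines (μ ν : SepRep G) (X : μ.H →L[ℂ] ν.H) : Prop :=
  ∀ g x, X (μ.U g x) = ν.U g (X x)

namespace SepRep

variable {μ ν lam : SepRep G}

theorem inner_U_left (μ : SepRep G) (g : G) (x y : μ.H) :
    Inner.inner ℂ (μ.U g x) y = Inner.inner ℂ x (μ.U g⁻¹ y) := by
  rw [← (μ.U g⁻¹).inner_map_map (μ.U g x) y]
  congr 1
  change (μ.U g⁻¹ * μ.U g) x = x
  rw [← _root_.map_mul, inv_mul_cancel, _root_.map_one]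
  rfl

namespace Intertwines

theorem id (μ : SepRep G) : μ.Intertwines μ (ContinuousLinearMap.id ℂ μ.H) := fun _ _ => rfl

theorem comp {X : ν.H →L[ℂ] lam.H} {Y : μ.H →L[ℂ] ν.H} (hX : ν.Intertwines lam X)
    (hY : μ.Intertwines ν Y) : μ.Intertwines lam (X ∘L Y) := fun g x => by
  rw [ContinuousLinearMap.comp_apply, hY, hX, ContinuousLinearMap.comp_apply]

theorem adjoint {X : μ.H →L[ℂ] ν.H} (hX : μ.Intertwines ν X) : ν.Intertwines μ X.adjoint :=
  fun g x => ext_inner_right ℂ fun y => by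
    rw [ContinuousLinearMap.adjoint_inner_left, inner_U_left, inner_U_left,
      ContinuousLinearMap.adjoint_inner_left, hX]

theorem isom_comp {V : μ.H →ₗᵢ[ℂ] ν.H} (hV : μ.Intertwines ν V.toContinuousLinearMap) (g : G) :
    (ν.U g).toLinearIsometry.comp V = V.comp (μ.U g).toLinearIsometry :=
  LinearIsometry.ext fun x => (hV g x).symm

end Intertwines

theorem intertwines_inl (μ ν : SepRep G) :
    μ.Intertwines (μ.sum ν) (μ.inl ν).toContinuousLinearMap :=
  fun g x => (congrArg (fun f => f x) (μ.sum_U_inl ν g)).symm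

theorem intertwines_inr (μ ν : SepRep G) :
    ν.Intertwines (μ.sum ν) (μ.inr ν).toContinuousLinearMap :=
  fun g x => (congrArg (fun f => f x) (μ.sum_U_inr ν g)).symm

theorem intertwines_coprod {V : μ.H →ₗᵢ[ℂ] lam.H} {W : ν.H →ₗᵢ[ℂ] lam.H}
    (h : ∀ x y, Inner.inner ℂ (V x) (W y) = 0)
    (hV : μ.Intertwines lam V.toContinuousLinearMap)
    (hW : ν.Intertwines lam W.toContinuousLinearMap) :
    (μ.sum ν).Intertwines lam (coprodIsom V W h).toContinuousLinearMap := fun g x => by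
  change V (μ.U g x.fst) + W (ν.U g x.snd) = lam.U g (V x.fst + W x.snd)
  rw [map_add]
  exact congrArg₂ _ (hV g x.fst) (hW g x.snd)

end SepRep

theorem SepRep.ad_op (ν : SepRep G) (g : G) (T : K ν.H) (x : ν.H) :
    (ν.ad g T).op x = ν.U g (T.op (ν.U g⁻¹ x)) := by
  change ν.U g (T.op ((ν.U g).toLinearIsometry.toContinuousLinearMap.adjoint x)) = _
  congr 2
  refine ext_inner_left ℂ fun y => ?_
  rw [ContinuousLinearMap.adjoint_inner_right]
  exact ν.inner_U_left g y x

theorem stabAction_tmul (μ : SepRep G) (α : CAction G A) (g : G) (T : K μ.H) (a : A) :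
    stabAction μ α g (CTensor.tmul T a) = CTensor.tmul (μ.ad g T) (α g a) :=
  CTensor.map_tmul _ _ _ _

theorem continuous_action (α : CAction G A) (g : G) : Continuous (α g) :=
  AddMonoidHomClass.continuous_of_bound (α g) 1 fun x => by
    rw [one_mul]; exact NonUnitalStarAlgHom.norm_apply_le _ x

theorem stabAction_sandwich {μ ν : SepRep G} {X Y : μ.H →L[ℂ] ν.H} (hX : μ.Intertwines ν X)
    (hY : μ.Intertwines ν Y) (g : G) (z : CTensor (K μ.H) A) :
    stabAction ν α g (sandwich A X Y z) = sandwich A X Y (stabAction μ α g z) := by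
  have h1 := continuous_action (stabAction ν α) g
  have h2 := continuous_action (stabAction μ α) g
  induction z using CTensor.induction_tmul with
  | hc => exact isClosed_eq (by fun_prop) (by fun_prop)
  | h0 => simp only [map_zero]
  | hadd x y hx hy => simp only [map_add, hx, hy]
  | h S a =>
    rw [sandwich_tmul, stabAction_tmul, stabAction_tmul, sandwich_tmul]
    congr 1
    refine K.ext fun x => ?_
    rw [SepRep.ad_op, K.sandwich_op, K.sandwich_op, SepRep.ad_op, hY.adjoint, hX]

theorem sandwich_mem_offDiag {μ ν lam : SepRep G} (X : lam.H →L[ℂ] μ.H) (Y : lam.H →L[ℂ] ν.H)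
    (z : CTensor (K lam.H) A) :
    sandwich A ((μ.inl ν).toContinuousLinearMap ∘L X) ((μ.inr ν).toContinuousLinearMap ∘L Y) z ∈
      offDiag μ ν A := by
  induction z using CTensor.induction_tmul with
  | hc => exact (Submodule.isClosed_topologicalClosure _).preimage (ContinuousLinearMap.continuous _)
  | h0 => rw [map_zero]; exact Submodule.zero_mem _
  | hadd x y hx hy => rw [map_add]; exact Submodule.add_mem _ hx hy
  | h S a =>
    rw [sandwich_tmul]
    refine Submodule.le_topologicalClosure _ (Submodule.subset_span ⟨_, a, fun x => ?_, fun y => ?_,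
      rfl⟩)
    · have h0 := congrArg (fun f => f x) (adjoint_comp_eq_zero (V := μ.inr ν) (W := μ.inl ν)
        fun x y => inner_eq_zero_symm.1 (μ.inner_inl_inr ν y x))
      have h1 : (μ.inr ν).toContinuousLinearMap.adjoint (μ.inl ν x) = 0 := h0
      rw [K.sandwich_op, ContinuousLinearMap.adjoint_comp]
      change _ = (μ.inl ν).toContinuousLinearMap 0
      rw [ContinuousLinearMap.comp_apply, ContinuousLinearMap.comp_apply, h1]
      simp only [map_zero]
    · exact ⟨_, (K.sandwich_op _ _ _ _)⟩

end Intertwines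

/-! ### Cuntz subequivalence in a C*-algebra with a group action -/

section Subequivalence

variable {G : Type*} [Group G] [TopologicalSpace G]
variable {D : Type*} [NonUnitalCStarAlgebra D]

/-- `x` is a limit of elements `d y d*` with invariant `d`. -/
def Subeq (σ : CAction G D) (x y : D) : Prop :=
  ∃ d : ℕ → D, (∀ n g, σ g (d n) = d n) ∧
    Filter.Tendsto (fun n => d n * y * star (d n)) Filter.atTop (𝓝 x)

theorem subeq_iff {σ : CAction G D} {x y : D} : Subeq σ x y ↔
    ∀ ε > 0, ∃ d, (∀ g, σ g d = d) ∧ ‖d * y * star d - x‖ < ε := by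
  refine ⟨fun ⟨d, hd, hlim⟩ ε hε => ?_, fun h => ?_⟩
  · obtain ⟨n, hn⟩ := (Metric.tendsto_nhds.1 hlim ε hε).exists
    exact ⟨d n, hd n, by rwa [← dist_eq_norm]⟩
  · choose d hd hlt using fun n : ℕ => h (1 / ((n : ℝ) + 1)) Nat.one_div_pos_of_nat
    refine ⟨d, hd, tendsto_iff_norm_sub_tendsto_zero.2 ?_⟩
    exact squeeze_zero (fun _ => norm_nonneg _) (fun n => (hlt n).le)
      tendsto_one_div_add_atTop_nhds_zero_nat

theorem Subeq.trans {σ : CAction G D} {x y z : D} (hxy : Subeq σ x y) (hyz : Subeq σ y z) :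
    Subeq σ x z := by
  rw [subeq_iff] at hxy hyz ⊢
  intro ε hε
  obtain ⟨d, hd, h1⟩ := hxy (ε / 2) (half_pos hε)
  have hpos : 0 < ‖d‖ * ‖d‖ + 1 := by positivity
  obtain ⟨e, he, h2⟩ := hyz (ε / 2 / (‖d‖ * ‖d‖ + 1)) (by positivity)
  refine ⟨d * e, fun g => by rw [map_mul, hd, he], ?_⟩
  have e1 : d * e * z * star (d * e) - x =
      d * (e * z * star e - y) * star d + (d * y * star d - x) := by
    rw [star_mul]; noncomm_ring
  have h3 : ‖d * (e * z * star e - y) * star d‖ ≤ ε / 2 := by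
    refine (norm_mul_le _ _).trans ((mul_le_mul_of_nonneg_right (norm_mul_le _ _)
      (norm_nonneg _)).trans ?_)
    rw [norm_star]
    have h4 := (lt_div_iff₀ hpos).1 h2
    nlinarith [norm_nonneg (e * z * star e - y)]
  rw [e1]
  refine (norm_add_le _ _).trans_lt ?_
  linarith

/-- The fixed point algebra of an action. -/
def fixedPoints (σ : CAction G D) : NonUnitalStarSubalgebra ℂ D where
  carrier := {x | ∀ g, σ g x = x}
  add_mem' hx hy g := by rw [map_add, hx g, hy g]
  zero_mem' g := map_zero _
  mul_mem' hx hy g := by rw [map_mul, hx g, hy g]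
  smul_mem' c x hx g := by rw [map_smul, hx g]
  star_mem' hx g := by rw [map_star, hx g]

instance (σ : CAction G D) : IsClosed (fixedPoints σ : Set D) := by
  have : (fixedPoints σ : Set D) = ⋂ g, {x | σ g x = x} := by
    ext x; simp only [Set.mem_iInter]; rfl
  rw [this]
  exact isClosed_iInter fun g => isClosed_eq (continuous_action σ g) continuous_id

/-- The `d_n` come from an approximate unit of the fixed point algebra. -/
theorem Subeq.refl {σ : CAction G D} {x : D} (hx : ∀ g, σ g x = x) : Subeq σ x x := by
  rw [subeq_iff]
  intro ε hε
  let F := fixedPoints σ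
  let _ := CStarAlgebra.spectralOrder F
  have := CStarAlgebra.spectralOrderedRing F
  have hl := CStarAlgebra.increasingApproximateUnit F
  let x' : F := ⟨x, hx⟩
  have h1 := (Metric.tendsto_nhds.1 (hl.tendsto_mul_left x') (ε / 2) (half_pos hε))
  have h2 := (Metric.tendsto_nhds.1 (hl.tendsto_mul_right x') (ε / 2) (half_pos hε))
  obtain ⟨d, ⟨⟨h1, h2⟩, h3⟩, h4⟩ := (((h1.and h2).and hl.eventually_star_eq).and
    hl.eventually_norm).exists
  refine ⟨d, d.2, ?_⟩
  have e1 : (d : D) * x * star (d : D) - x = ((d * (x' * d - x') + (d * x' - x') : F) : D) := by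
    have h5 : star (d : D) = d := congrArg Subtype.val h3
    rw [h5]
    push_cast
    noncomm_ring
  rw [e1]
  change ‖d * (x' * d - x') + (d * x' - x')‖ < ε
  rw [dist_eq_norm] at h1 h2
  have h6 := norm_mul_le d (x' * d - x')
  have h7 := norm_add_le (d * (x' * d - x')) (d * x' - x')
  nlinarith [norm_nonneg (x' * d - x')]

end Subequivalence

/-! ### The order and the addition of the equivariant Cuntz semigroup -/

section CuntzBasics

variable {G : Type*} [Group G] [TopologicalSpace G]
variable {A B : Type*} [NonUnitalCStarAlgebra A] [NonUnitalCStarAlgebra B]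
  {α : CAction G A} {β : CAction G B}

/-- Cuntz subequivalence may be tested in any representation which contains the representations
of the two elements: off-diagonal corners are reached by compressing on both sides. -/
theorem cuntzLE_iff {a b : PosElem α} {lam : SepRep G} {V : a.rep.H →ₗᵢ[ℂ] lam.H}
    {W : b.rep.H →ₗᵢ[ℂ] lam.H} (hV : a.rep.Intertwines lam V.toContinuousLinearMap)
    (hW : b.rep.Intertwines lam W.toContinuousLinearMap) :
    CuntzLE a b ↔ Subeq (stabAction lam α) (adA A V a.val) (adA A W b.val) := by
  let μ := a.rep
  let ν := b.rep
  let X₁ : (μ.sum ν).H →L[ℂ] lam.H :=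
    V.toContinuousLinearMap ∘L (μ.inl ν).toContinuousLinearMap.adjoint
  let Y₁ : (μ.sum ν).H →L[ℂ] lam.H :=
    W.toContinuousLinearMap ∘L (μ.inr ν).toContinuousLinearMap.adjoint
  let X₂ : lam.H →L[ℂ] (μ.sum ν).H :=
    (μ.inl ν).toContinuousLinearMap ∘L V.toContinuousLinearMap.adjoint
  let Y₂ : lam.H →L[ℂ] (μ.sum ν).H :=
    (μ.inr ν).toContinuousLinearMap ∘L W.toContinuousLinearMap.adjoint
  constructor
  · rintro ⟨d, -, hd, hlim⟩
    refine ⟨fun n => sandwich A X₁ Y₁ (d n), fun n g => ?_, ?_⟩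
    · have h1 := stabAction_sandwich (α := α) (hV.comp (μ.intertwines_inl ν).adjoint)
        (hW.comp (μ.intertwines_inr ν).adjoint) g (d n)
      exact h1.trans (congrArg _ (hd n g))
    · have h1 : Y₁.adjoint ∘L W.toContinuousLinearMap = (μ.inr ν).toContinuousLinearMap := by
        rw [ContinuousLinearMap.adjoint_comp, ContinuousLinearMap.adjoint_adjoint,
          ContinuousLinearMap.comp_assoc, isom_adjoint_comp, ContinuousLinearMap.comp_id]
      have h2 : X₁ ∘L (μ.inl ν).toContinuousLinearMap = V.toContinuousLinearMap := by
        rw [ContinuousLinearMap.comp_assoc, isom_adjoint_comp, ContinuousLinearMap.comp_id]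
      have h3 := ((sandwich A X₁ X₁).continuous.tendsto _).comp hlim
      have h4 : sandwich A X₁ X₁ (a.inl b.rep) = adA A V a.val := by
        rw [PosElem.inl, adA_eq_sandwich, sandwich_sandwich, h2, adA_eq_sandwich]
      rw [h4] at h3
      refine h3.congr fun n => ?_
      exact (sandwich_mul_adA_mul_star X₁ Y₁ W (μ.inr ν) h1 (d n) b.val).symm
  · rintro ⟨d, hd, hlim⟩
    refine ⟨fun n => sandwich A X₂ Y₂ (d n), fun n => sandwich_mem_offDiag _ _ _, fun n g => ?_, ?_⟩
    · have h1 := stabAction_sandwich (α := α) ((μ.intertwines_inl ν).comp hV.adjoint)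
        ((μ.intertwines_inr ν).comp hW.adjoint) g (d n)
      exact h1.trans (congrArg _ (hd n g))
    · have h1 : Y₂.adjoint ∘L (μ.inr ν).toContinuousLinearMap = W.toContinuousLinearMap := by
        rw [ContinuousLinearMap.adjoint_comp, ContinuousLinearMap.adjoint_adjoint,
          ContinuousLinearMap.comp_assoc, isom_adjoint_comp, ContinuousLinearMap.comp_id]
      have h2 : X₂ ∘L V.toContinuousLinearMap = (μ.inl ν).toContinuousLinearMap := by
        rw [ContinuousLinearMap.comp_assoc, isom_adjoint_comp, ContinuousLinearMap.comp_id]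
      have h3 := ((sandwich A X₂ X₂).continuous.tendsto _).comp hlim
      have h4 : sandwich A X₂ X₂ (adA A V a.val) = a.inl b.rep := by
        rw [PosElem.inl, adA_eq_sandwich, sandwich_sandwich, h2, adA_eq_sandwich]
      rw [h4] at h3
      refine h3.congr fun n => ?_
      exact (sandwich_mul_adA_mul_star X₂ Y₂ (μ.inr ν) W h1 (d n) b.val).symm

theorem stabAction_adA_val (a : PosElem α) {lam : SepRep G} {V : a.rep.H →ₗᵢ[ℂ] lam.H}
    (hV : a.rep.Intertwines lam V.toContinuousLinearMap) (g : G) :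
    stabAction lam α g (adA A V a.val) = adA A V a.val :=
  (PosElem.stabAction_adA (hV.isom_comp g) a.val).trans (congrArg _ (a.invariant g))

theorem cuntzLE_of_adA_eq {a b : PosElem α} {lam : SepRep G} {V : a.rep.H →ₗᵢ[ℂ] lam.H}
    {W : b.rep.H →ₗᵢ[ℂ] lam.H} (hV : a.rep.Intertwines lam V.toContinuousLinearMap)
    (hW : b.rep.Intertwines lam W.toContinuousLinearMap) (h : adA A V a.val = adA A W b.val) :
    CuntzLE a b := by
  rw [cuntzLE_iff hV hW, h]
  exact Subeq.refl (stabAction_adA_val b hW)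

/-- Elements which become equal in a larger representation are Cuntz equivalent. -/
theorem cuntzEquiv_of_adA_eq {a b : PosElem α} {lam : SepRep G} {V : a.rep.H →ₗᵢ[ℂ] lam.H}
    {W : b.rep.H →ₗᵢ[ℂ] lam.H} (hV : a.rep.Intertwines lam V.toContinuousLinearMap)
    (hW : b.rep.Intertwines lam W.toContinuousLinearMap) (h : adA A V a.val = adA A W b.val) :
    CuntzEquiv a b := ⟨cuntzLE_of_adA_eq hV hW h, cuntzLE_of_adA_eq hW hV h.symm⟩

theorem CuntzLE.refl (a : PosElem α) : CuntzLE a a :=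
  cuntzLE_of_adA_eq (V := LinearIsometry.id) (W := LinearIsometry.id)
    (SepRep.Intertwines.id a.rep) (SepRep.Intertwines.id a.rep) rfl

theorem CuntzLE.trans {a b c : PosElem α} (hab : CuntzLE a b) (hbc : CuntzLE b c) :
    CuntzLE a c := by
  let lam := (a.rep.sum b.rep).sum c.rep
  let V₁ : a.rep.H →ₗᵢ[ℂ] lam.H := ((a.rep.sum b.rep).inl c.rep).comp (a.rep.inl b.rep)
  let V₂ : b.rep.H →ₗᵢ[ℂ] lam.H := ((a.rep.sum b.rep).inl c.rep).comp (a.rep.inr b.rep)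
  let V₃ : c.rep.H →ₗᵢ[ℂ] lam.H := (a.rep.sum b.rep).inr c.rep
  have h₁ : a.rep.Intertwines lam V₁.toContinuousLinearMap :=
    (SepRep.intertwines_inl _ _).comp (SepRep.intertwines_inl _ _)
  have h₂ : b.rep.Intertwines lam V₂.toContinuousLinearMap :=
    (SepRep.intertwines_inl _ _).comp (SepRep.intertwines_inr _ _)
  have h₃ : c.rep.Intertwines lam V₃.toContinuousLinearMap := SepRep.intertwines_inr _ _
  rw [cuntzLE_iff h₁ h₂] at hab
  rw [cuntzLE_iff h₂ h₃] at hbc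
  rw [cuntzLE_iff h₁ h₃]
  exact hab.trans hbc

theorem cuntzEquiv_equivalence : Equivalence (CuntzEquiv (α := α)) where
  refl a := ⟨.refl a, .refl a⟩
  symm h := ⟨h.2, h.1⟩
  trans h h' := ⟨h.1.trans h'.1, h'.2.trans h.2⟩

namespace CuG

theorem mk_eq_mk {a b : PosElem α} : mk a = mk b ↔ CuntzEquiv a b :=
  ⟨fun h => cuntzEquiv_equivalence.eqvGen_iff.1 (Quot.eqvGen_exact h), fun h => Quot.sound h⟩

theorem mk_surjective (x : CuG α) : ∃ a, mk a = x := Quot.exists_rep x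

theorem mk_le_mk {a b : PosElem α} : mk a ≤ mk b ↔ CuntzLE a b := by
  refine ⟨?_, fun h => ⟨a, b, rfl, rfl, h⟩⟩
  rintro ⟨a', b', ha, hb, h⟩
  exact ((mk_eq_mk.1 ha).2.trans h).trans (mk_eq_mk.1 hb).1

protected theorem le_refl (x : CuG α) : x ≤ x := by
  obtain ⟨a, rfl⟩ := mk_surjective x
  exact mk_le_mk.2 (.refl a)

protected theorem le_antisymm {x y : CuG α} (h : x ≤ y) (h' : y ≤ x) : x = y := by
  obtain ⟨a, rfl⟩ := mk_surjective x
  obtain ⟨b, rfl⟩ := mk_surjective y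
  exact mk_eq_mk.2 ⟨mk_le_mk.1 h, mk_le_mk.1 h'⟩

end CuG

theorem PosElem.coprod_sum_val (a b : PosElem α) {lam : SepRep G} {V : a.rep.H →ₗᵢ[ℂ] lam.H}
    {W : b.rep.H →ₗᵢ[ℂ] lam.H} (h : ∀ x y, inner ℂ (V x) (W y) = 0) :
    adA A (coprodIsom V W h) (a.sum b).val = adA A V a.val + adA A W b.val := by
  change adA A (coprodIsom V W h) (adA A (inlIsom a.rep.H b.rep.H) a.val +
    adA A (inrIsom a.rep.H b.rep.H) b.val) = _
  rw [map_add, adA_adA, adA_adA, coprodIsom_comp_inl, coprodIsom_comp_inr]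

/-- A sum of orthogonal copies of `a` and `b` represents the sum of their classes. -/
theorem cuntzEquiv_sum {a b c : PosElem α} {lam : SepRep G} {V : a.rep.H →ₗᵢ[ℂ] lam.H}
    {W : b.rep.H →ₗᵢ[ℂ] lam.H} {U : c.rep.H →ₗᵢ[ℂ] lam.H}
    (hV : a.rep.Intertwines lam V.toContinuousLinearMap)
    (hW : b.rep.Intertwines lam W.toContinuousLinearMap)
    (hU : c.rep.Intertwines lam U.toContinuousLinearMap)
    (h : ∀ x y, inner ℂ (V x) (W y) = 0)
    (hc : adA A U c.val = adA A V a.val + adA A W b.val) : CuntzEquiv c (a.sum b) :=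
  cuntzEquiv_of_adA_eq hU (SepRep.intertwines_coprod h hV hW)
    (hc.trans (a.coprod_sum_val b h).symm)

/-- Block diagonal elements implement the subequivalence of direct sums. -/
theorem CuntzLE.sum {a a' b b' : PosElem α} (ha : CuntzLE a a') (hb : CuntzLE b b') :
    CuntzLE (a.sum b) (a'.sum b') := by
  let κ := a.rep.sum a'.rep
  let ρ := b.rep.sum b'.rep
  have o : ∀ x y, inner ℂ (κ.inl ρ x) (κ.inr ρ y) = 0 := κ.inner_inl_inr ρ
  rw [cuntzLE_iff (SepRep.intertwines_inl _ _) (SepRep.intertwines_inr _ _)] at ha hb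
  have o₁ : ∀ x y, inner ℂ (((κ.inl ρ).comp (a.rep.inl a'.rep)) x)
    (((κ.inr ρ).comp (b.rep.inl b'.rep)) y) = 0 := fun x y => o _ _
  have o₂ : ∀ x y, inner ℂ (((κ.inl ρ).comp (a.rep.inr a'.rep)) x)
    (((κ.inr ρ).comp (b.rep.inr b'.rep)) y) = 0 := fun x y => o _ _
  have i₁ := SepRep.intertwines_coprod o₁
    ((κ.intertwines_inl ρ).comp (a.rep.intertwines_inl a'.rep))
    ((κ.intertwines_inr ρ).comp (b.rep.intertwines_inl b'.rep))
  have i₂ := SepRep.intertwines_coprod o₂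
    ((κ.intertwines_inl ρ).comp (a.rep.intertwines_inr a'.rep))
    ((κ.intertwines_inr ρ).comp (b.rep.intertwines_inr b'.rep))
  refine (cuntzLE_iff (a := a.sum b) (b := a'.sum b') i₁ i₂).2 ?_
  suffices h : Subeq (stabAction (κ.sum ρ) α)
      (adA A (κ.inl ρ) (adA A (a.rep.inl a'.rep) a.val) +
        adA A (κ.inr ρ) (adA A (b.rep.inl b'.rep) b.val))
      (adA A (κ.inl ρ) (adA A (a.rep.inr a'.rep) a'.val) +
        adA A (κ.inr ρ) (adA A (b.rep.inr b'.rep) b'.val)) by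
    rw [adA_adA, adA_adA, adA_adA, adA_adA, ← a.coprod_sum_val b o₁,
      ← a'.coprod_sum_val b' o₂] at h
    exact h
  obtain ⟨d, hd, hdlim⟩ := ha
  obtain ⟨e, he, helim⟩ := hb
  refine ⟨fun n => adA A (κ.inl ρ) (d n) + adA A (κ.inr ρ) (e n), fun n g => ?_, ?_⟩
  · rw [map_add, PosElem.stabAction_adA (κ.sum_U_inl ρ g), PosElem.stabAction_adA (κ.sum_U_inr ρ g),
      hd, he]
  · have h1 := (((continuous_adA (κ.inl ρ)).tendsto _).comp hdlim).add
      (((continuous_adA (κ.inr ρ)).tendsto _).comp helim)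
    refine h1.congr fun n => ?_
    rw [star_add, ← map_star, ← map_star, adA_add_adA_mul o, adA_add_adA_mul o]
    rfl

/-- The sum of classes is defined by a choice of representatives, on which it does not depend. -/
theorem CuG.mk_add_mk (a b : PosElem α) : mk a + mk b = mk (a.sum b) := by
  have h : ∀ c : PosElem α, CuntzEquiv (Quot.out (mk c)) c := fun c =>
    mk_eq_mk.1 (Quot.out_eq (mk c))
  exact mk_eq_mk.2 ⟨(h a).1.sum (h b).1, (h a).2.sum (h b).2⟩

end CuntzBasics

/-! ### Order isomorphisms preserve suprema and the way-below relation -/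

section OrderIso

variable {X Y R : Type*} [Zero X] [Add X] [LE X] [SMul R X] [Zero Y] [Add Y] [LE Y] [SMul R Y]

theorem isLUB_image_of_leftInverse {f : X → Y} {g : Y → X} (hf : ∀ x y, x ≤ y → f x ≤ f y)
    (hg : ∀ x y, x ≤ y → g x ≤ g y) (hgf : Function.LeftInverse g f)
    (hfg : Function.RightInverse g f) {u : ℕ → X} {v : X}
    (h : IsLUB (Set.range u) v) : IsLUB (Set.range (f ∘ u)) (f v) := by
  constructor
  · rintro _ ⟨n, rfl⟩
    exact hf _ _ (h.1 ⟨n, rfl⟩)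
  · intro w hw
    rw [← hfg w]
    refine hf _ _ (h.2 ?_)
    rintro _ ⟨n, rfl⟩
    rw [← hgf (u n)]
    exact hg _ _ (hw ⟨n, rfl⟩)

theorem isCCuGMorphism_of_inverse {f : X → Y} {g : Y → X} (hf : ∀ x y, x ≤ y → f x ≤ f y)
    (hg : ∀ x y, x ≤ y → g x ≤ g y) (hgf : Function.LeftInverse g f)
    (hfg : Function.RightInverse g f) (h0 : f 0 = 0) (hadd : ∀ x y, f (x + y) = f x + f y)
    (hsmul : ∀ (r : R) x, f (r • x) = r • f x) : IsCCuGMorphism R f where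
  map_zero := h0
  map_add := hadd
  map_smul := hsmul
  mono := hf
  map_sup u v _ h := isLUB_image_of_leftInverse hf hg hgf hfg h
  map_wayBelow s t h u v hu hv ht := by
    obtain ⟨n, hn⟩ := h (g ∘ u) (g v) (fun n => hg _ _ (hu n))
      (isLUB_image_of_leftInverse hg hf hfg hgf hv) (by rw [← hgf t]; exact hg _ _ ht)
    exact ⟨n, by rw [← hfg (u n)]; exact hf _ _ hn⟩

/-- An order isomorphism which preserves zero, sums and multiples is an isomorphism. -/
theorem isCCuGIso_of_equiv (e : X ≃ Y) (he : ∀ x y, e x ≤ e y ↔ x ≤ y) (h0 : e 0 = 0)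
    (hadd : ∀ x y, e (x + y) = e x + e y) (hsmul : ∀ (r : R) x, e (r • x) = r • e x) :
    IsCCuGIso R e := by
  have hs : ∀ x y, x ≤ y → e.symm x ≤ e.symm y := fun x y h => by
    rw [← he, e.apply_symm_apply, e.apply_symm_apply]; exact h
  refine ⟨isCCuGMorphism_of_inverse (fun x y => (he x y).2) hs e.left_inv e.right_inv h0 hadd hsmul,
    e.symm, isCCuGMorphism_of_inverse hs (fun x y => (he x y).2) e.right_inv e.left_inv ?_ ?_ ?_,
    e.left_inv, e.right_inv⟩
  · rw [← h0, e.symm_apply_apply]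
  · intro x y
    rw [e.symm_apply_eq, hadd, e.apply_symm_apply, e.apply_symm_apply]
  · intro r x
    rw [e.symm_apply_eq, hsmul, e.apply_symm_apply]

end OrderIso

/-! ### Averaging over a compact group -/

section Averaging

variable {G : Type*} [Group G] [TopologicalSpace G] [IsTopologicalGroup G] [CompactSpace G]
  [T2Space G]
variable {E F : Type*} [NormedAddCommGroup E] [NormedSpace ℂ E] [CompleteSpace E]
  [NormedAddCommGroup F] [NormedSpace ℂ F] [CompleteSpace F]

/-- The integral of a function on a compact group with respect to the normalized Haar measure. -/
def average (f : G → E) : E :=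
  letI : MeasurableSpace G := borel G
  haveI : BorelSpace G := ⟨rfl⟩
  ∫ g, f g ∂(MeasureTheory.Measure.haarMeasure (⊤ : TopologicalSpace.PositiveCompacts G))

theorem average_mul_left (f : G → E) (h : G) : average (fun g => f (h * g)) = average f := by
  let _ : MeasurableSpace G := borel G
  have : BorelSpace G := ⟨rfl⟩
  exact MeasureTheory.integral_mul_left_eq_self f h

theorem map_average (L : E →L[ℂ] F) {f : G → E} (hf : Continuous f) :
    L (average f) = average fun g => L (f g) := by
  let _ : MeasurableSpace G := borel G
  have : BorelSpace G := ⟨rfl⟩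
  exact (L.integral_comp_comm
    (hf.integrable_of_hasCompactSupport (HasCompactSupport.of_compactSpace f))).symm

theorem isProbabilityMeasure_haarMeasure_top [MeasurableSpace G] [BorelSpace G] :
    MeasureTheory.IsProbabilityMeasure
      (MeasureTheory.Measure.haarMeasure (⊤ : TopologicalSpace.PositiveCompacts G)) :=
  ⟨MeasureTheory.Measure.haarMeasure_self⟩

theorem average_mem {s : Set E} (hs : Convex ℝ s) (hc : IsClosed s) {f : G → E}
    (hf : Continuous f) (h : ∀ g, f g ∈ s) : average f ∈ s := by
  let _ : MeasurableSpace G := borel G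
  have : BorelSpace G := ⟨rfl⟩
  have := isProbabilityMeasure_haarMeasure_top (G := G)
  exact hs.integral_mem hc (Filter.Eventually.of_forall h)
    (hf.integrable_of_hasCompactSupport (HasCompactSupport.of_compactSpace f))

theorem average_re_pos {f : G → ℂ} (hf : Continuous f) (h : ∀ g, 0 ≤ (f g).re)
    (h1 : 0 < (f 1).re) : 0 < (average f).re := by
  let _ : MeasurableSpace G := borel G
  have : BorelSpace G := ⟨rfl⟩
  have h2 : (average f).re = ∫ g, (f g).re
      ∂(MeasureTheory.Measure.haarMeasure (⊤ : TopologicalSpace.PositiveCompacts G)) :=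
    (Complex.reCLM.integral_comp_comm
      (hf.integrable_of_hasCompactSupport (HasCompactSupport.of_compactSpace f))).symm
  rw [h2]
  exact (Complex.continuous_re.comp hf).integral_pos_of_hasCompactSupport_nonneg_nonzero
    (HasCompactSupport.of_compactSpace _) h h1.ne'

end Averaging

/-! ### Invariant elements of a C*-algebra with an action of a compact group -/

section InvariantElements

variable {G : Type*} [Group G] [TopologicalSpace G]
variable {D : Type*} [NonUnitalCStarAlgebra D]

/-- An automorphism of an action as a bounded linear map. -/
def CAction.clm (σ : CAction G D) (g : G) : D →L[ℂ] D :=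
  ⟨LinearMapClass.linearMap (σ g), continuous_action σ g⟩

theorem CAction.clm_apply (σ : CAction G D) (g : G) (x : D) : σ.clm g x = σ g x := rfl

/-- The square root of an invariant positive element is invariant. -/
theorem exists_invariant_sqrt {σ : CAction G D} {x : D} (hx : ∃ c, x = star c * c)
    (hinv : ∀ g, σ g x = x) : ∃ h, star h = h ∧ x = star h * h ∧ ∀ g, σ g h = h := by
  let _ := CStarAlgebra.spectralOrder D
  have := CStarAlgebra.spectralOrderedRing D
  have hx0 : 0 ≤ x := CStarAlgebra.nonneg_iff_eq_star_mul_self.2 hx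
  have h0 : 0 ≤ CFC.sqrt x := CFC.sqrt_nonneg x
  have hs : star (CFC.sqrt x) = CFC.sqrt x := (IsSelfAdjoint.of_nonneg h0).star_eq
  refine ⟨CFC.sqrt x, hs, by rw [hs, CFC.sqrt_mul_sqrt_self x hx0], fun g => ?_⟩
  have h1 : σ g (CFC.sqrt x) * σ g (CFC.sqrt x) = x := by
    rw [← map_mul, CFC.sqrt_mul_sqrt_self x hx0, hinv]
  have h2 : 0 ≤ σ g (CFC.sqrt x) := by
    obtain ⟨c, hc⟩ := CStarAlgebra.nonneg_iff_eq_star_mul_self.1 h0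
    rw [hc, map_mul, map_star]
    exact star_mul_self_nonneg _
  exact (CFC.sqrt_unique h1 h2).symm

/-- If `h k_n → x`, then `k_n* (h* h) k_n → x* x`. -/
theorem subeq_of_mem_closure {σ : CAction G D} {x h : D}
    (hx : x ∈ closure {y | ∃ k, (∀ g, σ g k = k) ∧ h * k = y}) :
    Subeq σ (star x * x) (star h * h) := by
  obtain ⟨y, hy, hlim⟩ := mem_closure_iff_seq_limit.1 hx
  choose k hk hky using hy
  refine ⟨fun n => star (k n), fun n g => by rw [map_star, hk], ?_⟩
  refine ((continuous_star.tendsto _ |>.comp hlim).mul hlim).congr fun n => ?_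
  rw [Function.comp_apply, ← hky, star_mul, star_star, mul_assoc, mul_assoc, mul_assoc]

section
variable [IsTopologicalGroup G] [CompactSpace G] [T2Space G]

theorem action_average (σ : CAction G D) (x : D) (h : G) :
    σ h (average fun g => σ g x) = average fun g => σ g x := by
  have h1 := map_average (σ.clm h) (σ.continuous x)
  refine h1.trans ((congrArg average (funext fun g => ?_)).trans
    (average_mul_left (fun g => σ g x) h))
  rw [σ.clm_apply, σ.map_mul]
  rfl

/-- Averaging makes approximate right inverses invariant. -/
theorem mem_closure_invariant {σ : CAction G D} {x h : D} (hx : ∀ g, σ g x = x)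
    (hh : ∀ g, σ g h = h) (hxh : x ∈ closure (Set.range fun k => h * k)) :
    x ∈ closure {y | ∃ k, (∀ g, σ g k = k) ∧ h * k = y} := by
  rw [Metric.mem_closure_iff] at hxh ⊢
  intro ε hε
  obtain ⟨_, ⟨k, rfl⟩, hk⟩ := hxh (ε / 2) (half_pos hε)
  refine ⟨_, ⟨average fun g => σ g k, action_average σ k, rfl⟩, ?_⟩
  have h1 : h * average (fun g => σ g k) = average fun g => h * σ g k :=
    map_average (ContinuousLinearMap.mul ℂ D h) (σ.continuous k)
  rw [h1, dist_comm]
  have h2 : average (fun g => h * σ g k) ∈ Metric.closedBall x (ε / 2) := by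
    refine average_mem (convex_closedBall _ _) Metric.isClosed_closedBall
      (continuous_const.mul (σ.continuous k)) fun g => ?_
    have h3 := dist_hom_le (σ g) (h * k) x
    rw [map_mul, hh, hx, dist_comm (h * k)] at h3
    exact h3.trans hk.le
  exact (Metric.mem_closedBall.1 h2).trans_lt (half_lt_self hε)

end

end InvariantElements

/-! ### Strictly positive compact operators -/

section PositiveFunctionals

variable {D : Type*} [NonUnitalCStarAlgebra D]

open scoped ComplexOrder in
/-- A positive functional is continuous, and vanishes on `h* D` if it vanishes on `h* h`, by the
Cauchy-Schwarz inequality. -/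
theorem continuous_and_apply_star_mul_eq_zero {f : D →ₗ[ℂ] ℂ} (hf : ∀ c, 0 ≤ f (star c * c)) :
    Continuous f ∧ ∀ h, f (star h * h) = 0 → ∀ k, f (star h * k) = 0 := by
  let _ := CStarAlgebra.spectralOrder D
  have := CStarAlgebra.spectralOrderedRing D
  let F : D →ₚ[ℂ] ℂ := PositiveLinearMap.mk₀ f fun x hx => by
    obtain ⟨c, rfl⟩ := CStarAlgebra.nonneg_iff_eq_star_mul_self.1 hx
    exact hf c
  constructor
  · obtain ⟨C, hC⟩ := F.exists_norm_apply_le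
    exact AddMonoidHomClass.continuous_of_bound f C hC
  · intro h h0 k
    have h1 : ‖F.toPreGNS h‖ = 0 := by
      have : F (star h * h) = 0 := h0
      rw [PositiveLinearMap.preGNS_norm_def, PositiveLinearMap.ofPreGNS_toPreGNS, this]
      simp
    have h2 := norm_inner_le_norm (𝕜 := ℂ) (F.toPreGNS h) (F.toPreGNS k)
    rw [h1, zero_mul] at h2
    exact norm_le_zero_iff.1 h2

end PositiveFunctionals

section StrictlyPositive

variable {H H' : Type*} [NormedAddCommGroup H] [InnerProductSpace ℂ H] [CompleteSpace H]
  [NormedAddCommGroup H'] [InnerProductSpace ℂ H'] [CompleteSpace H']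

theorem K.norm_op_apply_le (T : K H) (ξ : H) : ‖T.op ξ‖ ≤ ‖T‖ * ‖ξ‖ := T.op.le_opNorm ξ

/-- The vector functional `T ↦ ⟪ξ, T η⟫` on the compact operators. -/
def K.vecFunctional (ξ η : H) : K H →L[ℂ] ℂ :=
  LinearMap.mkContinuous
    { toFun := fun T => inner ℂ ξ (T.op η)
      map_add' := fun S T => by simp
      map_smul' := fun c T => by simp } (‖ξ‖ * ‖η‖) fun T => by
    refine (norm_inner_le_norm _ _).trans ?_
    have := T.norm_op_apply_le η
    calc ‖ξ‖ * ‖T.op η‖ ≤ ‖ξ‖ * (‖T‖ * ‖η‖) := mul_le_mul_of_nonneg_left this (norm_nonneg _)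
      _ = _ := by ring

theorem K.vecFunctional_apply (ξ η : H) (T : K H) : K.vecFunctional ξ η T = inner ℂ ξ (T.op η) :=
  rfl

/-- If `h` is injective, the elements `h* k` are dense in the compact operators. -/
theorem K.dense_star_mul {h : K H} (hinj : ∀ ξ, h.op ξ = 0 → ξ = 0) (T : K H) :
    T ∈ closure (Set.range fun k : K H => star h * k) := by
  have hadd : ∀ x y, x ∈ closure (Set.range fun k : K H => star h * k) →
      y ∈ closure (Set.range fun k : K H => star h * k) →
      x + y ∈ closure (Set.range fun k : K H => star h * k) := fun x y hx hy =>
    map_mem_closure₂ continuous_add hx hy (by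
      rintro _ ⟨k, rfl⟩ _ ⟨k', rfl⟩
      exact ⟨k + k', mul_add _ _ _⟩)
  have hdense : Dense (LinearMap.range ((star h).op : H →ₗ[ℂ] H) : Set H) := by
    rw [Submodule.dense_iff_topologicalClosure_eq_top, Submodule.topologicalClosure_eq_top_iff,
      Submodule.eq_bot_iff]
    intro ξ hξ
    refine hinj ξ (ext_inner_left ℂ fun η => ?_)
    rw [Submodule.mem_orthogonal] at hξ
    have := hξ ((star h).op η) ⟨η, rfl⟩
    rw [K.op_star, ContinuousLinearMap.star_eq_adjoint,
      ContinuousLinearMap.adjoint_inner_left] at this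
    rw [this, inner_zero_right]
  induction T using K.induction with
  | hc => exact isClosed_closure
  | h0 => exact subset_closure ⟨0, mul_zero _⟩
  | hadd S T hS hT => exact hadd S T hS hT
  | h ξ η =>
    refine map_mem_closure (f := fun ξ => K.rankOne ξ η)
      (K.continuous_rankOne.comp (Continuous.prodMk_left η)) (hdense ξ) ?_
    rintro _ ⟨ζ, rfl⟩
    exact ⟨K.rankOne ζ η, K.ext fun x => by simp⟩

open scoped ComplexOrder in
/-- A positive compact operator is strictly positive if and only if it is injective. -/
theorem K.isStrictlyPositiveElem_iff {s : K H} :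
    IsStrictlyPositiveElem s ↔ (∃ c, s = star c * c) ∧ ∀ ξ, s.op ξ = 0 → ξ = 0 := by
  constructor
  · rintro ⟨hs, h⟩
    refine ⟨hs, fun ξ hξ => ?_⟩
    by_contra hne
    have h1 := h (K.vecFunctional ξ ξ).toLinearMap (fun c => ?_) (fun h0 => ?_)
    · change 0 < (inner ℂ ξ (s.op ξ) : ℂ) at h1
      rw [hξ, inner_zero_right] at h1
      exact lt_irrefl _ h1
    · change 0 ≤ (inner ℂ ξ ((star c * c).op ξ) : ℂ)
      rw [K.op_mul, mul_apply_eq_comp, K.op_star, ContinuousLinearMap.star_eq_adjoint,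
        ContinuousLinearMap.adjoint_inner_right, inner_self_eq_norm_sq_to_K]
      rw [← RCLike.ofReal_pow]
      exact Complex.zero_le_real.2 (sq_nonneg ‖c.op ξ‖)
    · have h2 : (inner ℂ ξ ((K.rankOne ξ ξ).op ξ) : ℂ) = 0 := congrArg (fun f => f (K.rankOne ξ ξ)) h0
      rw [K.rankOne_op, inner_smul_right, mul_self_eq_zero] at h2
      exact hne (inner_self_eq_zero.1 h2)
  · rintro ⟨⟨h, rfl⟩, hinj⟩
    have hinj' : ∀ ξ, h.op ξ = 0 → ξ = 0 := fun ξ hξ => hinj ξ (by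
      rw [K.op_mul, mul_apply_eq_comp, hξ, map_zero])
    refine ⟨⟨h, rfl⟩, fun f hf hne => lt_of_le_of_ne (hf h) fun h0 => hne ?_⟩
    obtain ⟨hcont, hCS⟩ := continuous_and_apply_star_mul_eq_zero hf
    refine LinearMap.ext fun T => ?_
    have hcl : IsClosed {T : K H | f T = 0} := isClosed_eq hcont continuous_const
    refine closure_minimal ?_ hcl (K.dense_star_mul hinj' T)
    rintro _ ⟨k, rfl⟩
    exact hCS h h0.symm k

theorem K.rankOne_self_eq_star_mul (w : H) : ∃ c : K H, K.rankOne w w = star c * c := by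
  by_cases hw : w = 0
  · exact ⟨0, K.ext fun x => by simp [hw]⟩
  · refine ⟨(‖w‖⁻¹ : ℂ) • K.rankOne w w, K.ext fun x => ?_⟩
    have h1 : star (K.rankOne w w) = K.rankOne w w := K.ext fun x => ext_inner_left ℂ fun y => by
      rw [K.op_star, ContinuousLinearMap.star_eq_adjoint, ContinuousLinearMap.adjoint_inner_right,
        K.rankOne_op, K.rankOne_op, inner_smul_left, inner_smul_right, inner_conj_symm, mul_comm]
    have hn : (‖w‖ : ℂ) ≠ 0 := by exact_mod_cast norm_ne_zero_iff.2 hw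
    rw [star_smul, h1]
    simp only [K.op_mul, K.op_smul, mul_apply_eq_comp, smul_apply, map_smul, K.rankOne_op,
      inner_self_eq_norm_sq_to_K, smul_smul]
    congr 1
    simp
    field_simp

/-- On a separable Hilbert space there is an injective positive compact operator `∑ |w_n⟩⟨w_n|`, where
`(w_n)` is a dense sequence scaled so that the sum converges. -/
theorem K.exists_injective_pos [TopologicalSpace.SeparableSpace H] :
    ∃ s : K H, (∃ c, s = star c * c) ∧ ∀ ξ, ξ ≠ 0 → 0 < (inner ℂ ξ (s.op ξ) : ℂ).re := by
  let v : ℕ → H := TopologicalSpace.denseSeq H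
  let w : ℕ → H := fun n => (((1 / 2 : ℝ) ^ n / (1 + ‖v n‖) : ℝ) : ℂ) • v n
  have hpos : ∀ n, 0 < (1 / 2 : ℝ) ^ n / (1 + ‖v n‖) := fun n => by positivity
  have hw : ∀ n, ‖w n‖ ≤ (1 / 2 : ℝ) ^ n := fun n => by
    rw [norm_smul, Complex.norm_real, Real.norm_of_nonneg (hpos n).le, div_mul_eq_mul_div]
    rw [div_le_iff₀ (by positivity)]
    exact mul_le_mul_of_nonneg_left (by linarith) (by positivity)
  have hsum : Summable fun n => K.rankOne (w n) (w n) := by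
    refine Summable.of_norm_bounded summable_geometric_two fun n => ?_
    rw [K.norm_def]
    change ‖InnerProductSpace.rankOne ℂ (w n) (w n)‖ ≤ _
    rw [InnerProductSpace.norm_rankOne]
    have h1 : (1 / 2 : ℝ) ^ n ≤ 1 := pow_le_one₀ (by norm_num) (by norm_num)
    nlinarith [hw n, norm_nonneg (w n)]
  refine ⟨∑' n, K.rankOne (w n) (w n), ?_, fun ξ hξ => ?_⟩
  · let _ := CStarAlgebra.spectralOrder (K H)
    have := CStarAlgebra.spectralOrderedRing (K H)
    refine CStarAlgebra.nonneg_iff_eq_star_mul_self.1 (tsum_nonneg fun n => ?_)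
    exact CStarAlgebra.nonneg_iff_eq_star_mul_self.2 (K.rankOne_self_eq_star_mul (w n))
  · have h1 := (hsum.hasSum.mapL (K.vecFunctional ξ ξ)).mapL Complex.reCLM
    have h2 : ∀ n, Complex.reCLM (K.vecFunctional ξ ξ (K.rankOne (w n) (w n))) =
        ‖(inner ℂ (w n) ξ : ℂ)‖ ^ 2 := fun n => by
      rw [K.vecFunctional_apply, K.rankOne_op, inner_smul_right, ← inner_conj_symm ξ (w n),
        RCLike.mul_conj]
      exact_mod_cast rfl
    obtain ⟨n, hn⟩ : ∃ n, (inner ℂ (v n) ξ : ℂ) ≠ 0 := by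
      by_contra! hall
      have hcl : IsClosed {x : H | (inner ℂ x ξ : ℂ) = 0} :=
        isClosed_eq (by fun_prop) continuous_const
      have h3 : ξ ∈ {x : H | (inner ℂ x ξ : ℂ) = 0} := by
        refine closure_minimal ?_ hcl (TopologicalSpace.denseRange_denseSeq H ξ)
        rintro _ ⟨n, rfl⟩
        exact hall n
      exact hξ (inner_self_eq_zero.1 h3)
    have h4 : (0 : ℝ) < ‖(inner ℂ (w n) ξ : ℂ)‖ ^ 2 := by
      rw [inner_smul_left]
      have := hpos n
      have h5 : ((((1 / 2 : ℝ) ^ n / (1 + ‖v n‖) : ℝ) : ℂ)) ≠ 0 := by exact_mod_cast this.ne'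
      exact pow_pos (norm_pos_iff.2 (mul_ne_zero (by simpa using h5) hn)) 2
    refine lt_of_lt_of_le h4 ?_
    rw [← h2]
    refine le_hasSum h1 n fun m _ => ?_
    rw [h2]
    positivity

theorem K.isStrictlyPositiveElem_adIsom {s : K H} (hs : IsStrictlyPositiveElem s)
    (V : H ≃ₗᵢ[ℂ] H') : IsStrictlyPositiveElem (adIsom V.toLinearIsometry s) := by
  rw [K.isStrictlyPositiveElem_iff] at hs ⊢
  obtain ⟨⟨c, hc⟩, hinj⟩ := hs
  refine ⟨⟨adIsom V.toLinearIsometry c, by rw [hc, map_mul, map_star]⟩, fun ξ hξ => ?_⟩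
  obtain ⟨η, rfl⟩ := V.surjective ξ
  have h1 := isom_adjoint_apply V.toLinearIsometry η
  rw [LinearIsometryEquiv.coe_toLinearIsometry] at h1
  rw [adIsom_op, h1] at hξ
  rw [hinj η (V.injective (hξ.trans (map_zero V).symm)), map_zero]

end StrictlyPositive

section StrictlyPositiveInvariant

variable {G : Type*} [Group G] [TopologicalSpace G]

variable [IsTopologicalGroup G] [CompactSpace G] [T2Space G]

/-- The algebra `K(H_ν)` has a strictly positive invariant element: the average of a strictly
positive element. -/
theorem SepRep.exists_strictlyPositive (ν : SepRep G) :
    ∃ s : K ν.H, IsStrictlyPositiveElem s ∧ ∀ g, ν.ad g s = s := by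
  obtain ⟨s, hs, hs'⟩ := K.exists_injective_pos (H := ν.H)
  refine ⟨average fun g => ν.ad g s, ?_, action_average ν.ad s⟩
  rw [K.isStrictlyPositiveElem_iff]
  constructor
  · let _ := CStarAlgebra.spectralOrder (K ν.H)
    have := CStarAlgebra.spectralOrderedRing (K ν.H)
    rw [← CStarAlgebra.nonneg_iff_eq_star_mul_self]
    refine average_mem (s := Set.Ici (0 : K ν.H)) (convex_Ici 0) isClosed_Ici
      (ν.ad.continuous s) fun g => ?_
    obtain ⟨c, rfl⟩ := hs
    rw [Set.mem_Ici, map_mul, map_star]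
    exact star_mul_self_nonneg _
  · intro ξ hξ
    by_contra hne
    have h1 : ∀ g, Inner.inner ℂ ξ ((ν.ad g s).op ξ) =
        Inner.inner ℂ (ν.U g⁻¹ ξ) (s.op (ν.U g⁻¹ ξ)) :=
      fun g => by
        rw [ν.ad_op, inner_U_left ν g⁻¹, inv_inv]
    have h2 := map_average (K.vecFunctional ξ ξ) (ν.ad.continuous s)
    have h3 : 0 < (average fun g => K.vecFunctional ξ ξ (ν.ad g s)).re := by
      refine average_re_pos ((K.vecFunctional ξ ξ).continuous.comp (ν.ad.continuous s))
        (fun g => ?_) ?_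
      · rw [K.vecFunctional_apply, h1]
        exact (hs' _ ((map_ne_zero_iff _ (ν.U g⁻¹).injective).2 hne)).le
      · rw [K.vecFunctional_apply, h1, inv_one, _root_.map_one]
        exact hs' _ hne
    rw [← h2, K.vecFunctional_apply, hξ, inner_zero_right] at h3
    exact lt_irrefl _ h3

/-- Any two strictly positive invariant compact operators are Cuntz equivalent, as the roles of `s`
and `s'` can be exchanged. For the square roots `t` and `h` of `s` and `s'`, the element `t` is a limit
of elements `h k`, with invariant `k` after averaging. -/
theorem subeq_of_strictlyPositive {ν : SepRep G} {s s' : K ν.H} (hs : IsStrictlyPositiveElem s)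
    (hsi : ∀ g, ν.ad g s = s) (hs' : IsStrictlyPositiveElem s') (hsi' : ∀ g, ν.ad g s' = s') :
    Subeq ν.ad s s' := by
  obtain ⟨t, -, rfl, hti⟩ := exists_invariant_sqrt hs.1 hsi
  obtain ⟨h, hh, rfl, hhi⟩ := exists_invariant_sqrt hs'.1 hsi'
  refine subeq_of_mem_closure (mem_closure_invariant hti hhi ?_)
  have hinj : ∀ ξ, h.op ξ = 0 → ξ = 0 := fun ξ hξ => (K.isStrictlyPositiveElem_iff.1 hs').2 ξ (by
    rw [K.op_mul, mul_apply_eq_comp, hξ, map_zero])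
  have h1 := K.dense_star_mul hinj t
  rwa [hh] at h1

end StrictlyPositiveInvariant

/-! ### Tensor products of representations -/

namespace HTensor

variable {H H' L L' T T' : Type*}
  [NormedAddCommGroup H] [InnerProductSpace ℂ H] [CompleteSpace H]
  [NormedAddCommGroup H'] [InnerProductSpace ℂ H'] [CompleteSpace H']
  [NormedAddCommGroup L] [InnerProductSpace ℂ L] [CompleteSpace L]
  [NormedAddCommGroup L'] [InnerProductSpace ℂ L'] [CompleteSpace L']
  [NormedAddCommGroup T] [InnerProductSpace ℂ T] [CompleteSpace T]
  [NormedAddCommGroup T'] [InnerProductSpace ℂ T'] [CompleteSpace T']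
variable {A : Type*} [NonUnitalCStarAlgebra A]
variable (P : HTensor H L T) (P' : HTensor H' L' T')

theorem K_sandwich_tensK (X X' : H →L[ℂ] H') (Y Y' : L →L[ℂ] L') (s : K H) (k : K L) :
    K.sandwich (P.op P' X Y) (P.op P' X' Y') (P.tensK s k) =
      P'.tensK (K.sandwich X X' s) (K.sandwich Y Y' k) :=
  K.ext fun x => by
    rw [K.sandwich_op, tensK_op, tensK_op, op_adjoint, op_apply_op, op_apply_op]
    rfl

theorem sandwich_leftTens (X X' : H →L[ℂ] H') (Y Y' : L →L[ℂ] L') (s : K H)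
    (x : CTensor (K L) A) :
    sandwich A (P.op P' X Y) (P.op P' X' Y') (P.leftTens A s x) =
      P'.leftTens A (K.sandwich X X' s) (sandwich A Y Y' x) :=
  congrArg (fun f => f x) (show sandwich A (P.op P' X Y) (P.op P' X' Y') ∘L P.leftTens A s =
    P'.leftTens A (K.sandwich X X' s) ∘L sandwich A Y Y' from CTensor.clm_ext fun k a => by
      rw [ContinuousLinearMap.comp_apply, ContinuousLinearMap.comp_apply, leftTens_tmul,
        sandwich_tmul, sandwich_tmul, leftTens_tmul, K_sandwich_tensK])

theorem adA_leftTens (V : H →ₗᵢ[ℂ] H') (W : L →ₗᵢ[ℂ] L') (s : K H) (x : CTensor (K L) A) :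
    adA A (P.isom P' V W) (P.leftTens A s x) = P'.leftTens A (adIsom V s) (adA A W x) := by
  rw [adA_eq_sandwich, adA_eq_sandwich, isom_toCLM, sandwich_leftTens]
  rfl

theorem map_leftTens {B : Type*} [NonUnitalCStarAlgebra B] (ψ : A →⋆ₙₐ[ℂ] B) (s : K H)
    (x : CTensor (K L) A) :
    CTensor.map (NonUnitalStarAlgHom.id ℂ _) ψ (P.leftTens A s x) =
      P.leftTens B s (CTensor.map (NonUnitalStarAlgHom.id ℂ _) ψ x) := by
  have h1 := CTensor.continuous_map (NonUnitalStarAlgHom.id ℂ (K L)) ψ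
  have h2 := CTensor.continuous_map (NonUnitalStarAlgHom.id ℂ (K T)) ψ
  induction x using CTensor.induction_tmul with
  | hc => exact isClosed_eq (by fun_prop) (by fun_prop)
  | h0 => simp
  | hadd x y hx hy => simp only [map_add, hx, hy]
  | h k a => simp

theorem continuous_leftTens : Continuous fun p : K H × CTensor (K L) A => P.leftTens A p.1 p.2 :=
  (LinearMap.mkContinuous₂ (P.leftTensₗ A) 1 fun s x => by
    rw [one_mul]; exact P.norm_leftTens_le s x).continuous₂

end HTensor

section TensorReps

variable {G : Type*} [Group G] [TopologicalSpace G]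
variable {A B : Type*} [NonUnitalCStarAlgebra A] [NonUnitalCStarAlgebra B]
  {α : CAction G A} {β : CAction G B}

namespace SepRep

/-- The Hilbert space of the tensor product of two representations as a Hilbert space tensor
product. -/
def hT (ν μ : SepRep G) : HTensor ν.H μ.H (ν.tensor μ).H := HTensor.completion ν.H μ.H

variable {μ μ' ν ν' : SepRep G}

theorem tensor_U_pure (ν μ : SepRep G) (g : G) (ξ : ν.H) (η : μ.H) :
    (ν.tensor μ).U g ((ν.hT μ).pure ξ η) = (ν.hT μ).pure (ν.U g ξ) (μ.U g η) :=
  tensorIsom_tmul (ν.U g) (μ.U g) ξ η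

theorem tensor_U (ν μ : SepRep G) (g : G) : ((ν.tensor μ).U g).toLinearIsometry =
    (ν.hT μ).isom (ν.hT μ) (ν.U g).toLinearIsometry (μ.U g).toLinearIsometry := by
  have h : ((ν.tensor μ).U g).toLinearIsometry.toContinuousLinearMap =
      ((ν.hT μ).isom (ν.hT μ) (ν.U g).toLinearIsometry
        (μ.U g).toLinearIsometry).toContinuousLinearMap := (ν.hT μ).ext_clm fun ξ η => by
    refine (tensor_U_pure ν μ g ξ η).trans ?_
    rw [HTensor.isom_toCLM, HTensor.op_pure]
    rfl
  exact LinearIsometry.ext fun x => congrArg (fun f => f x) h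

theorem Intertwines.op {X : ν.H →L[ℂ] ν'.H} {Y : μ.H →L[ℂ] μ'.H} (hX : ν.Intertwines ν' X)
    (hY : μ.Intertwines μ' Y) :
    (ν.tensor μ).Intertwines (ν'.tensor μ') ((ν.hT μ).op (ν'.hT μ') X Y) := fun g x => by
  have hX' : X ∘L (ν.U g).toLinearIsometry.toContinuousLinearMap =
    (ν'.U g).toLinearIsometry.toContinuousLinearMap ∘L X := ContinuousLinearMap.ext (hX g)
  have hY' : Y ∘L (μ.U g).toLinearIsometry.toContinuousLinearMap =
    (μ'.U g).toLinearIsometry.toContinuousLinearMap ∘L Y := ContinuousLinearMap.ext (hY g)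
  change (ν.hT μ).op (ν'.hT μ') X Y (((ν.tensor μ).U g).toLinearIsometry.toContinuousLinearMap x) =
    ((ν'.tensor μ').U g).toLinearIsometry.toContinuousLinearMap ((ν.hT μ).op (ν'.hT μ') X Y x)
  rw [tensor_U, tensor_U, HTensor.isom_toCLM, HTensor.isom_toCLM, HTensor.op_apply_op,
    HTensor.op_apply_op, hX', hY']

theorem Intertwines.isom {V : ν.H →ₗᵢ[ℂ] ν'.H} {W : μ.H →ₗᵢ[ℂ] μ'.H}
    (hV : ν.Intertwines ν' V.toContinuousLinearMap)
    (hW : μ.Intertwines μ' W.toContinuousLinearMap) : (ν.tensor μ).Intertwines (ν'.tensor μ')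
      ((ν.hT μ).isom (ν'.hT μ') V W).toContinuousLinearMap := hV.op hW

end SepRep

theorem stabAction_eq (μ : SepRep G) (g : G) (x : CTensor (K μ.H) A) :
    stabAction μ α g x = adA A (μ.U g).toLinearIsometry
      (CTensor.map (NonUnitalStarAlgHom.id ℂ _) (α g) x) :=
  (CTensor.map_map (adIsom (μ.U g).toLinearIsometry) (NonUnitalStarAlgHom.id ℂ A)
    (NonUnitalStarAlgHom.id ℂ (K μ.H)) (α g) x).symm

theorem stabAction_leftTens (ν μ : SepRep G) (g : G) (s : K ν.H) (x : CTensor (K μ.H) A) :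
    stabAction (ν.tensor μ) α g ((ν.hT μ).leftTens A s x) =
      (ν.hT μ).leftTens A (ν.ad g s) (stabAction μ α g x) := by
  rw [stabAction_eq, stabAction_eq, SepRep.tensor_U, HTensor.map_leftTens, HTensor.adA_leftTens]
  rfl

/-! ### The action of the representation semiring -/

/-- The relation `z = s ⊗ x`, defined as the closure of its instances on elementary tensors, is the
graph of the bounded map `leftTens`. -/
theorem isOuterTensor_iff {ν μ : SepRep G} {s : K ν.H} {x : CTensor (K μ.H) A}
    {z : CTensor (K (ν.tensor μ).H) A} :
    IsOuterTensor ν μ s x z ↔ z = (ν.hT μ).leftTens A s x := by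
  have hT : ∀ (k : K μ.H) (T : K (ν.tensor μ).H),
      (∀ ξ η, T.op (ν.pure μ ξ η) = ν.pure μ (s.op ξ) (k.op η)) ↔ T = (ν.hT μ).tensK s k := by
    intro k T
    constructor
    · intro h
      have h1 : T.op = (ν.hT μ).op (ν.hT μ) s.op k.op := (ν.hT μ).ext_clm fun ξ η => by
        rw [HTensor.op_pure]
        exact h ξ η
      exact K.ext fun x => congrArg (fun f => f x) h1
    · rintro rfl ξ η
      exact (ν.hT μ).op_pure (ν.hT μ) s.op k.op ξ η
  constructor
  · intro h
    have hcl : IsClosed {p : CTensor (K μ.H) A × CTensor (K (ν.tensor μ).H) A |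
        p.2 = (ν.hT μ).leftTens A s p.1} :=
      isClosed_eq continuous_snd (((ν.hT μ).leftTens A s).continuous.comp continuous_fst)
    refine closure_minimal (fun p hp => ?_) hcl h
    induction hp using Submodule.span_induction with
    | mem p hp =>
      obtain ⟨k, T, a, hTk, rfl⟩ := hp
      rw [hT] at hTk
      change CTensor.tmul T a = (ν.hT μ).leftTens A s (CTensor.tmul k a)
      rw [HTensor.leftTens_tmul, hTk]
    | zero => exact (map_zero _).symm
    | add p q _ _ hp hq =>
      change p.2 + q.2 = (ν.hT μ).leftTens A s (p.1 + q.1)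
      rw [map_add]
      exact congrArg₂ _ hp hq
    | smul c p _ hp =>
      change c • p.2 = (ν.hT μ).leftTens A s (c • p.1)
      rw [map_smul]
      exact congrArg _ hp
  · rintro rfl
    unfold IsOuterTensor
    induction x using CTensor.induction_tmul with
    | hc =>
      exact (Submodule.isClosed_topologicalClosure _).preimage
        (continuous_id.prodMk ((ν.hT μ).leftTens A s).continuous)
    | h0 => rw [map_zero]; exact Submodule.zero_mem _
    | hadd x y hx hy => rw [map_add]; exact Submodule.add_mem _ hx hy
    | h k a =>
      refine Submodule.le_topologicalClosure _ (Submodule.subset_span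
        ⟨k, (ν.hT μ).tensK s k, a, (hT _ _).2 rfl, ?_⟩)
      rw [HTensor.leftTens_tmul]

/-- The positive invariant element `s ⊗ a`. -/
def PosElem.outer (ν : SepRep G) (s : K ν.H) (hs : ∃ c, s = star c * c) (hsi : ∀ g, ν.ad g s = s)
    (a : PosElem α) : PosElem α where
  rep := ν.tensor a.rep
  val := (ν.hT a.rep).leftTens A s a.val
  pos := by
    obtain ⟨c, rfl⟩ := hs
    obtain ⟨d, hd⟩ := a.pos
    exact ⟨(ν.hT a.rep).leftTens A c d, by rw [HTensor.star_leftTens, HTensor.leftTens_mul, hd]⟩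
  invariant g := by rw [stabAction_leftTens, hsi, a.invariant]

theorem Subeq.leftTens {ν μ : SepRep G} {s s' : K ν.H} {x x' : CTensor (K μ.H) A}
    (hs : Subeq ν.ad s s') (hx : Subeq (stabAction μ α) x x') :
    Subeq (stabAction (ν.tensor μ) α) ((ν.hT μ).leftTens A s x) ((ν.hT μ).leftTens A s' x') := by
  obtain ⟨e, he, helim⟩ := hs
  obtain ⟨d, hd, hdlim⟩ := hx
  refine ⟨fun n => (ν.hT μ).leftTens A (e n) (d n), fun n g => ?_, ?_⟩
  · rw [stabAction_leftTens, he, hd]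
  · refine (((ν.hT μ).continuous_leftTens.tendsto (s, x)).comp
      (helim.prodMk_nhds hdlim)).congr fun n => ?_
    rw [Function.comp_apply, HTensor.star_leftTens, HTensor.leftTens_mul, HTensor.leftTens_mul]

variable [IsTopologicalGroup G] [CompactSpace G] [T2Space G]

/-- Up to Cuntz subequivalence, `s ⊗ a` depends neither on the strictly positive element `s` nor on
the representation within its unitary equivalence class. -/
theorem CuntzLE.outer {ν ν' : SepRep G} (hν : ν.Equivalent ν') {s : K ν.H} {s' : K ν'.H}
    (hs : IsStrictlyPositiveElem s) (hsi : ∀ g, ν.ad g s = s)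
    (hs' : IsStrictlyPositiveElem s') (hsi' : ∀ g, ν'.ad g s' = s') {a a' : PosElem α}
    (h : CuntzLE a a') :
    CuntzLE (PosElem.outer ν s hs.1 hsi a) (PosElem.outer ν' s' hs'.1 hsi' a') := by
  obtain ⟨V, hV⟩ := hν
  rw [cuntzLE_iff (SepRep.intertwines_inl a.rep a'.rep) (SepRep.intertwines_inr a.rep a'.rep)] at h
  have hV' : ν.Intertwines ν' V.toLinearIsometry.toContinuousLinearMap := hV
  refine (cuntzLE_iff (hV'.isom (SepRep.intertwines_inl a.rep a'.rep))
    (SepRep.Intertwines.isom (V := LinearIsometry.id) (SepRep.Intertwines.id ν')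
      (SepRep.intertwines_inr a.rep a'.rep))).2 ?_
  have h1 : Subeq ν'.ad (adIsom V.toLinearIsometry s) s' := by
    refine subeq_of_strictlyPositive (K.isStrictlyPositiveElem_adIsom hs V) (fun g => ?_) hs' hsi'
    have h2 : (adIsom (ν'.U g).toLinearIsometry).comp (adIsom V.toLinearIsometry) =
        (adIsom V.toLinearIsometry).comp (adIsom (ν.U g).toLinearIsometry) := by
      rw [adIsom_comp, adIsom_comp, hV'.isom_comp]
    exact (congrArg (fun f => f s) h2).trans (congrArg (adIsom V.toLinearIsometry) (hsi g))
  have h3 := h1.leftTens h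
  have e1 := (ν.hT a.rep).adA_leftTens (ν'.hT (a.rep.sum a'.rep)) V.toLinearIsometry
    (a.rep.inl a'.rep) s a.val
  have e2 := (ν'.hT a'.rep).adA_leftTens (ν'.hT (a.rep.sum a'.rep)) LinearIsometry.id
    (a.rep.inr a'.rep) s' a'.val
  rw [adIsom_id] at e2
  rw [← e1] at h3
  refine Eq.subst (motive := Subeq _ _) e2.symm h3

theorem SepRep.equivalent_equivalence : Equivalence (SepRep.Equivalent (G := G)) where
  refl ν := ⟨LinearIsometryEquiv.refl ℂ ν.H, fun _ _ => rfl⟩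
  symm := by
    rintro μ ν ⟨V, hV⟩
    exact ⟨V.symm, fun g x => by
      rw [LinearIsometryEquiv.symm_apply_eq, hV, LinearIsometryEquiv.apply_symm_apply]⟩
  trans := by
    rintro μ ν κ ⟨V, hV⟩ ⟨W, hW⟩
    exact ⟨V.trans W, fun g x => by
      rw [LinearIsometryEquiv.trans_apply, LinearIsometryEquiv.trans_apply, hV, hW]⟩

/-- The class of a representation in the representation semiring. -/
def RepSemiring.mk (ν : SepRep G) : RepSemiring G := Quot.mk _ ν

theorem SepRep.equivalent_of_mk_eq {μ ν : SepRep G}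
    (h : RepSemiring.mk μ = RepSemiring.mk ν) : μ.Equivalent ν :=
  SepRep.equivalent_equivalence.eqvGen_iff.1 (Quot.eqvGen_exact h)

theorem isSMul_outer (ν : SepRep G) {s : K ν.H} (hs : IsStrictlyPositiveElem s)
    (hsi : ∀ g, ν.ad g s = s) (a : PosElem α) :
    IsSMul (RepSemiring.mk ν) (CuG.mk a) (CuG.mk (PosElem.outer ν s hs.1 hsi a)) :=
  ⟨ν, a, s, _, (PosElem.outer ν s hs.1 hsi a).pos, (PosElem.outer ν s hs.1 hsi a).invariant,
    rfl, rfl, hs, hsi, isOuterTensor_iff.2 rfl, rfl⟩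

/-- The product `[ν] · [a]` is defined by a choice of `ν`, `a` and `s`, on which it does not
depend. -/
theorem CuG.smul_mk (ν : SepRep G) {s : K ν.H} (hs : IsStrictlyPositiveElem s)
    (hsi : ∀ g, ν.ad g s = s) (a : PosElem α) :
    RepSemiring.mk ν • CuG.mk a = CuG.mk (PosElem.outer ν s hs.1 hsi a) := by
  have h : IsSMul (RepSemiring.mk ν) (CuG.mk a)
      (RepSemiring.mk ν • CuG.mk a) :=
    Classical.epsilon_spec (p := IsSMul (RepSemiring.mk ν) (CuG.mk a))
      ⟨_, isSMul_outer ν hs hsi a⟩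
  obtain ⟨ν', a', s', z, hz, hz', hν, ha, hs', hsi', hout, hmk⟩ := h
  rw [isOuterTensor_iff] at hout
  subst hout
  rw [← hmk]
  have hν' := SepRep.equivalent_of_mk_eq hν
  have ha' := CuG.mk_eq_mk.1 ha
  exact CuG.mk_eq_mk.2 ⟨CuntzLE.outer hν' hs' hsi' hs hsi ha'.1,
    CuntzLE.outer (SepRep.equivalent_equivalence.symm hν') hs hsi hs' hsi' ha'.2⟩

end TensorReps

/-! ### Associativity of Hilbert space tensor products -/

namespace HTensor

variable {H₁ H₂ H₃ T₁₂ T₂₃ T T' E : Type*}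
  [NormedAddCommGroup H₁] [InnerProductSpace ℂ H₁] [CompleteSpace H₁]
  [NormedAddCommGroup H₂] [InnerProductSpace ℂ H₂] [CompleteSpace H₂]
  [NormedAddCommGroup H₃] [InnerProductSpace ℂ H₃] [CompleteSpace H₃]
  [NormedAddCommGroup T₁₂] [InnerProductSpace ℂ T₁₂] [CompleteSpace T₁₂]
  [NormedAddCommGroup T₂₃] [InnerProductSpace ℂ T₂₃] [CompleteSpace T₂₃]
  [NormedAddCommGroup T] [InnerProductSpace ℂ T] [CompleteSpace T]
  [NormedAddCommGroup T'] [InnerProductSpace ℂ T'] [CompleteSpace T']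
variable {A : Type*} [NonUnitalCStarAlgebra A]

/-- The bounded operator `η ↦ ξ ⊗ η`. -/
def creLeft (P : HTensor H₁ H₂ T₁₂) (ξ : H₁) : H₂ →L[ℂ] T₁₂ :=
  (P.pure ξ).mkContinuous ‖ξ‖ fun η => by rw [P.norm_pure]

@[simp]
theorem creLeft_apply (P : HTensor H₁ H₂ T₁₂) (ξ : H₁) (η : H₂) : P.creLeft ξ η = P.pure ξ η := rfl

theorem creLeft_add (P : HTensor H₁ H₂ T₁₂) (ξ ξ' : H₁) :
    P.creLeft (ξ + ξ') = P.creLeft ξ + P.creLeft ξ' := by ext η; simp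

theorem creLeft_smul (P : HTensor H₁ H₂ T₁₂) (c : ℂ) (ξ : H₁) :
    P.creLeft (c • ξ) = c • P.creLeft ξ := by ext η; simp

theorem creLeft_adjoint_comp (P : HTensor H₁ H₂ T₁₂) (ξ ξ' : H₁) :
    (P.creLeft ξ).adjoint ∘L P.creLeft ξ' = (inner ℂ ξ ξ' : ℂ) • ContinuousLinearMap.id ℂ H₂ :=
  ContinuousLinearMap.ext fun η => ext_inner_left ℂ fun ζ => by
    rw [ContinuousLinearMap.comp_apply, ContinuousLinearMap.adjoint_inner_right, creLeft_apply,
      creLeft_apply, P.inner_pure, smul_apply, inner_smul_right]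
    rfl

variable (P : HTensor H₁ H₂ T₁₂) (Q : HTensor T₁₂ H₃ T) (R : HTensor H₂ H₃ T₂₃)

/-- The tensor product `(H₁ ⊗ H₂) ⊗ H₃`, as a tensor product of `H₁` and `H₂ ⊗ H₃`. -/
def assoc : HTensor H₁ T₂₃ T where
  pure :=
    { toFun := fun ξ => (R.op Q (P.creLeft ξ) (ContinuousLinearMap.id ℂ H₃)).toLinearMap
      map_add' := fun ξ ξ' => by rw [creLeft_add, op_add_left]; rfl
      map_smul' := fun c ξ => by rw [creLeft_smul, op_smul_left]; rfl }
  inner_pure ξ ξ' ω ω' := by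
    change inner ℂ (R.op Q (P.creLeft ξ) (ContinuousLinearMap.id ℂ H₃) ω)
      (R.op Q (P.creLeft ξ') (ContinuousLinearMap.id ℂ H₃) ω') = _
    rw [← ContinuousLinearMap.adjoint_inner_right, op_adjoint, op_apply_op, creLeft_adjoint_comp,
      show (ContinuousLinearMap.id ℂ H₃).adjoint = ContinuousLinearMap.id ℂ H₃ from
        star_one (H₃ →L[ℂ] H₃), ContinuousLinearMap.comp_id, op_smul_left, op_id, smul_apply,
      inner_smul_right]
    rfl
  denseRange ζ := by
    have hadd : ∀ f : H₁ ⊗[ℂ] T₂₃ →ₗ[ℂ] T, ∀ x y, x ∈ closure (Set.range f) →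
        y ∈ closure (Set.range f) → x + y ∈ closure (Set.range f) := fun f x y hx hy =>
      map_mem_closure₂ continuous_add hx hy (by
        rintro _ ⟨k, rfl⟩ _ ⟨k', rfl⟩
        exact ⟨k + k', map_add _ _ _⟩)
    induction ζ using Q.induction with
    | hc => exact isClosed_closure
    | h0 => exact subset_closure ⟨0, map_zero _⟩
    | hadd x y hx hy => exact hadd _ x y hx hy
    | h τ ζ =>
      induction τ using P.induction with
      | hc => exact isClosed_closure.preimage (Q.creRight ζ).continuous
      | h0 => rw [map_zero]; exact subset_closure ⟨0, map_zero _⟩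
      | hadd x y hx hy => rw [map_add]; exact hadd _ _ _ hx hy
      | h ξ η =>
        refine subset_closure ⟨ξ ⊗ₜ R.pure η ζ, ?_⟩
        rw [TensorProduct.lift.tmul]
        exact R.op_pure Q _ _ η ζ

@[simp]
theorem assoc_pure_pure (ξ : H₁) (η : H₂) (ζ : H₃) :
    (P.assoc Q R).pure ξ (R.pure η ζ) = Q.pure (P.pure ξ η) ζ := R.op_pure Q _ _ η ζ

theorem ext_clm₃ [NormedAddCommGroup E] [NormedSpace ℂ E] {X Y : T →L[ℂ] E}
    (h : ∀ ξ η ζ, X (Q.pure (P.pure ξ η) ζ) = Y (Q.pure (P.pure ξ η) ζ)) : X = Y := by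
  ext x
  induction x using Q.induction with
  | hc => exact isClosed_eq X.continuous Y.continuous
  | h0 => simp
  | hadd x y hx hy => simp only [map_add, hx, hy]
  | h τ ζ =>
    induction τ using P.induction with
    | hc =>
      exact isClosed_eq (X.continuous.comp (Q.creRight ζ).continuous)
        (Y.continuous.comp (Q.creRight ζ).continuous)
    | h0 => simp
    | hadd x y hx hy => simp only [map_add, LinearMap.add_apply, hx, hy]
    | h ξ η => exact h ξ η ζ

theorem assoc_tensK (s : K H₁) (k : K H₂) (l : K H₃) :
    (P.assoc Q R).tensK s (R.tensK k l) = Q.tensK (P.tensK s k) l := by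
  refine K.ext fun x => congrArg (fun f : T →L[ℂ] T => f x) ?_
  refine P.ext_clm₃ Q fun ξ η ζ => ?_
  rw [tensK_op, tensK_op, tensK_op, ← assoc_pure_pure P Q R, op_pure, tensK_op, op_pure,
    assoc_pure_pure, assoc_pure_pure, op_pure, op_pure]

theorem assoc_leftTens_shuffle (s : K H₁) (x : CTensor (K H₂) (CTensor A (K H₃))) :
    (P.assoc Q R).leftTens A s (R.shuffle A x) = Q.shuffle A (P.leftTens _ s x) :=
  congrArg (fun f => f x) (show (P.assoc Q R).leftTens A s ∘L R.shuffleL A =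
    Q.shuffleL A ∘L P.leftTens _ s from clm_ext₃ fun k a l => by
      rw [ContinuousLinearMap.comp_apply, ContinuousLinearMap.comp_apply, shuffleL_apply,
        shuffleL_apply, leftTens_tmul, shuffle_tmul, shuffle_tmul, leftTens_tmul, assoc_tensK])

end HTensor

/-! ### Absorbing the compact operators -/

section Absorb

variable {G : Type*} [Group G] [TopologicalSpace G]
variable {A B : Type*} [NonUnitalCStarAlgebra A] [NonUnitalCStarAlgebra B]
  {α : CAction G A} {β : CAction G B}

/-- The tensor product `(H_ν ⊗ H_μ) ⊗ H_κ`, as a tensor product of `H_ν` and `H_μ ⊗ H_κ`. -/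
def SepRep.hT₃ (ν μ κ : SepRep G) : HTensor ν.H (μ.tensor κ).H ((ν.tensor μ).tensor κ).H :=
  (ν.hT μ).assoc ((ν.tensor μ).hT κ) (μ.hT κ)

theorem SepRep.tensor_U_hT₃_pure (ν μ κ : SepRep G) (g : G) (ξ : ν.H) (ω : (μ.tensor κ).H) :
    ((ν.tensor μ).tensor κ).U g ((ν.hT₃ μ κ).pure ξ ω) =
      (ν.hT₃ μ κ).pure (ν.U g ξ) ((μ.tensor κ).U g ω) := by
  induction ω using (μ.hT κ).induction with
  | hc =>
    exact isClosed_eq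
      (((ν.tensor μ).tensor κ).U g |>.continuous.comp ((ν.hT₃ μ κ).creLeft ξ).continuous)
      (((ν.hT₃ μ κ).creLeft (ν.U g ξ)).continuous.comp ((μ.tensor κ).U g).continuous)
  | h0 => simp only [_root_.map_zero]
  | hadd x y hx hy => simp only [_root_.map_add, hx, hy]
  | h η ζ =>
    rw [hT₃, HTensor.assoc_pure_pure, tensor_U_pure, tensor_U_pure, tensor_U_pure,
      HTensor.assoc_pure_pure]

/-- The unitary `H_ν ⊗ (H_μ ⊗ H_κ) ≅ (H_ν ⊗ H_μ) ⊗ H_κ`. -/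
def SepRep.assocIsom (ν μ κ : SepRep G) :
    (ν.tensor (μ.tensor κ)).H →ₗᵢ[ℂ] ((ν.tensor μ).tensor κ).H :=
  (ν.hT (μ.tensor κ)).isom (ν.hT₃ μ κ) LinearIsometry.id LinearIsometry.id

theorem SepRep.intertwines_assocIsom (ν μ κ : SepRep G) :
    (ν.tensor (μ.tensor κ)).Intertwines ((ν.tensor μ).tensor κ)
      (ν.assocIsom μ κ).toContinuousLinearMap := fun g x => by
  have h : (ν.assocIsom μ κ).toContinuousLinearMap ∘L
      ((ν.tensor (μ.tensor κ)).U g).toLinearIsometry.toContinuousLinearMap =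
      (((ν.tensor μ).tensor κ).U g).toLinearIsometry.toContinuousLinearMap ∘L
        (ν.assocIsom μ κ).toContinuousLinearMap :=
    (ν.hT (μ.tensor κ)).ext_clm fun ξ ω => by
      change ν.assocIsom μ κ ((ν.tensor (μ.tensor κ)).U g ((ν.hT (μ.tensor κ)).pure ξ ω)) =
        ((ν.tensor μ).tensor κ).U g (ν.assocIsom μ κ ((ν.hT (μ.tensor κ)).pure ξ ω))
      rw [tensor_U_pure, assocIsom, HTensor.isom_pure, HTensor.isom_pure]
      exact (tensor_U_hT₃_pure ν μ κ g ξ ω).symm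
  exact congrArg (fun f => f x) h

variable {κ : SepRep G} {γ : CAction G (K κ.H)}

/-- Regrouping is equivariant. The hypothesis `hγ` says that `γ = Ad(κ)`; it is an equation between
values, so that the same results apply to the trivial action on `K(L)`, which is `Ad` of the trivial
representation only up to a propositional equality. -/
theorem shuffle_stabAction (hγ : ∀ g, γ g = adIsom (κ.U g).toLinearIsometry) (ν : SepRep G) (g : G)
    (z : CTensor (K ν.H) (CTensor A (K κ.H))) :
    (ν.hT κ).shuffle A (stabAction ν (α.tensor γ) g z) =
      stabAction (ν.tensor κ) α g ((ν.hT κ).shuffle A z) :=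
  congrArg (fun f => f z) (show (ν.hT κ).shuffleL A ∘L (stabAction ν (α.tensor γ)).clm g =
    (stabAction (ν.tensor κ) α).clm g ∘L (ν.hT κ).shuffleL A from HTensor.clm_ext₃ fun s a k => by
      rw [ContinuousLinearMap.comp_apply, ContinuousLinearMap.comp_apply, CAction.clm_apply,
        CAction.clm_apply, HTensor.shuffleL_apply, HTensor.shuffleL_apply, stabAction_tmul,
        HTensor.shuffle_tmul, stabAction_tmul]
      change (ν.hT κ).shuffle A (CTensor.tmul _ (CTensor.map (α g) (γ g) (CTensor.tmul a k))) = _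
      rw [CTensor.map_tmul, HTensor.shuffle_tmul, hγ]
      congr 1
      change _ = adIsom ((ν.tensor κ).U g).toLinearIsometry _
      rw [SepRep.tensor_U]
      exact ((ν.hT κ).K_sandwich_tensK (ν.hT κ) _ _ _ _ s k).symm)

theorem subeq_shuffle_iff (hγ : ∀ g, γ g = adIsom (κ.U g).toLinearIsometry) {ν : SepRep G}
    {x y : CTensor (K ν.H) (CTensor A (K κ.H))} :
    Subeq (stabAction (ν.tensor κ) α) ((ν.hT κ).shuffle A x) ((ν.hT κ).shuffle A y) ↔
      Subeq (stabAction ν (α.tensor γ)) x y := by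
  constructor
  · rintro ⟨d, hd, hlim⟩
    refine ⟨fun n => ((ν.hT κ).shuffleEquiv A).symm (d n), fun n g => ?_, ?_⟩
    · apply (ν.hT κ).shuffle_bijective.1
      rw [shuffle_stabAction hγ, HTensor.shuffle_symm_apply, hd]
    · have h1 := ((ν.hT κ).continuous_shuffle_symm (A := A)).tendsto _ |>.comp hlim
      rw [HTensor.symm_shuffle_apply] at h1
      refine h1.congr fun n => ?_
      rw [Function.comp_apply, map_mul, map_mul, map_star, HTensor.symm_shuffle_apply]
  · rintro ⟨d, hd, hlim⟩
    refine ⟨fun n => (ν.hT κ).shuffle A (d n), fun n g => ?_, ?_⟩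
    · rw [← shuffle_stabAction hγ, hd]
    · refine (((ν.hT κ).continuous_shuffle (A := A)).tendsto _ |>.comp hlim).congr fun n => ?_
      rw [Function.comp_apply, map_mul, map_mul, map_star]

/-- The positive element of `K(H_ν ⊗ H_κ) ⊗ A` given by one of `K(H_ν) ⊗ (A ⊗ K(H_κ))`. -/
def PosElem.shuffle (hγ : ∀ g, γ g = adIsom (κ.U g).toLinearIsometry) (a : PosElem (α.tensor γ)) :
    PosElem α where
  rep := a.rep.tensor κ
  val := (a.rep.hT κ).shuffle A a.val
  pos := by
    obtain ⟨c, hc⟩ := a.pos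
    exact ⟨(a.rep.hT κ).shuffle A c, by rw [hc, map_mul, map_star]⟩
  invariant g := by rw [← shuffle_stabAction hγ, a.invariant]

theorem cuntzLE_shuffle_iff (hγ : ∀ g, γ g = adIsom (κ.U g).toLinearIsometry)
    {a b : PosElem (α.tensor γ)} : CuntzLE (a.shuffle hγ) (b.shuffle hγ) ↔ CuntzLE a b := by
  rw [cuntzLE_iff (SepRep.intertwines_inl a.rep b.rep) (SepRep.intertwines_inr a.rep b.rep),
    ← subeq_shuffle_iff hγ, (a.rep.hT κ).shuffle_adA ((a.rep.sum b.rep).hT κ),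
    (b.rep.hT κ).shuffle_adA ((a.rep.sum b.rep).hT κ)]
  exact cuntzLE_iff
    (SepRep.Intertwines.isom (W := LinearIsometry.id) (SepRep.intertwines_inl a.rep b.rep)
      (SepRep.Intertwines.id κ))
    (SepRep.Intertwines.isom (W := LinearIsometry.id) (SepRep.intertwines_inr a.rep b.rep)
      (SepRep.Intertwines.id κ))

/-- The map `Cu^G(A ⊗ K(H_κ)) → Cu^G(A)` which regards positive elements of
`K(H_ν) ⊗ (A ⊗ K(H_κ))` as positive elements of `K(H_ν ⊗ H_κ) ⊗ A`. -/
def CuG.absorb (hγ : ∀ g, γ g = adIsom (κ.U g).toLinearIsometry) : CuG (α.tensor γ) → CuG α :=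
  Quot.map (ra := CuntzEquiv) (rb := CuntzEquiv) (PosElem.shuffle hγ)
    fun _ _ h => ⟨(cuntzLE_shuffle_iff hγ).2 h.1, (cuntzLE_shuffle_iff hγ).2 h.2⟩

theorem CuG.absorb_mk (hγ : ∀ g, γ g = adIsom (κ.U g).toLinearIsometry) (a : PosElem (α.tensor γ)) :
    absorb hγ (mk a) = mk (a.shuffle hγ) := rfl

theorem CuG.absorb_le_absorb (hγ : ∀ g, γ g = adIsom (κ.U g).toLinearIsometry)
    (x y : CuG (α.tensor γ)) : absorb hγ x ≤ absorb hγ y ↔ x ≤ y := by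
  obtain ⟨a, rfl⟩ := mk_surjective x
  obtain ⟨b, rfl⟩ := mk_surjective y
  rw [absorb_mk, absorb_mk, mk_le_mk, mk_le_mk, cuntzLE_shuffle_iff]

theorem CuG.absorb_injective (hγ : ∀ g, γ g = adIsom (κ.U g).toLinearIsometry) :
    Function.Injective (absorb (α := α) hγ) := fun x y h =>
  CuG.le_antisymm ((absorb_le_absorb hγ x y).1 (h ▸ CuG.le_refl _))
    ((absorb_le_absorb hγ y x).1 (h ▸ CuG.le_refl _))

theorem CuG.absorb_zero (hγ : ∀ g, γ g = adIsom (κ.U g).toLinearIsometry) :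
    absorb (α := α) hγ 0 = 0 := by
  refine mk_eq_mk.2 (cuntzEquiv_of_adA_eq (SepRep.intertwines_inl _ _)
    (SepRep.intertwines_inr _ _) ?_)
  have h1 : ((PosElem.zero (α.tensor γ)).shuffle hγ).val = 0 := map_zero _
  have h2 : (PosElem.zero α).val = 0 := rfl
  rw [h1, h2, map_zero, map_zero]

theorem HTensor.inner_isom_eq_zero {H₁ H₂ H L T₁ T₂ T : Type*}
    [NormedAddCommGroup H₁] [InnerProductSpace ℂ H₁] [CompleteSpace H₁]
    [NormedAddCommGroup H₂] [InnerProductSpace ℂ H₂] [CompleteSpace H₂]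
    [NormedAddCommGroup H] [InnerProductSpace ℂ H] [CompleteSpace H]
    [NormedAddCommGroup L] [InnerProductSpace ℂ L] [CompleteSpace L]
    [NormedAddCommGroup T₁] [InnerProductSpace ℂ T₁] [CompleteSpace T₁]
    [NormedAddCommGroup T₂] [InnerProductSpace ℂ T₂] [CompleteSpace T₂]
    [NormedAddCommGroup T] [InnerProductSpace ℂ T] [CompleteSpace T]
    (P₁ : HTensor H₁ L T₁) (P₂ : HTensor H₂ L T₂) (P : HTensor H L T) {V : H₁ →ₗᵢ[ℂ] H}
    {W : H₂ →ₗᵢ[ℂ] H} (h : ∀ x y, inner ℂ (V x) (W y) = 0) (x : T₁) (y : T₂) :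
    inner ℂ (P₁.isom P V LinearIsometry.id x) (P₂.isom P W LinearIsometry.id y) = 0 := by
  change inner ℂ ((P₁.isom P V LinearIsometry.id).toContinuousLinearMap x)
    ((P₂.isom P W LinearIsometry.id).toContinuousLinearMap y) = 0
  rw [← ContinuousLinearMap.adjoint_inner_right, isom_toCLM, isom_toCLM, op_adjoint, op_apply_op,
    adjoint_comp_eq_zero h]
  have h0 := P₂.op_smul_left P₁ 0 (0 : H₂ →L[ℂ] H₁)
    ((LinearIsometry.id : L →ₗᵢ[ℂ] L).toContinuousLinearMap.adjoint ∘L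
      (LinearIsometry.id : L →ₗᵢ[ℂ] L).toContinuousLinearMap)
  rw [zero_smul, zero_smul] at h0
  rw [h0, zero_apply, inner_zero_right]

theorem CuG.absorb_add (hγ : ∀ g, γ g = adIsom (κ.U g).toLinearIsometry)
    (x y : CuG (α.tensor γ)) : absorb hγ (x + y) = absorb hγ x + absorb hγ y := by
  obtain ⟨a, rfl⟩ := mk_surjective x
  obtain ⟨b, rfl⟩ := mk_surjective y
  rw [mk_add_mk, absorb_mk, absorb_mk, absorb_mk, mk_add_mk, mk_eq_mk]
  refine cuntzEquiv_sum (c := (a.sum b).shuffle hγ) (a := a.shuffle hγ) (b := b.shuffle hγ)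
    (lam := (a.rep.sum b.rep).tensor κ) (U := LinearIsometry.id)
    (SepRep.Intertwines.isom (W := LinearIsometry.id) (SepRep.intertwines_inl a.rep b.rep)
      (SepRep.Intertwines.id κ))
    (SepRep.Intertwines.isom (W := LinearIsometry.id) (SepRep.intertwines_inr a.rep b.rep)
      (SepRep.Intertwines.id κ)) (SepRep.Intertwines.id _)
    (HTensor.inner_isom_eq_zero (a.rep.hT κ) (b.rep.hT κ) ((a.rep.sum b.rep).hT κ)
      (a.rep.inner_inl_inr b.rep)) ?_
  refine (adA_id _).trans ?_
  change ((a.rep.sum b.rep).hT κ).shuffle A (adA _ (a.rep.inl b.rep) a.val +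
    adA _ (a.rep.inr b.rep) b.val) = _
  rw [map_add, (a.rep.hT κ).shuffle_adA ((a.rep.sum b.rep).hT κ),
    (b.rep.hT κ).shuffle_adA ((a.rep.sum b.rep).hT κ)]
  rfl

variable [IsTopologicalGroup G] [CompactSpace G] [T2Space G]

/-- Both `(s ⊗ a)` regrouped and `s ⊗ (a regrouped)` are the same element, up to the associativity
unitary of Hilbert space tensor products. -/
theorem CuG.absorb_smul (hγ : ∀ g, γ g = adIsom (κ.U g).toLinearIsometry) (r : RepSemiring G)
    (x : CuG (α.tensor γ)) : absorb hγ (r • x) = r • absorb hγ x := by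
  obtain ⟨a, rfl⟩ := mk_surjective x
  obtain ⟨ν, rfl⟩ := Quot.exists_rep r
  obtain ⟨s, hs, hsi⟩ := ν.exists_strictlyPositive
  refine (congrArg (absorb hγ) (smul_mk ν hs hsi a)).trans (Eq.trans ?_
    (smul_mk ν hs hsi (a.shuffle hγ)).symm)
  refine mk_eq_mk.2 (cuntzEquiv_of_adA_eq
    (a := (PosElem.outer ν s hs.1 hsi a).shuffle hγ)
    (b := PosElem.outer ν s hs.1 hsi (a.shuffle hγ)) (V := LinearIsometry.id)
    (SepRep.Intertwines.id _) (ν.intertwines_assocIsom a.rep κ) ?_)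
  refine (adA_id _).trans ?_
  refine ((ν.hT a.rep).assoc_leftTens_shuffle ((ν.tensor a.rep).hT κ) (a.rep.hT κ) s
    a.val).symm.trans ?_
  have h := (ν.hT (a.rep.tensor κ)).adA_leftTens (ν.hT₃ a.rep κ) LinearIsometry.id
    LinearIsometry.id s ((a.rep.hT κ).shuffle A a.val)
  rw [adIsom_id, adA_id] at h
  exact h.symm

end Absorb

/-! ### Conjugate representations and surjectivity of the absorption map -/

/-- The conjugate of a Hilbert space: the same additive group, with conjugate scalar
multiplication. -/
def ConjSpace (H : Type*) : Type _ := H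

namespace ConjSpace

variable {H : Type*} [NormedAddCommGroup H] [InnerProductSpace ℂ H]

instance : NormedAddCommGroup (ConjSpace H) := inferInstanceAs (NormedAddCommGroup H)

instance : Module ℂ (ConjSpace H) := Module.compHom H (starRingEnd ℂ)

/-- A vector, as an element of the conjugate Hilbert space. -/
def of (x : H) : ConjSpace H := x

/-- An element of the conjugate Hilbert space, as a vector. -/
def un (x : ConjSpace H) : H := x

theorem un_smul (c : ℂ) (x : ConjSpace H) : un (c • x) = starRingEnd ℂ c • un x := rfl

theorem un_add (x y : ConjSpace H) : un (x + y) = un x + un y := rfl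

instance : InnerProductSpace ℂ (ConjSpace H) where
  norm_smul_le c x := by
    refine (norm_smul_le (starRingEnd ℂ c) (un x)).trans ?_
    rw [RCLike.norm_conj]
    rfl
  inner x y := Inner.inner ℂ (un y) (un x)
  norm_sq_eq_re_inner x := InnerProductSpace.norm_sq_eq_re_inner (𝕜 := ℂ) (un x)
  conj_inner_symm x y := InnerProductSpace.conj_inner_symm (𝕜 := ℂ) (un y) (un x)
  add_left x y z := by rw [un_add, inner_add_right]
  smul_left x y c := by rw [un_smul, inner_smul_right]

theorem inner_def (x y : ConjSpace H) : Inner.inner ℂ x y = Inner.inner ℂ (un y) (un x) := rfl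

instance [CompleteSpace H] : CompleteSpace (ConjSpace H) := inferInstanceAs (CompleteSpace H)

instance [TopologicalSpace.SeparableSpace H] : TopologicalSpace.SeparableSpace (ConjSpace H) :=
  inferInstanceAs (TopologicalSpace.SeparableSpace H)

/-- A unitary on a Hilbert space, as a unitary on the conjugate Hilbert space. -/
def congr (U : H ≃ₗᵢ[ℂ] H) : ConjSpace H ≃ₗᵢ[ℂ] ConjSpace H where
  toFun x := of (U (un x))
  invFun x := of (U.symm (un x))
  left_inv x := U.symm_apply_apply (un x)
  right_inv x := U.apply_symm_apply (un x)
  map_add' x y := U.map_add (un x) (un y)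
  map_smul' c x := U.map_smul (starRingEnd ℂ c) (un x)
  norm_map' x := U.norm_map (un x)

end ConjSpace

section Absorb

variable {G : Type*} [Group G] [TopologicalSpace G]
variable {A B : Type*} [NonUnitalCStarAlgebra A] [NonUnitalCStarAlgebra B]
  {α : CAction G A} {β : CAction G B}

/-- The conjugate representation. -/
def SepRep.conj (κ : SepRep G) : SepRep G where
  H := ConjSpace κ.H
  U :=
    { toFun := fun g => ConjSpace.congr (κ.U g)
      map_one' := by rw [_root_.map_one]; rfl
      map_mul' := fun g h => by rw [_root_.map_mul]; rfl }
  continuous ξ := κ.continuous (ConjSpace.un ξ)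

section
variable [IsTopologicalGroup G] [CompactSpace G] [T2Space G]

/-- The tensor product of a nonzero representation with its conjugate has an invariant unit
vector: the average of the orbit of `ē ⊗ e`. -/
theorem SepRep.exists_invariant_vector (κ : SepRep G) [Nontrivial κ.H] :
    ∃ v : (κ.conj.tensor κ).H, ‖v‖ = 1 ∧ ∀ g, (κ.conj.tensor κ).U g v = v := by
  obtain ⟨e, he⟩ := exists_ne (0 : κ.H)
  let w : (κ.conj.tensor κ).H := (κ.conj.hT κ).pure (ConjSpace.of e) e
  let v : (κ.conj.tensor κ).H := average fun g => (κ.conj.tensor κ).U g w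
  have hcont := (κ.conj.tensor κ).continuous w
  have hinv : ∀ g, (κ.conj.tensor κ).U g v = v := fun h => by
    have h1 := map_average ((κ.conj.tensor κ).U h).toLinearIsometry.toContinuousLinearMap hcont
    refine h1.trans ((congrArg average (funext fun g => ?_)).trans
      (average_mul_left (fun g => (κ.conj.tensor κ).U g w) h))
    change (κ.conj.tensor κ).U h ((κ.conj.tensor κ).U g w) = (κ.conj.tensor κ).U (h * g) w
    rw [_root_.map_mul]
    rfl
  have hv : v ≠ 0 := by
    intro h0
    have h1 := map_average (innerSL ℂ w) hcont
    have h2 : ∀ g, (innerSL ℂ w) ((κ.conj.tensor κ).U g w) =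
        ((‖(Inner.inner ℂ e (κ.U g e) : ℂ)‖ ^ 2 : ℝ) : ℂ) := fun g => by
      have hw : (κ.conj.tensor κ).U g w = (κ.conj.hT κ).pure _ _ := tensor_U_pure κ.conj κ g _ _
      rw [innerSL_apply_apply, hw]
      refine ((κ.conj.hT κ).inner_pure _ _ _ _).trans ?_
      change Inner.inner ℂ (κ.U g e) e * Inner.inner ℂ e (κ.U g e) = _
      rw [← inner_conj_symm (κ.U g e) e, RCLike.conj_mul]
      norm_cast
    have h3 : 0 < (average fun g => (innerSL ℂ w) ((κ.conj.tensor κ).U g w)).re := by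
      refine average_re_pos ((innerSL ℂ w).continuous.comp hcont) (fun g => ?_) ?_
      · rw [h2, Complex.ofReal_re]
        positivity
      · rw [h2, Complex.ofReal_re, _root_.map_one]
        have : (Inner.inner ℂ e e : ℂ) ≠ 0 := inner_self_ne_zero.2 he
        exact pow_pos (norm_pos_iff.2 this) 2
    rw [← h1] at h3
    change 0 < (innerSL ℂ w v).re at h3
    rw [h0, _root_.map_zero] at h3
    exact lt_irrefl _ h3
  have hn : ‖v‖ ≠ 0 := norm_ne_zero_iff.2 hv
  refine ⟨(‖v‖⁻¹ : ℂ) • v, ?_, fun g => ?_⟩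
  · rw [norm_smul, norm_inv, Complex.norm_real, norm_norm, inv_mul_cancel₀ hn]
  · rw [LinearIsometryEquiv.map_smul, hinv]

variable {κ : SepRep G} {γ : CAction G (K κ.H)}

/-- Every representation `λ` is contained in `(λ ⊗ κ̄) ⊗ κ`, so that the absorption map reaches
every class. -/
theorem CuG.absorb_surjective [Nontrivial κ.H]
    (hγ : ∀ g, γ g = adIsom (κ.U g).toLinearIsometry) :
    Function.Surjective (absorb (α := α) hγ) := by
  intro y
  obtain ⟨b, rfl⟩ := mk_surjective y
  obtain ⟨v, hv, hinv⟩ := κ.exists_invariant_vector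
  let J : b.rep.H →ₗᵢ[ℂ] ((b.rep.tensor κ.conj).tensor κ).H :=
    { toLinearMap := ((b.rep.hT₃ κ.conj κ).creRight v).toLinearMap
      norm_map' := fun x => by
        change ‖(b.rep.hT₃ κ.conj κ).pure x v‖ = ‖x‖
        rw [HTensor.norm_pure, hv, mul_one] }
  have hJ : b.rep.Intertwines ((b.rep.tensor κ.conj).tensor κ) J.toContinuousLinearMap :=
    fun g x => by
      change (b.rep.hT₃ κ.conj κ).pure (b.rep.U g x) v =
        ((b.rep.tensor κ.conj).tensor κ).U g ((b.rep.hT₃ κ.conj κ).pure x v)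
      rw [SepRep.tensor_U_hT₃_pure, hinv]
  let P := (b.rep.tensor κ.conj).hT κ
  let a : PosElem (α.tensor γ) :=
    { rep := b.rep.tensor κ.conj
      val := (P.shuffleEquiv A).symm (adA A J b.val)
      pos := by
        obtain ⟨c, hc⟩ := b.pos
        exact ⟨(P.shuffleEquiv A).symm (adA A J c), by rw [hc, map_mul, map_star, map_mul, map_star]⟩
      invariant := fun g => by
        apply P.shuffle_bijective.1
        rw [shuffle_stabAction hγ, HTensor.shuffle_symm_apply]
        exact stabAction_adA_val b hJ g }
  refine ⟨mk a, mk_eq_mk.2 (cuntzEquiv_of_adA_eq (a := a.shuffle hγ) (b := b)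
    (V := LinearIsometry.id) (W := J) (SepRep.Intertwines.id _) hJ ?_)⟩
  exact (adA_id _).trans (P.shuffle_symm_apply _)

/-- Absorption as a bijection. -/
def CuG.absorbEquiv [Nontrivial κ.H] (hγ : ∀ g, γ g = adIsom (κ.U g).toLinearIsometry) :
    CuG (α.tensor γ) ≃ CuG α :=
  Equiv.ofBijective (absorb hγ) ⟨absorb_injective hγ, absorb_surjective hγ⟩

end

/-! ### Naturality -/

variable {κ : SepRep G} {γ : CAction G (K κ.H)}

theorem CuG.absorb_map (hγ : ∀ g, γ g = adIsom (κ.U g).toLinearIsometry) (ψ : EquivHom α β)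
    (x : CuG (α.tensor γ)) :
    absorb hγ (CuG.map (ψ.tensorId γ) x) = CuG.map ψ (absorb hγ x) := by
  obtain ⟨a, rfl⟩ := mk_surjective x
  refine congrArg mk ?_
  have h := (a.rep.hT κ).map_shuffle ψ.toHom a.val
  unfold PosElem.shuffle EquivHom.mapPos
  congr 1
  exact h.symm

/-! ### Rank one projections -/

theorem IsRankOneProjection.exists_eq_rankOne {H : Type*} [NormedAddCommGroup H]
    [InnerProductSpace ℂ H] [CompleteSpace H] {q : K H} (hq : IsRankOneProjection q) :
    ∃ e : H, ‖e‖ = 1 ∧ q = K.rankOne e e := by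
  obtain ⟨⟨hidem, hsa⟩, hrank⟩ := hq
  obtain ⟨⟨w, hw⟩, hw0, hspan⟩ := finrank_eq_one_iff'.1 hrank
  have hw0' : w ≠ 0 := fun h => hw0 (Subtype.ext h)
  have hn : (‖w‖ : ℂ) ≠ 0 := by exact_mod_cast norm_ne_zero_iff.2 hw0'
  have hqq : ∀ x, q.op (q.op x) = q.op x := fun x => congrArg (fun k : K H => k.op x) hidem.eq
  obtain ⟨y, hy⟩ := hw
  have hqw : q.op w = w := by
    rw [← hy]
    exact hqq y
  refine ⟨(‖w‖⁻¹ : ℂ) • w, ?_, K.ext fun x => ?_⟩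
  · rw [norm_smul, norm_inv, Complex.norm_real, norm_norm,
      inv_mul_cancel₀ (norm_ne_zero_iff.2 hw0')]
  · obtain ⟨c, hc⟩ := hspan ⟨q.op x, ⟨x, rfl⟩⟩
    have hc' : c • w = q.op x := congrArg Subtype.val hc
    have h1 : inner ℂ w x = inner ℂ w (q.op x) := by
      have h2 : star q.op = q.op := congrArg K.op hsa.star_eq
      rw [← ContinuousLinearMap.adjoint_inner_left, ← ContinuousLinearMap.star_eq_adjoint, h2, hqw]
    rw [K.rankOne_op, inner_smul_left, h1, ← hc', inner_smul_right, inner_self_eq_norm_sq_to_K,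
      smul_smul]
    congr 1
    simp
    field_simp

theorem IsRankOneProjection.nontrivial {H : Type*} [NormedAddCommGroup H]
    [InnerProductSpace ℂ H] [CompleteSpace H] {q : K H} (hq : IsRankOneProjection q) :
    Nontrivial H := by
  obtain ⟨e, he, -⟩ := hq.exists_eq_rankOne
  exact ⟨e, 0, fun h => by simp [h] at he⟩

section Corner

variable {L : Type} [NormedAddCommGroup L] [InnerProductSpace ℂ L] [CompleteSpace L]
  [TopologicalSpace.SeparableSpace L]

theorem trivial_eq_adIsom (g : G) : (CAction.trivial (K L) : CAction G (K L)) g =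
    adIsom (((SepRep.trivial L : SepRep G).U g).toLinearIsometry) := adIsom_id.symm

theorem HTensor.shuffle_map_corner {H T : Type*} [NormedAddCommGroup H] [InnerProductSpace ℂ H]
    [CompleteSpace H] [NormedAddCommGroup T] [InnerProductSpace ℂ T] [CompleteSpace T]
    (P : HTensor H L T) {e : L} {q : K L} (hqe : q = K.rankOne e e) (hq : IsStarProjection q)
    (W : H →ₗᵢ[ℂ] T) (hW : ∀ ξ, W ξ = P.pure ξ e) (z : CTensor (K H) A) :
    P.shuffle A (CTensor.map (NonUnitalStarAlgHom.id ℂ _) (EquivHom.cornerHom A hq) z) =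
      adA A W z := by
  have h1 := CTensor.continuous_map (NonUnitalStarAlgHom.id ℂ (K H)) (EquivHom.cornerHom A hq)
  have h2 := P.continuous_shuffle (A := A)
  have h3 := continuous_adA (A := A) W
  induction z using CTensor.induction_tmul with
  | hc => exact isClosed_eq (by fun_prop) (by fun_prop)
  | h0 => simp only [map_zero]
  | hadd x y hx hy => simp only [map_add, hx, hy]
  | h s a =>
    rw [CTensor.map_tmul, adA_tmul]
    change P.shuffle A (CTensor.tmul s (CTensor.tmul a q)) = _
    rw [shuffle_tmul]
    congr 1
    refine K.ext fun x => congrArg (fun f : T →L[ℂ] T => f x) (P.ext_clm fun ξ η => ?_)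
    rw [tensK_op, op_pure, hqe, K.rankOne_op, adIsom_op]
    have h4 : W.toContinuousLinearMap.adjoint (P.pure ξ η) = (inner ℂ e η : ℂ) • ξ := by
      refine ext_inner_left ℂ fun ζ => ?_
      rw [ContinuousLinearMap.adjoint_inner_right]
      change inner ℂ (W ζ) _ = _
      rw [hW, P.inner_pure, inner_smul_right, mul_comm]
    rw [h4, hW, map_smul, map_smul, map_smul]
    rfl

/-- The absorption map for a trivial representation is left inverse to the corner inclusion. -/
theorem CuG.absorb_map_corner {q : K L} (hq : IsRankOneProjection q) (x : CuG α) :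
    absorb (κ := SepRep.trivial L) trivial_eq_adIsom (CuG.map (EquivHom.corner α hq.1) x) = x := by
  obtain ⟨a, rfl⟩ := mk_surjective x
  obtain ⟨e, he, hqe⟩ := hq.exists_eq_rankOne
  let P := a.rep.hT (SepRep.trivial L)
  let W : a.rep.H →ₗᵢ[ℂ] (a.rep.tensor (SepRep.trivial L)).H :=
    { toLinearMap := (P.creRight e).toLinearMap
      norm_map' := fun x => by
        change ‖P.pure x e‖ = ‖x‖
        exact (P.norm_pure x e).trans ((congrArg (‖x‖ * ·) he).trans (mul_one _)) }
  have hW : a.rep.Intertwines (a.rep.tensor (SepRep.trivial L)) W.toContinuousLinearMap :=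
    fun g x => (SepRep.tensor_U_pure a.rep (SepRep.trivial L) g x e).symm
  refine mk_eq_mk.2 (cuntzEquiv_of_adA_eq
    (a := ((EquivHom.corner α hq.1).mapPos a).shuffle (κ := SepRep.trivial L) trivial_eq_adIsom)
    (b := a) (V := LinearIsometry.id) (W := W) (SepRep.Intertwines.id _) hW ?_)
  exact (adA_id _).trans (P.shuffle_map_corner hqe hq.1 W (fun _ => rfl) a.val)

end Corner

end Absorb

/-! ### Twisted invariant elements -/

section Mixed

variable {H₁ H₂ : Type*} [NormedAddCommGroup H₁] [InnerProductSpace ℂ H₁] [CompleteSpace H₁]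
  [NormedAddCommGroup H₂] [InnerProductSpace ℂ H₂] [CompleteSpace H₂]
variable {A : Type*} [NonUnitalCStarAlgebra A]

theorem sandwich_map_sandwich {u₁ v₁ : H₁ →L[ℂ] H₁} {u₂ v₂ : H₂ →L[ℂ] H₂} {X Y : H₁ →L[ℂ] H₂}
    (hX : u₂ ∘L X = X ∘L u₁) (hY : v₂ ∘L Y = Y ∘L v₁) (σ : A →⋆ₙₐ[ℂ] A) (z : CTensor (K H₁) A) :
    sandwich A u₂ v₂ (CTensor.map (NonUnitalStarAlgHom.id ℂ _) σ (sandwich A X Y z)) =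
      sandwich A X Y (sandwich A u₁ v₁ (CTensor.map (NonUnitalStarAlgHom.id ℂ _) σ z)) := by
  rw [map_sandwich, sandwich_sandwich, sandwich_sandwich, hX, hY]

end Mixed

section Twisted

variable {G : Type*} [Group G] [TopologicalSpace G]
variable {A : Type*} [NonUnitalCStarAlgebra A] {α : CAction G A}

/-- The unitary of a group element as a bounded operator. -/
def SepRep.opU (ν : SepRep G) (g : G) : ν.H →L[ℂ] ν.H :=
  (ν.U g).toLinearIsometry.toContinuousLinearMap

theorem SepRep.opU_tensor (ν μ : SepRep G) (g : G) :
    (ν.tensor μ).opU g = (ν.hT μ).op (ν.hT μ) (ν.opU g) (μ.opU g) := by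
  rw [opU, tensor_U]
  rfl

theorem SepRep.Intertwines.comp_opU {μ ν : SepRep G} {X : μ.H →L[ℂ] ν.H} (hX : μ.Intertwines ν X)
    (g : G) : ν.opU g ∘L X = X ∘L μ.opU g := ContinuousLinearMap.ext fun x => (hX g x).symm

theorem stabAction_eq_sandwich (μ : SepRep G) (g : G) (x : CTensor (K μ.H) A) :
    stabAction μ α g x = sandwich A (μ.opU g) (μ.opU g)
      (CTensor.map (NonUnitalStarAlgHom.id ℂ _) (α g) x) := by
  rw [stabAction_eq, adA_eq_sandwich]
  rfl

/-- Invariance of `z` under the operators `z ↦ (ν_g ⊗ μ_g) α_g(z) (ν_g ⊗ 1)*`: equivariance from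
`H_ν ⊗ H_μ`, with the trivial representation on `H_μ`, to `H_ν ⊗ H_μ`, with the representation `μ`. -/
def IsMixedInvariant (α : CAction G A) (ν μ : SepRep G) (z : CTensor (K (ν.tensor μ).H) A) : Prop :=
  ∀ g, sandwich A ((ν.tensor μ).opU g)
    ((ν.hT μ).op (ν.hT μ) (ν.opU g) (ContinuousLinearMap.id ℂ μ.H))
    (CTensor.map (NonUnitalStarAlgHom.id ℂ _) (α g) z) = z

/-- Twisted invariance, defined as the closure of a relation on elementary tensors, becomes invariance
under a family of bounded operators after regrouping. -/
theorem isTwistedInvariant_iff {μ ν : SepRep G} {d : CTensor (K ν.H) (CTensor A (K μ.H))} :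
    IsTwistedInvariant α μ ν d ↔ IsMixedInvariant α ν μ ((ν.hT μ).shuffle A d) := by
  let P := ν.hT μ
  let F : G → CTensor (K (ν.tensor μ).H) A → CTensor (K (ν.tensor μ).H) A := fun g z =>
    sandwich A ((ν.tensor μ).opU g) (P.op P (ν.opU g) (ContinuousLinearMap.id ℂ μ.H))
      (CTensor.map (NonUnitalStarAlgHom.id ℂ _) (α g) z)
  have hFc : ∀ g, Continuous (F g) := fun g =>
    (ContinuousLinearMap.continuous _).comp (CTensor.continuous_map _ _)
  have hF : ∀ g (x : K ν.H) (a : A) (k k' : K μ.H), (∀ ξ, k'.op ξ = μ.U g (k.op ξ)) →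
      F g (P.shuffle A (CTensor.tmul x (CTensor.tmul a k))) =
        P.shuffle A (CTensor.tmul (ν.ad g x) (CTensor.tmul (α g a) k')) := by
    intro g x a k k' hk
    change sandwich A _ _ (CTensor.map _ _ _) = _
    rw [HTensor.shuffle_tmul, HTensor.shuffle_tmul, CTensor.map_tmul, sandwich_tmul,
      SepRep.opU_tensor, NonUnitalStarAlgHom.coe_id, id, P.K_sandwich_tensK]
    congr 2
    refine K.ext fun ξ => ?_
    rw [K.sandwich_op, hk]
    exact congrArg (fun y => μ.U g (k.op y)) (one_adjoint_apply ξ)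
  refine forall_congr' fun g => ?_
  constructor
  · intro h
    have hcl : IsClosed {p : CTensor (K ν.H) (CTensor A (K μ.H)) ×
        CTensor (K ν.H) (CTensor A (K μ.H)) | F g (P.shuffle A p.1) = P.shuffle A p.2} :=
      isClosed_eq ((hFc g).comp (P.continuous_shuffle.comp continuous_fst))
        (P.continuous_shuffle.comp continuous_snd)
    refine closure_minimal (fun p hp => ?_) hcl h
    induction hp using Submodule.span_induction with
    | mem p hp =>
      obtain ⟨x, a, k, k', hk, rfl⟩ := hp
      exact hF g x a k k' hk
    | zero =>
      change sandwich A _ _ (CTensor.map _ _ (P.shuffle A 0)) = P.shuffle A 0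
      simp only [map_zero]
    | add p q _ _ hp hq =>
      change sandwich A _ _ (CTensor.map _ _ (P.shuffle A (p.1 + q.1))) = P.shuffle A (p.2 + q.2)
      rw [map_add, map_add, map_add, map_add]
      exact congrArg₂ _ hp hq
    | smul c p _ hp =>
      change sandwich A _ _ (CTensor.map _ _ (P.shuffle A (c • p.1))) = P.shuffle A (c • p.2)
      rw [map_smul, map_smul, map_smul, map_smul]
      exact congrArg _ hp
  · intro h
    have key : ∀ z : CTensor (K ν.H) (CTensor A (K μ.H)),
        (z, (P.shuffleEquiv A).symm (F g (P.shuffle A z))) ∈ (Submodule.span ℂ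
          {p : CTensor (K ν.H) (CTensor A (K μ.H)) × CTensor (K ν.H) (CTensor A (K μ.H)) |
            ∃ (x : K ν.H) (a : A) (k k' : K μ.H), (∀ ξ, k'.op ξ = μ.U g (k.op ξ)) ∧
              p = (CTensor.tmul x (CTensor.tmul a k), CTensor.tmul (ν.ad g x)
                (CTensor.tmul (α g a) k'))}).topologicalClosure := by
      have hc : Continuous fun z : CTensor (K ν.H) (CTensor A (K μ.H)) =>
          (z, (P.shuffleEquiv A).symm (F g (P.shuffle A z))) :=
        continuous_id.prodMk (P.continuous_shuffle_symm.comp ((hFc g).comp P.continuous_shuffle))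
      have h0 : (P.shuffleEquiv A).symm (F g (P.shuffle A 0)) = 0 := by
        change (P.shuffleEquiv A).symm (sandwich A _ _ (CTensor.map _ _ (P.shuffle A 0))) = 0
        simp only [map_zero]
      have hadd : ∀ x y, (P.shuffleEquiv A).symm (F g (P.shuffle A (x + y))) =
          (P.shuffleEquiv A).symm (F g (P.shuffle A x)) +
            (P.shuffleEquiv A).symm (F g (P.shuffle A y)) := fun x y => by
        change (P.shuffleEquiv A).symm (sandwich A _ _ (CTensor.map _ _ (P.shuffle A (x + y)))) = _
        rw [map_add, map_add, map_add, map_add]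
      intro z
      induction z using CTensor.induction_tmul with
      | hc => exact (Submodule.isClosed_topologicalClosure _).preimage hc
      | h0 => rw [h0]; exact Submodule.zero_mem _
      | hadd x y hx hy => rw [hadd]; exact Submodule.add_mem _ hx hy
      | h x y =>
        induction y using CTensor.induction_tmul with
        | hc =>
          exact (Submodule.isClosed_topologicalClosure _).preimage
            (hc.comp (CTensor.continuous_tmul_right x))
        | h0 => rw [CTensor.tmul_zero, h0]; exact Submodule.zero_mem _
        | hadd y y' hy hy' => rw [CTensor.tmul_add, hadd]; exact Submodule.add_mem _ hy hy'
        | h a k =>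
          let k' : K μ.H := K.ofOp (μ.opU g ∘L k.op) (k.isCompact.clm_comp _)
          rw [hF g x a k k' fun ξ => rfl, HTensor.symm_shuffle_apply]
          exact Submodule.le_topologicalClosure _
            (Submodule.subset_span ⟨x, a, k, k', fun ξ => rfl, rfl⟩)
    have h1 : F g (P.shuffle A d) = P.shuffle A d := h
    have h2 := key d
    rwa [h1, HTensor.symm_shuffle_apply] at h2

theorem HTensor.tendsto_shuffle_iff {H L T : Type*} [NormedAddCommGroup H] [InnerProductSpace ℂ H]
    [CompleteSpace H] [NormedAddCommGroup L] [InnerProductSpace ℂ L] [CompleteSpace L]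
    [NormedAddCommGroup T] [InnerProductSpace ℂ T] [CompleteSpace T] (P : HTensor H L T)
    {f : ℕ → CTensor (K H) (CTensor A (K L))} {x : CTensor (K H) (CTensor A (K L))} :
    Filter.Tendsto (fun n => P.shuffle A (f n)) Filter.atTop (𝓝 (P.shuffle A x)) ↔
      Filter.Tendsto f Filter.atTop (𝓝 x) := by
  have h : Isometry (P.shuffle A) := AddMonoidHomClass.isometry_of_norm _
    (NonUnitalStarAlgHom.norm_map _ P.shuffle_bijective.1)
  exact (h.isEmbedding.tendsto_nhds_iff (f := f)).symm

end Twisted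

section Compression

variable {G : Type*} [Group G] [TopologicalSpace G]
variable {A : Type*} [NonUnitalCStarAlgebra A] {α : CAction G A}
variable (ν ρ μ : SepRep G)

/-- The trivial representation on the space of `μ`. -/
abbrev SepRep.triv (μ : SepRep G) : SepRep G := SepRep.trivial μ.H

/-- The inclusion of `H_ν ⊗ H_μ` in `(H_ν ⊕ H_ρ) ⊗ H_μ`. -/
def twistInl : (ν.tensor μ).H →ₗᵢ[ℂ] ((ν.sum ρ).tensor μ).H :=
  (ν.hT μ).isom ((ν.sum ρ).hT μ) (ν.inl ρ) LinearIsometry.id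

/-- The Hilbert space of `ρ ⊗ triv`, as a tensor product of `H_ρ` and the space of `μ` itself. -/
def SepRep.hTTriv : HTensor ρ.H μ.H (ρ.tensor μ.triv).H := ρ.hT μ.triv

/-- The inclusion of `H_ρ ⊗ H_μ` in `(H_ν ⊕ H_ρ) ⊗ H_μ`, where `ρ` is tensored with the trivial
representation. -/
def twistInr : (ρ.tensor μ.triv).H →ₗᵢ[ℂ] ((ν.sum ρ).tensor μ).H :=
  (ρ.hTTriv μ).isom ((ν.sum ρ).hT μ) (ν.inr ρ) LinearIsometry.id

/-- The operator which carries the first summand of `(H_ν ⊗ H_μ) ⊕ (H_ρ ⊗ H_μ)` into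
`(H_ν ⊕ H_ρ) ⊗ H_μ`. -/
def twistX : ((ν.tensor μ).sum (ρ.tensor μ.triv)).H →L[ℂ] ((ν.sum ρ).tensor μ).H :=
  (twistInl ν ρ μ).toContinuousLinearMap ∘L
    ((ν.tensor μ).inl (ρ.tensor μ.triv)).toContinuousLinearMap.adjoint

/-- The operator which carries the second summand of `(H_ν ⊗ H_μ) ⊕ (H_ρ ⊗ H_μ)` into
`(H_ν ⊕ H_ρ) ⊗ H_μ`. -/
def twistY : ((ν.tensor μ).sum (ρ.tensor μ.triv)).H →L[ℂ] ((ν.sum ρ).tensor μ).H :=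
  (twistInr ν ρ μ).toContinuousLinearMap ∘L
    ((ν.tensor μ).inr (ρ.tensor μ.triv)).toContinuousLinearMap.adjoint

theorem intertwines_twistX :
    ((ν.tensor μ).sum (ρ.tensor μ.triv)).Intertwines ((ν.sum ρ).tensor μ) (twistX ν ρ μ) :=
  (SepRep.Intertwines.isom (W := LinearIsometry.id) (SepRep.intertwines_inl ν ρ)
    (SepRep.Intertwines.id μ)).comp (SepRep.intertwines_inl _ _).adjoint

theorem intertwines_twistY :
    ((ν.tensor μ).sum (ρ.tensor μ.triv)).Intertwines ((ν.sum ρ).tensor μ.triv) (twistY ν ρ μ) :=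
  (SepRep.Intertwines.isom (W := LinearIsometry.id) (SepRep.intertwines_inr ν ρ)
    (SepRep.Intertwines.id μ.triv)).comp (SepRep.intertwines_inr _ _).adjoint

theorem opU_tensor_triv (g : G) : ((ν.sum ρ).tensor μ.triv).opU g =
    ((ν.sum ρ).hT μ).op ((ν.sum ρ).hT μ) ((ν.sum ρ).opU g) (ContinuousLinearMap.id ℂ μ.H) :=
  (ν.sum ρ).opU_tensor μ.triv g

theorem isMixedInvariant_sandwich
    {z : CTensor (K ((ν.tensor μ).sum (ρ.tensor μ.triv)).H) A}
    (hz : ∀ g, stabAction ((ν.tensor μ).sum (ρ.tensor μ.triv)) α g z = z) :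
    IsMixedInvariant α (ν.sum ρ) μ (sandwich A (twistX ν ρ μ) (twistY ν ρ μ) z) := fun g => by
  have h1 := (intertwines_twistX ν ρ μ).comp_opU g
  have h2 := (intertwines_twistY ν ρ μ).comp_opU g
  rw [opU_tensor_triv] at h2
  refine (sandwich_map_sandwich h1 h2 (α g) z).trans ?_
  rw [← stabAction_eq_sandwich, hz]

theorem IsMixedInvariant.stabAction_sandwich_adjoint
    {z : CTensor (K ((ν.sum ρ).tensor μ).H) A} (hz : IsMixedInvariant α (ν.sum ρ) μ z) (g : G) :
    stabAction ((ν.tensor μ).sum (ρ.tensor μ.triv)) α g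
      (sandwich A (twistX ν ρ μ).adjoint (twistY ν ρ μ).adjoint z) =
      sandwich A (twistX ν ρ μ).adjoint (twistY ν ρ μ).adjoint z := by
  have h1 := (intertwines_twistX ν ρ μ).adjoint.comp_opU g
  have h2 := (intertwines_twistY ν ρ μ).adjoint.comp_opU g
  rw [opU_tensor_triv] at h2
  rw [stabAction_eq_sandwich]
  exact (sandwich_map_sandwich h1 h2 (α g) z).trans (congrArg _ (hz g))

theorem twistX_comp_inl : twistX ν ρ μ ∘L
    ((ν.tensor μ).inl (ρ.tensor μ.triv)).toContinuousLinearMap =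
      (twistInl ν ρ μ).toContinuousLinearMap := by
  rw [twistX, ContinuousLinearMap.comp_assoc, isom_adjoint_comp, ContinuousLinearMap.comp_id]

theorem twistY_comp_inr : twistY ν ρ μ ∘L
    ((ν.tensor μ).inr (ρ.tensor μ.triv)).toContinuousLinearMap =
      (twistInr ν ρ μ).toContinuousLinearMap := by
  rw [twistY, ContinuousLinearMap.comp_assoc, isom_adjoint_comp, ContinuousLinearMap.comp_id]

theorem twistX_adjoint_comp : (twistX ν ρ μ).adjoint ∘L (twistInl ν ρ μ).toContinuousLinearMap =
    ((ν.tensor μ).inl (ρ.tensor μ.triv)).toContinuousLinearMap := by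
  rw [twistX, ContinuousLinearMap.adjoint_comp, ContinuousLinearMap.adjoint_adjoint,
    ContinuousLinearMap.comp_assoc, isom_adjoint_comp, ContinuousLinearMap.comp_id]

theorem twistY_adjoint_comp : (twistY ν ρ μ).adjoint ∘L (twistInr ν ρ μ).toContinuousLinearMap =
    ((ν.tensor μ).inr (ρ.tensor μ.triv)).toContinuousLinearMap := by
  rw [twistY, ContinuousLinearMap.adjoint_comp, ContinuousLinearMap.adjoint_adjoint,
    ContinuousLinearMap.comp_assoc, isom_adjoint_comp, ContinuousLinearMap.comp_id]

/-- The elements of `K((H_ν ⊕ H_ρ) ⊗ H_μ) ⊗ A` with source in the second summand and range in the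
first come from off-diagonal elements. -/
theorem symm_sandwich_mem_offDiag (z : CTensor (K ((ν.tensor μ).sum (ρ.tensor μ.triv)).H) A) :
    (((ν.sum ρ).hT μ).shuffleEquiv A).symm (sandwich A (twistX ν ρ μ) (twistY ν ρ μ) z) ∈
      offDiag ν ρ (CTensor A (K μ.H)) := by
  let P := (ν.sum ρ).hT μ
  let d := (P.shuffleEquiv A).symm (sandwich A (twistX ν ρ μ) (twistY ν ρ μ) z)
  have hX : P.op P ((ν.inl ρ).toContinuousLinearMap ∘L (ν.inl ρ).toContinuousLinearMap.adjoint)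
      (ContinuousLinearMap.id ℂ μ.H) ∘L twistX ν ρ μ = twistX ν ρ μ := by
    rw [twistX, ← ContinuousLinearMap.comp_assoc]
    congr 1
    refine (HTensor.op_comp _ _ _ _ _ _ _).trans ?_
    rw [ContinuousLinearMap.comp_assoc, isom_adjoint_comp, ContinuousLinearMap.comp_id]
    rfl
  have hY : P.op P ((ν.inr ρ).toContinuousLinearMap ∘L (ν.inr ρ).toContinuousLinearMap.adjoint)
      (ContinuousLinearMap.id ℂ μ.H) ∘L twistY ν ρ μ = twistY ν ρ μ := by
    rw [twistY, ← ContinuousLinearMap.comp_assoc]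
    congr 1
    refine (HTensor.op_comp _ _ _ _ _ _ _).trans ?_
    rw [ContinuousLinearMap.comp_assoc, isom_adjoint_comp, ContinuousLinearMap.comp_id]
    rfl
  have h : sandwich _ ((ν.inl ρ).toContinuousLinearMap ∘L (ν.inl ρ).toContinuousLinearMap.adjoint)
      ((ν.inr ρ).toContinuousLinearMap ∘L (ν.inr ρ).toContinuousLinearMap.adjoint) d = d := by
    apply P.shuffle_bijective.1
    rw [P.shuffle_sandwich P, HTensor.shuffle_symm_apply, sandwich_sandwich, hX, hY]
  have h1 := sandwich_mem_offDiag (A := CTensor A (K μ.H)) (μ := ν) (ν := ρ)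
    (ν.inl ρ).toContinuousLinearMap.adjoint (ν.inr ρ).toContinuousLinearMap.adjoint d
  rw [h] at h1
  exact h1

end Compression

section Cocycle

variable {G : Type*} [Group G] [TopologicalSpace G]
variable {A : Type*} [NonUnitalCStarAlgebra A] {α : CAction G A}

theorem ad_eq_adIsom (μ : SepRep G) (g : G) : μ.ad g = adIsom (μ.U g).toLinearIsometry := rfl

/-- The twisted Cuntz equivalence of `a` and `b` is the Cuntz equivalence of the corresponding
positive elements over `A`: under the isomorphism of `K(H_λ) ⊗ (A ⊗ K(H_μ))` with
`K(H_λ ⊗ H_μ) ⊗ A`, twisted invariance becomes invariance of operators from `H_ρ ⊗ H_μ` with the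
trivial action on `H_μ` to `H_ν ⊗ H_μ`. -/
theorem twistedEquiv_iff {μ : SepRep G} {a : PosElem (α.tensor μ.ad)}
    {b : PosElem (α.tensor (CAction.trivial (K μ.H)))} :
    TwistedEquiv a b ↔ CuntzEquiv (a.shuffle (ad_eq_adIsom μ))
      (b.shuffle (κ := SepRep.trivial μ.H) trivial_eq_adIsom) := by
  let ν := a.rep
  let ρ := b.rep
  let P := (ν.sum ρ).hT μ
  let X := twistX ν ρ μ
  let Y := twistY ν ρ μ
  let S := (ν.tensor μ).sum (ρ.tensor μ.triv)
  let I₁ := (ν.tensor μ).inl (ρ.tensor μ.triv)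
  let I₂ := (ν.tensor μ).inr (ρ.tensor μ.triv)
  let V₁ := twistInl ν ρ μ
  let V₂ := twistInr ν ρ μ
  let a' : CTensor (K (ν.tensor μ).H) A := (a.shuffle (ad_eq_adIsom μ)).val
  let b' : CTensor (K (ρ.tensor μ.triv).H) A :=
    (b.shuffle (κ := SepRep.trivial μ.H) trivial_eq_adIsom).val
  have ha : P.shuffle A (a.inl b.rep) = adA A V₁ a' := (ν.hT μ).shuffle_adA P (ν.inl ρ) a.val
  have hb : P.shuffle A (b.inr a.rep) = adA A V₂ b' :=
    (ρ.hTTriv μ).shuffle_adA P (ν.inr ρ) b.val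
  have c₁ : X ∘L I₁.toContinuousLinearMap = V₁.toContinuousLinearMap := twistX_comp_inl ν ρ μ
  have c₂ : Y ∘L I₂.toContinuousLinearMap = V₂.toContinuousLinearMap := twistY_comp_inr ν ρ μ
  have c₃ : X.adjoint ∘L V₁.toContinuousLinearMap = I₁.toContinuousLinearMap :=
    twistX_adjoint_comp ν ρ μ
  have c₄ : Y.adjoint ∘L V₂.toContinuousLinearMap = I₂.toContinuousLinearMap :=
    twistY_adjoint_comp ν ρ μ
  have c₅ : X.adjoint.adjoint ∘L I₁.toContinuousLinearMap = V₁.toContinuousLinearMap := by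
    rw [ContinuousLinearMap.adjoint_adjoint, c₁]
  have c₆ : Y.adjoint.adjoint ∘L I₂.toContinuousLinearMap = V₂.toContinuousLinearMap := by
    rw [ContinuousLinearMap.adjoint_adjoint, c₂]
  have s₁ : sandwich A X X (adA A I₁ a') = P.shuffle A (a.inl b.rep) := by
    rw [ha, adA_eq_sandwich, sandwich_sandwich, c₁, adA_eq_sandwich]
  have s₂ : sandwich A Y Y (adA A I₂ b') = P.shuffle A (b.inr a.rep) := by
    rw [hb, adA_eq_sandwich, sandwich_sandwich, c₂, adA_eq_sandwich]
  have s₃ : sandwich A X.adjoint X.adjoint (P.shuffle A (a.inl b.rep)) = adA A I₁ a' := by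
    rw [ha, adA_eq_sandwich, sandwich_sandwich, c₃, adA_eq_sandwich]
  have s₄ : sandwich A Y.adjoint Y.adjoint (P.shuffle A (b.inr a.rep)) = adA A I₂ b' := by
    rw [hb, adA_eq_sandwich, sandwich_sandwich, c₄, adA_eq_sandwich]
  have e₁ : CuntzLE (a.shuffle (ad_eq_adIsom μ))
      (b.shuffle (κ := SepRep.trivial μ.H) trivial_eq_adIsom) ↔
      Subeq (stabAction S α) (adA A I₁ a') (adA A I₂ b') :=
    cuntzLE_iff (SepRep.intertwines_inl _ _) (SepRep.intertwines_inr _ _)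
  have e₂ : CuntzLE (b.shuffle (κ := SepRep.trivial μ.H) trivial_eq_adIsom)
      (a.shuffle (ad_eq_adIsom μ)) ↔ Subeq (stabAction S α) (adA A I₂ b') (adA A I₁ a') :=
    cuntzLE_iff (SepRep.intertwines_inr _ _) (SepRep.intertwines_inl _ _)
  rw [TwistedEquiv, CuntzEquiv, e₁, e₂]
  refine and_congr ⟨?_, ?_⟩ ⟨?_, ?_⟩
  · rintro ⟨d, -, hd, hlim⟩
    refine ⟨fun n => sandwich A X.adjoint Y.adjoint (P.shuffle A (d n)),
      fun n => (isTwistedInvariant_iff.1 (hd n)).stabAction_sandwich_adjoint ν ρ μ, ?_⟩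
    have h1 := ((sandwich A X.adjoint X.adjoint).continuous.tendsto _).comp
      (P.tendsto_shuffle_iff.2 hlim)
    rw [s₃] at h1
    refine h1.congr fun n => ?_
    rw [sandwich_mul_adA_mul_star X.adjoint Y.adjoint I₂ V₂ c₆, ← hb, ← map_star, ← map_mul,
      ← map_mul]
    rfl
  · rintro ⟨E, hE, hlim⟩
    refine ⟨fun n => (P.shuffleEquiv A).symm (sandwich A X Y (E n)),
      fun n => symm_sandwich_mem_offDiag ν ρ μ (E n), fun n => ?_, ?_⟩
    · rw [isTwistedInvariant_iff, HTensor.shuffle_symm_apply]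
      exact isMixedInvariant_sandwich ν ρ μ (hE n)
    · rw [← P.tendsto_shuffle_iff, ← s₁]
      refine (((sandwich A X X).continuous.tendsto _).comp hlim).congr fun n => ?_
      rw [map_mul, map_mul, map_star, HTensor.shuffle_symm_apply, hb,
        sandwich_mul_adA_mul_star X Y V₂ I₂ c₄]
      rfl
  · rintro ⟨d, -, hd, hlim⟩
    refine ⟨fun n => star (sandwich A X.adjoint Y.adjoint (P.shuffle A (d n))), fun n g => ?_, ?_⟩
    · rw [map_star]
      exact congrArg star ((isTwistedInvariant_iff.1 (hd n)).stabAction_sandwich_adjoint ν ρ μ g)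
    · have h1 := ((sandwich A Y.adjoint Y.adjoint).continuous.tendsto _).comp
        (P.tendsto_shuffle_iff.2 hlim)
      rw [s₄] at h1
      refine h1.congr fun n => ?_
      beta_reduce
      rw [star_sandwich, sandwich_mul_adA_mul_star Y.adjoint X.adjoint I₁ V₁ c₅, ← ha, star_star,
        ← map_star, ← map_mul, ← map_mul]
      rfl
  · rintro ⟨E, hE, hlim⟩
    refine ⟨fun n => (P.shuffleEquiv A).symm (sandwich A X Y (star (E n))),
      fun n => symm_sandwich_mem_offDiag ν ρ μ (star (E n)), fun n => ?_, ?_⟩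
    · rw [isTwistedInvariant_iff, HTensor.shuffle_symm_apply]
      exact isMixedInvariant_sandwich ν ρ μ fun g => by rw [map_star, hE]
    · rw [← P.tendsto_shuffle_iff, ← s₂]
      refine (((sandwich A Y Y).continuous.tendsto _).comp hlim).congr fun n => ?_
      rw [map_mul, map_mul, map_star, HTensor.shuffle_symm_apply, ha]
      have h2 := sandwich_mul_adA_mul_star Y X V₁ I₁ c₃ (E n) a'
      have h3 : sandwich A X Y (star (E n)) = star (sandwich A Y X (E n)) := by
        rw [star_sandwich]
      rw [h3, star_star, h2]
      rfl

end Cocycle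

/-! ### The two stability isomorphisms -/

theorem separableSpace_l2 : TopologicalSpace.SeparableSpace (lp (fun _ : ℕ => ℂ) 2) := by
  rw [← TopologicalSpace.isSeparable_univ_iff]
  have h := ((Set.countable_range fun n : ℕ =>
    (lp.single 2 n (1 : ℂ) : lp (fun _ : ℕ => ℂ) 2)).isSeparable.span (R := ℂ)).closure
  refine h.mono fun f _ => ?_
  refine mem_closure_of_tendsto (lp.hasSum_single (by norm_num) f) (.of_forall fun s => ?_)
  refine Submodule.sum_mem _ fun i _ => ?_
  rw [← mul_one (f i), ← smul_eq_mul, lp.single_smul]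
  exact Submodule.smul_mem _ _ (Submodule.subset_span ⟨i, rfl⟩)

section

variable {G : Type*} [Group G] [TopologicalSpace G] [IsTopologicalGroup G] [CompactSpace G]
  [T2Space G]
variable {A : Type*} [NonUnitalCStarAlgebra A] {α : CAction G A}
variable {κ : SepRep G} {γ : CAction G (K κ.H)}

theorem CuG.isCCuGIso_of_absorb_eq [Nontrivial κ.H]
    (hγ : ∀ g, γ g = adIsom (κ.U g).toLinearIsometry) {f : CuG α → CuG (α.tensor γ)}
    (hf : ∀ x, absorb hγ (f x) = x) : IsCCuGIso (RepSemiring G) f := by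
  have h : f = (absorbEquiv hγ).symm := funext fun x =>
    ((absorbEquiv hγ).symm_apply_eq.2 (hf x).symm).symm
  have hsymm : ∀ x, absorb hγ ((absorbEquiv (α := α) hγ).symm x) = x :=
    (absorbEquiv hγ).apply_symm_apply
  rw [h]
  refine isCCuGIso_of_equiv _ (fun x y => ?_) (absorb_injective hγ ?_)
    (fun x y => absorb_injective hγ ?_) (fun r x => absorb_injective hγ ?_)
  · rw [← absorb_le_absorb hγ, hsymm, hsymm]
  · rw [hsymm, absorb_zero]
  · rw [absorb_add, hsymm, hsymm, hsymm]
  · rw [absorb_smul, hsymm, hsymm]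

end

section

variable {G : Type*} [Group G] [TopologicalSpace G]
variable {A : Type*} [NonUnitalCStarAlgebra A] {α : CAction G A}
variable {L : Type} [NormedAddCommGroup L] [InnerProductSpace ℂ L] [CompleteSpace L]
  [TopologicalSpace.SeparableSpace L]

/-- Absorption of a Hilbert space with the trivial action, written in terms of the Hilbert space
instead of the trivial representation on it. -/
def CuG.absorbTriv (x : CuG (α.tensor (CAction.trivial (K L)))) : CuG α :=
  absorb (κ := SepRep.trivial L) trivial_eq_adIsom x

theorem CuG.absorbTriv_injective : Function.Injective (absorbTriv (α := α) (L := L)) :=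
  absorb_injective (κ := SepRep.trivial L) _

theorem CuG.absorbTriv_le_absorbTriv (x y : CuG (α.tensor (CAction.trivial (K L)))) :
    absorbTriv x ≤ absorbTriv y ↔ x ≤ y :=
  absorb_le_absorb (κ := SepRep.trivial L) _ x y

theorem CuG.absorbTriv_zero : absorbTriv (0 : CuG (α.tensor (CAction.trivial (K L)))) = 0 :=
  absorb_zero (κ := SepRep.trivial L) _

theorem CuG.absorbTriv_add (x y : CuG (α.tensor (CAction.trivial (K L)))) :
    absorbTriv (x + y) = absorbTriv x + absorbTriv y :=
  absorb_add (κ := SepRep.trivial L) _ x y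

variable [IsTopologicalGroup G] [CompactSpace G] [T2Space G]

theorem CuG.absorbTriv_smul (r : RepSemiring G) (x : CuG (α.tensor (CAction.trivial (K L)))) :
    absorbTriv (r • x) = r • absorbTriv x :=
  absorb_smul (κ := SepRep.trivial L) _ r x

theorem CuG.absorbTriv_surjective [h : Nontrivial L] :
    Function.Surjective (absorbTriv (α := α) (L := L)) :=
  have : Nontrivial (SepRep.trivial (G := G) L).H := h
  absorb_surjective (κ := SepRep.trivial L) _

end

section

variable {G : Type*} [Group G] [TopologicalSpace G]
variable {A B : Type*} [NonUnitalCStarAlgebra A] [NonUnitalCStarAlgebra B] {α : CAction G A}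
  {β : CAction G B}
variable {L : Type} [NormedAddCommGroup L] [InnerProductSpace ℂ L] [CompleteSpace L]
  [TopologicalSpace.SeparableSpace L]

theorem CuG.map_tensorId_map_corner {q : K L} (hq : IsRankOneProjection q) (ψ : EquivHom α β)
    (x : CuG α) : CuG.map (ψ.tensorId (CAction.trivial (K L)))
      (CuG.map (EquivHom.corner α hq.1) x) =
        CuG.map (EquivHom.corner β hq.1) (CuG.map ψ x) := by
  refine absorbTriv_injective ?_
  refine (absorb_map (κ := SepRep.trivial L) trivial_eq_adIsom ψ _).trans ?_
  exact (congrArg _ (absorb_map_corner hq x)).trans (absorb_map_corner hq _).symm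

theorem CuG.isCCuGIso_map_corner [IsTopologicalGroup G] [CompactSpace G] [T2Space G] {q : K L}
    (hq : IsRankOneProjection q) :
    IsCCuGIso (RepSemiring G) (CuG.map (EquivHom.corner α hq.1)) :=
  have : Nontrivial (SepRep.trivial (G := G) L).H := hq.nontrivial
  isCCuGIso_of_absorb_eq (κ := SepRep.trivial L) trivial_eq_adIsom (absorb_map_corner hq)

end

section

variable {G : Type*} [Group G] [TopologicalSpace G]
variable {A : Type*} [NonUnitalCStarAlgebra A] {α : CAction G A} {μ : SepRep G}

/-- Absorption of `H_μ` turns the cocycle isomorphism into the identity of `Cu^G(A, α)`. -/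
theorem IsCocycleIso.absorb_apply
    {ε : CuG (α.tensor μ.ad) ≃ CuG (α.tensor (CAction.trivial (K μ.H)))} (hε : IsCocycleIso ε)
    (x : CuG (α.tensor μ.ad)) :
    CuG.absorbTriv (ε x) =
      CuG.absorb (ad_eq_adIsom μ) x := by
  obtain ⟨a, rfl⟩ := CuG.mk_surjective x
  obtain ⟨b, hb⟩ := CuG.mk_surjective (ε (CuG.mk a))
  rw [← hb]
  exact (CuG.mk_eq_mk.2 (twistedEquiv_iff.1 ((hε.2 a b).1 hb.symm))).symm

variable [IsTopologicalGroup G] [CompactSpace G] [T2Space G]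

theorem existsUnique_isCocycleIso [Nontrivial μ.H] :
    ∃! ε : CuG (α.tensor μ.ad) ≃ CuG (α.tensor (CAction.trivial (K μ.H))), IsCocycleIso ε := by
  let T := Equiv.ofBijective (CuG.absorbTriv (α := α) (L := μ.H))
    ⟨CuG.absorbTriv_injective, CuG.absorbTriv_surjective⟩
  let ε := (CuG.absorbEquiv (α := α) (ad_eq_adIsom μ)).trans T.symm
  have hT : Function.Injective (CuG.absorbTriv (α := α) (L := μ.H)) := CuG.absorbTriv_injective
  have hε : ∀ x, CuG.absorbTriv (ε x) = CuG.absorb (ad_eq_adIsom μ) x := fun x =>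
    T.apply_symm_apply _
  refine ⟨ε, ⟨isCCuGIso_of_equiv _ (fun x y => ?_) (hT ?_) (fun x y => hT ?_)
    (fun r x => hT ?_), fun a b => ?_⟩, fun δ hδ => Equiv.ext fun x => hT ?_⟩
  · rw [← CuG.absorbTriv_le_absorbTriv, hε, hε, CuG.absorb_le_absorb]
  · rw [hε, CuG.absorb_zero, CuG.absorbTriv_zero]
  · rw [CuG.absorbTriv_add, hε, hε, hε, CuG.absorb_add]
  · rw [CuG.absorbTriv_smul, hε, hε, CuG.absorb_smul]
  · rw [twistedEquiv_iff, ← CuG.mk_eq_mk, ← CuG.absorb_mk, ← hε]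
    exact hT.eq_iff.symm
  · rw [hδ.absorb_apply, hε]

theorem IsCocycleIso.absorb_symm_map_corner {q : K μ.H} (hq : IsRankOneProjection q)
    {ε : CuG (α.tensor μ.ad) ≃ CuG (α.tensor (CAction.trivial (K μ.H)))} (hε : IsCocycleIso ε)
    (x : CuG α) : CuG.absorb (ad_eq_adIsom μ)
      (ε.symm (CuG.map (EquivHom.corner α hq.1) x)) = x := by
  rw [← hε.absorb_apply, Equiv.apply_symm_apply]
  exact CuG.absorb_map_corner hq x

end

end EqCuntz
end

theorem mainTheorem9 (G : Type v) [Group G] [TopologicalSpace G] [IsTopologicalGroup G]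
    [CompactSpace G] [T2Space G] :
    -- stability under tensoring with the compact operators on `ℓ²(ℕ)` with the trivial action
    (∀ (q : EqCuntz.K (lp (fun _ : ℕ => ℂ) 2)) (hq : EqCuntz.IsRankOneProjection q),
      (∀ (A : Type u) [NonUnitalCStarAlgebra A] (α : EqCuntz.CAction G A),
        EqCuntz.IsCCuGIso (EqCuntz.RepSemiring G)
          (EqCuntz.CuG.map (EqCuntz.EquivHom.corner α hq.1))) ∧
      (∀ (A B : Type u) [NonUnitalCStarAlgebra A] [NonUnitalCStarAlgebra B]
        (α : EqCuntz.CAction G A) (β : EqCuntz.CAction G B) (ψ : EqCuntz.EquivHom α β)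
        (x : EqCuntz.CuG α),
        EqCuntz.CuG.map (ψ.tensorId (EqCuntz.CAction.trivial (EqCuntz.K (lp (fun _ : ℕ => ℂ) 2))))
            (EqCuntz.CuG.map (EqCuntz.EquivHom.corner α hq.1) x) =
          EqCuntz.CuG.map (EqCuntz.EquivHom.corner β hq.1) (EqCuntz.CuG.map ψ x))) ∧
    -- stability under tensoring with an inner action on the compact operators
    (∀ (μ : EqCuntz.SepRep G) (q : EqCuntz.K μ.H) (hq : EqCuntz.IsRankOneProjection q),
      (∀ (A : Type u) [CStarAlgebra A] (α : EqCuntz.CAction G A),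
        (∃! ε : EqCuntz.CuG (α.tensor μ.ad) ≃
            EqCuntz.CuG (α.tensor (EqCuntz.CAction.trivial (EqCuntz.K μ.H))),
          EqCuntz.IsCocycleIso ε) ∧
        ∀ ε : EqCuntz.CuG (α.tensor μ.ad) ≃
            EqCuntz.CuG (α.tensor (EqCuntz.CAction.trivial (EqCuntz.K μ.H))),
          EqCuntz.IsCocycleIso ε →
            EqCuntz.IsCCuGIso (EqCuntz.RepSemiring G)
              (fun x => ε.symm (EqCuntz.CuG.map (EqCuntz.EquivHom.corner α hq.1) x))) ∧
      (∀ (A B : Type u) [CStarAlgebra A] [CStarAlgebra B]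
        (α : EqCuntz.CAction G A) (β : EqCuntz.CAction G B) (ψ : EqCuntz.EquivHom α β)
        (ε : EqCuntz.CuG (α.tensor μ.ad) ≃
          EqCuntz.CuG (α.tensor (EqCuntz.CAction.trivial (EqCuntz.K μ.H))))
        (δ : EqCuntz.CuG (β.tensor μ.ad) ≃
          EqCuntz.CuG (β.tensor (EqCuntz.CAction.trivial (EqCuntz.K μ.H))))
        (_ : EqCuntz.IsCocycleIso ε) (_ : EqCuntz.IsCocycleIso δ) (x : EqCuntz.CuG α),
        EqCuntz.CuG.map (ψ.tensorId μ.ad)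
            (ε.symm (EqCuntz.CuG.map (EqCuntz.EquivHom.corner α hq.1) x)) =
          δ.symm (EqCuntz.CuG.map (EqCuntz.EquivHom.corner β hq.1) (EqCuntz.CuG.map ψ x)))) := by
  constructor
  · intro q hq
    have := EqCuntz.separableSpace_l2
    exact ⟨fun A _ α => EqCuntz.CuG.isCCuGIso_map_corner hq,
      fun A B _ _ α β ψ x => EqCuntz.CuG.map_tensorId_map_corner hq ψ x⟩
  · intro μ q hq
    have : Nontrivial μ.H := hq.nontrivial
    refine ⟨fun A _ α => ⟨EqCuntz.existsUnique_isCocycleIso, fun ε hε =>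
      EqCuntz.CuG.isCCuGIso_of_absorb_eq (EqCuntz.ad_eq_adIsom μ)
        (hε.absorb_symm_map_corner hq)⟩, fun A B _ _ α β ψ ε δ hε hδ x => ?_⟩
    refine EqCuntz.CuG.absorb_injective (EqCuntz.ad_eq_adIsom μ) ?_
    rw [EqCuntz.CuG.absorb_map, hε.absorb_symm_map_corner hq, hδ.absorb_symm_map_corner hq]
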